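/- **Setting.** For a finite directed graph $G=(V,E)$, $V\neq\emptyset$, with nonnegative integer edge lengths, let $d(u\to v)\in\mathbb N\cup\{\infty\}$ be the length of a shortest directed path from $u$ to $v$. The Min-eccentricity of $c\in V$ is $\max_{v\in V}\min\{d(c\to v),d(v\to c)\}$, and the Min-Radius is $$R(G)=\min_{c\in V}\max_{v\in V}\min\{d(c\to v),d(v\to c)\}\in\mathbb N\cup\{\infty\}.$$ An $\alpha$-approximation algorithm for Min-Radius outputs, on input $G$, a number $R^*\in\mathbb N\cup\{\infty\}$ with $R(G)\le R^*\le\alpha R(G)$. Algorithms are deterministic programs of a random access machine with words of $O(\log s)$ bits and unit cost operations on words, where $s$ is the length of the input plus the largest integer in it; graphs are given by their edge lists. The Hitting Set Conjecture states that there is no $\varepsilon>0$ such that for every $c\ge1$ there is an algorithm that, given two lists of $n$ subsets of a universe $U$ with $|U|\le c\log n$, decides in $O(n^{2-\varepsilon})$ time whether some set in the first list intersects every set in the second list. **Theorem.** 1. There are an algorithm and a constant $C$ such that, for every directed acyclic graph with $n\ge 1$ vertices, $m$ edges and edge lengths in $\{0,1,\dots,M\}$, $M\ge1$, the algorithm computes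 a $3$-approximation of the Min-Radius in time at most $C\,(m+1)\sqrt n\,\log(Mn+1)$ (that is, in time $O(m\sqrt n\log(Mn))$ whenever $m\ge1$). 2. Let $\delta,\varepsilon>0$ and $K>1$. If there is a $(2-\delta)$-approximation algorithm for Min-Radius that runs in $O(n^{2-\varepsilon})$ time on all unweighted directed acyclic graphs (all edge lengths equal to $1$) with $n\ge 1$ vertices and at most $Kn$ edges, then the Hitting Set Conjecture is false. -/

import Mathlib

namespace MinRad

/-! ## The machine model: a random access machine with unit-cost words

A program is a finite structured program over registers `0, 1, 2, …` and arrays `0, 1, 2, …`, all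
holding natural numbers. A program mentions finitely many registers and finitely many arrays
(which could be interleaved in one memory), and every array cell is reached in one step through
indirect addressing. Every number computed has to fit into a machine word. -/

/-- The binary word operations. -/
inductive BinOp where
  | add | sub | mul | div | mod | land | lor | xor | shl | shr

/-- Value of a binary operation (subtraction is truncated at `0`, and `x / 0 = 0`). -/
def BinOp.eval : BinOp → ℕ → ℕ → ℕ
  | .add, x, y => x + y
  | .sub, x, y => x - y
  | .mul, x, y => x * y
  | .div, x, y => x / y
  | .mod, x, y => x % y
  | .land, x, y => x &&& y
  | .lor, x, y => x ||| y
  | .xor, x, y => x ^^^ y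
  | .shl, x, y => x <<< y
  | .shr, x, y => x >>> y

/-- Programs. -/
inductive Prog where
  /-- do nothing -/
  | skip : Prog
  /-- `reg x := k` -/
  | const (x k : ℕ) : Prog
  /-- `reg x := o (reg y) (reg z)` -/
  | op (o : BinOp) (x y z : ℕ) : Prog
  /-- `reg x := arr a [reg y]` -/
  | load (x a y : ℕ) : Prog
  /-- `arr a [reg y] := reg z` -/
  | store (a y z : ℕ) : Prog
  /-- first `p`, then `q` -/
  | seq (p q : Prog) : Prog
  /-- if `reg y < reg z` then `p` else `q` -/
  | cond (y z : ℕ) (p q : Prog) : Prog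
  /-- while `reg y < reg z` do `p` -/
  | loop (y z : ℕ) (p : Prog) : Prog

/-- A configuration of the memory. -/
structure State where
  reg : ℕ → ℕ
  arr : ℕ → ℕ → ℕ

/-- Write `v` into register `x`. -/
def State.setReg (s : State) (x v : ℕ) : State :=
  { s with reg := Function.update s.reg x v }

/-- Write `v` into cell `i` of array `a`. -/
def State.setArr (s : State) (a i v : ℕ) : State :=
  { s with arr := Function.update s.arr a (Function.update (s.arr a) i v) }

/-- `Exec B p s t s'`: started in `s`, the program `p` halts in `s'` after exactly `t` steps, and
no number that it computes on the way exceeds `B`. Every elementary instruction and every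
evaluation of a test is one step. -/
inductive Exec (B : ℕ) : Prog → State → ℕ → State → Prop where
  | skip (s : State) : Exec B .skip s 1 s
  | const (s : State) (x k : ℕ) (h : k ≤ B) : Exec B (.const x k) s 1 (s.setReg x k)
  | op (s : State) (o : BinOp) (x y z : ℕ) (h : o.eval (s.reg y) (s.reg z) ≤ B) :
      Exec B (.op o x y z) s 1 (s.setReg x (o.eval (s.reg y) (s.reg z)))
  | load (s : State) (x a y : ℕ) :
      Exec B (.load x a y) s 1 (s.setReg x (s.arr a (s.reg y)))
  | store (s : State) (a y z : ℕ) :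
      Exec B (.store a y z) s 1 (s.setArr a (s.reg y) (s.reg z))
  | seq {p q : Prog} {s s' s'' : State} {t t' : ℕ} (hp : Exec B p s t s')
      (hq : Exec B q s' t' s'') : Exec B (.seq p q) s (t + t') s''
  | cond_true {y z : ℕ} {p q : Prog} {s s' : State} {t : ℕ} (h : s.reg y < s.reg z)
      (hp : Exec B p s t s') : Exec B (.cond y z p q) s (t + 1) s'
  | cond_false {y z : ℕ} {p q : Prog} {s s' : State} {t : ℕ} (h : ¬ s.reg y < s.reg z)
      (hq : Exec B q s t s') : Exec B (.cond y z p q) s (t + 1) s'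
  | loop_done {y z : ℕ} {p : Prog} {s : State} (h : ¬ s.reg y < s.reg z) :
      Exec B (.loop y z p) s 1 s
  | loop_step {y z : ℕ} {p : Prog} {s s' s'' : State} {t t' : ℕ} (h : s.reg y < s.reg z)
      (hp : Exec B p s t s') (hl : Exec B (.loop y z p) s' t' s'') :
      Exec B (.loop y z p) s (t + t' + 1) s''

/-- Initial configuration: the input is in array `0`, everything else is `0`. -/
def initState (x : List ℕ) : State where
  reg := fun _ => 0
  arr := fun a i => if a = 0 then x.getD i 0 else 0

/-- The length of the input plus its largest entry. -/
def inputSize (x : List ℕ) : ℕ := x.length + x.foldr max 0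

/-- On input `x` the program `P` halts after at most `T` steps, in a configuration that satisfies
`post`, and it only computes numbers bounded by `(inputSize x + 2) ^ κ`, that is, it works with
words of `κ * log₂ (inputSize x + 2)` bits. -/
def RunsWithin (P : Prog) (κ : ℕ) (x : List ℕ) (T : ℝ) (post : State → Prop) : Prop :=
  ∃ (t : ℕ) (s : State),
    Exec ((inputSize x + 2) ^ κ) P (initState x) t s ∧ (t : ℝ) ≤ T ∧ post s

/-- The answer "yes" / "no" of a decision algorithm: register `0` holds `1` / `0`. -/
def State.Decides (s : State) (Q : Prop) : Prop :=
  (Q → s.reg 0 = 1) ∧ (¬ Q → s.reg 0 = 0)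

/-- The number in `ℕ ∪ {∞}` that is output: `∞` if register `0` holds `0`, and the content of
register `1` otherwise. -/
def State.output (s : State) : ℕ∞ := if s.reg 0 = 0 then ⊤ else (s.reg 1 : ℕ∞)

/-! ## Weighted directed graphs and the Min-Radius -/

/-- A finite simple directed graph with vertex set `{0, …, n - 1}` and nonnegative integer edge
lengths, given by the list of its edges `(source, target, length)`. -/
structure WDigraph where
  n : ℕ
  edges : List (Fin n × Fin n × ℕ)
  simple : (edges.map fun e => (e.1, e.2.1)).Nodup

namespace WDigraph

/-- The number of edges. -/
def m (G : WDigraph) : ℕ := G.edges.length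

/-- There is an edge from `u` to `v`. -/
def Adj (G : WDigraph) (u v : Fin G.n) : Prop := ∃ w, (u, v, w) ∈ G.edges

/-- The graph has no directed cycle. -/
def IsDAG (G : WDigraph) : Prop := ∀ v, ¬ Relation.TransGen G.Adj v v

/-- There is a directed walk from `u` to `v` of total length `ℓ`. -/
inductive Walk (G : WDigraph) : Fin G.n → Fin G.n → ℕ → Prop where
  | nil (v : Fin G.n) : Walk G v v 0
  | cons {u v x : Fin G.n} {w ℓ : ℕ} (h : (u, v, w) ∈ G.edges) (p : Walk G v x ℓ) :
      Walk G u x (w + ℓ)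

/-- The distance from `u` to `v` (`⊤` if `v` cannot be reached from `u`). -/
noncomputable def dist (G : WDigraph) (u v : Fin G.n) : ℕ∞ :=
  ⨅ (ℓ : ℕ) (_ : G.Walk u v ℓ), (ℓ : ℕ∞)

/-- The Min-eccentricity of `c`. -/
noncomputable def minEcc (G : WDigraph) (c : Fin G.n) : ℕ∞ :=
  ⨆ v, min (G.dist c v) (G.dist v c)

/-- The Min-Radius. -/
noncomputable def minRadius (G : WDigraph) : ℕ∞ := ⨅ c, G.minEcc c

/-- The input given to a machine: `n`, `m`, and then source, target and length of every edge. -/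
def encode (G : WDigraph) : List ℕ :=
  G.n :: G.m :: G.edges.flatMap fun e => [e.1.val, e.2.1.val, e.2.2]

end WDigraph

/-- `r` is an `α`-approximation of `R`, i.e. `R ≤ r ≤ α R`; if `R = ∞` and `α > 0`, this says
that `r = ∞`. -/
def IsApprox (α : ℝ) (R r : ℕ∞) : Prop :=
  R ≤ r ∧ (r : ENNReal) ≤ ENNReal.ofReal α * (R : ENNReal)

/-- The program `P`, with words of `κ * log₂ (inputSize + 2)` bits, is an `α`-approximation
algorithm for Min-Radius, running in at most `T G` steps, on the nonempty graphs `G` in the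
class `𝒢`. -/
def ApproximatesMinRadius (P : Prog) (κ : ℕ) (α : ℝ) (𝒢 : WDigraph → Prop)
    (T : WDigraph → ℝ) : Prop :=
  ∀ G : WDigraph, 1 ≤ G.n → 𝒢 G →
    RunsWithin P κ G.encode (T G) fun s => IsApprox α G.minRadius s.output

/-! ## The Hitting Set Conjecture -/

/-- Some set of the first list intersects every set of the second list. -/
def HasHittingSet {n d : ℕ} (A B : Fin n → Finset (Fin d)) : Prop :=
  ∃ i, ∀ j, (A i ∩ B j).Nonempty

/-- The characteristic vectors of a list of subsets of `{0, …, d - 1}`, one after the other. -/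
def encodeSets {n d : ℕ} (A : Fin n → Finset (Fin d)) : List ℕ :=
  (List.ofFn fun i => List.ofFn fun u : Fin d => if u ∈ A i then 1 else 0).flatten

/-- The input given to a machine: `n`, `d`, and the two lists of sets. -/
def encodeHSE {n d : ℕ} (A B : Fin n → Finset (Fin d)) : List ℕ :=
  n :: d :: (encodeSets A ++ encodeSets B)

/-- The Hitting Set Conjecture: there is no `ε > 0` such that for all `c ≥ 1` some algorithm
decides, for two lists of `n` subsets of a universe of size at most `c log n`, in time
`O(n ^ (2 - ε))` whether a set in the first list intersects every set in the second list. -/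
def HittingSetConjecture : Prop :=
  ¬ ∃ ε : ℝ, 0 < ε ∧ ∀ c : ℝ, 1 ≤ c → ∃ (P : Prog) (κ : ℕ) (C : ℝ),
    ∀ (n d : ℕ), 1 ≤ n → (d : ℝ) ≤ c * Real.logb 2 n →
      ∀ A B : Fin n → Finset (Fin d),
        RunsWithin P κ (encodeHSE A B) (C * (n : ℝ) ^ (2 - ε)) fun s =>
          s.Decides (HasHittingSet A B)

end MinRad

namespace MinRad

/-! ## Symbolic execution of programs -/

/-! Upper bound. Number the vertices of an acyclic graph in topological order. Edges go upwards, so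
the Min-distance satisfies the triangle inequality whenever the middle vertex lies between the other
two (`mdist_triangle`). Hence, if `w` is a vertex farthest from `x`, every `c` between `w` and `x`
has at least half the Min-eccentricity of `x` (`covered_of_between`): one exact eccentricity, which
costs linear time once the edges are sorted by source, settles all these `c` up to a factor of two.

Cut the order into at most `k` blocks of `k ≈ √n` consecutive vertices, tabulate all distances
inside blocks in time `O((n + m) k)`, and let `e x` be the eccentricity of `x` within its block. In
each block keep a set of unsettled candidates and pick a candidate `x` such that a quarter of the
candidates is at or before `x`, a quarter is at or after `x`, and a quarter has `e` at least `e x`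
(`exists_splits`). If the farthest vertex `w` lies before the block, the candidates up to `x` are
settled; if it lies after the block, those from `x` on; if it lies inside, the eccentricity of `x`
is `e x`, and the candidates with `e` at least `e x` are no better than `x`. Each case removes a
quarter, so `O(log k)` eccentricities per block suffice (`searchBlock_runs`), that is `O(√n log n)`
linear-time computations in all. The least eccentricity found is at most twice a finite radius, so
the factor 3 leaves room. Distances are truncated at a value `T` above twice every finite distance,
and the answer `T` is read as `∞`. If `n > 2m + 1`, there is an isolated vertex, the radius is `∞`,
and the program stops at once; otherwise `n = O(m + 1)`.

Lower bound. Let `L ≈ log n`. Every set `A k` becomes a path ("row") with `qL` edges, every set `B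
j` likewise, and the elements of the universe are vertices in between: the end of row `k` points to
the elements of `A k`, and an element points to the starts of the rows of the sets `B j` that
contain it. Hops by powers of two connect the first rows within `L` edges. One extra row, entered
from the end of every row, leads to all elements, and many pads hang off its first vertex. If `A i`
hits every `B j`, the end of row `i` has eccentricity at most `(q + 1) L` (`minRadius_le_of_hits`).
If there is no hitting set, every eccentricity is at least `2qL` (`exists_far`): from row `k` to the
end of the row of a set `B j` disjoint from `A k`, a walk has to traverse a further full row before
it reaches an element of `B j`, and vertices beyond the start of the extra row are incomparable to
some vertex because of the pads. For `q` large the ratio `2q / (q + 1)` exceeds `2 - δ`. The pads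
also push the number of edges per vertex below `K`, and the graph has only `O(n log² n)` vertices,
so a subquadratic algorithm stays subquadratic (`exists_rpow_bound`).

Programs. Both halves are proved for explicit machine programs. A weakest precondition with a step
counter evaluates straight-line code, loops are handled by invariants (`Runs.loop`, `Runs.for`), and
what a subprogram leaves unchanged is read off syntactically (`Exec.same`). -/

@[simp] theorem State.setReg_reg (s : State) (x v y : ℕ) :
    (s.setReg x v).reg y = if y = x then v else s.reg y := by
  simp [State.setReg, Function.update_apply]

@[simp] theorem State.setReg_arr (s : State) (x v : ℕ) : (s.setReg x v).arr = s.arr := rfl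

@[simp] theorem State.setArr_reg (s : State) (a i v : ℕ) : (s.setArr a i v).reg = s.reg := rfl

@[simp] theorem State.setArr_arr (s : State) (a i v b : ℕ) :
    (s.setArr a i v).arr b = if b = a then Function.update (s.arr a) i v else s.arr b := by
  simp [State.setArr, Function.update_apply]

theorem Exec.mono {B B' : ℕ} (hB : B ≤ B') {P : Prog} {s s' : State} {t : ℕ}
    (h : Exec B P s t s') : Exec B' P s t s' := by
  induction h with
  | skip s => exact .skip s
  | const s x k h => exact .const s x k (h.trans hB)
  | op s o x y z h => exact .op s o x y z (h.trans hB)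
  | load s x a y => exact .load s x a y
  | store s a y z => exact .store s a y z
  | seq _ _ ih₁ ih₂ => exact .seq ih₁ ih₂
  | cond_true h _ ih => exact .cond_true h ih
  | cond_false h _ ih => exact .cond_false h ih
  | loop_done h => exact .loop_done h
  | loop_step h _ _ ih₁ ih₂ => exact .loop_step h ih₁ ih₂

/-- The registers that a program may write. -/
def Prog.wregs : Prog → List ℕ
  | .skip => []
  | .const x _ => [x]
  | .op _ x _ _ => [x]
  | .load x _ _ => [x]
  | .store _ _ _ => []
  | .seq p q => p.wregs ++ q.wregs
  | .cond _ _ p q => p.wregs ++ q.wregs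
  | .loop _ _ p => p.wregs

/-- The arrays that a program may write. -/
def Prog.warrs : Prog → List ℕ
  | .skip => []
  | .const _ _ => []
  | .op _ _ _ _ => []
  | .load _ _ _ => []
  | .store a _ _ => [a]
  | .seq p q => p.warrs ++ q.warrs
  | .cond _ _ p q => p.warrs ++ q.warrs
  | .loop _ _ p => p.warrs

/-- `s` and `s'` agree on everything that `P` does not write. -/
structure Same (P : Prog) (s s' : State) : Prop where
  reg : ∀ x, x ∉ P.wregs → s'.reg x = s.reg x
  arr : ∀ a, a ∉ P.warrs → s'.arr a = s.arr a

theorem Same.refl (P : Prog) (s : State) : Same P s s := ⟨fun _ _ => rfl, fun _ _ => rfl⟩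

theorem Same.trans {P : Prog} {s s' s'' : State} (h : Same P s s') (h' : Same P s' s'') :
    Same P s s'' :=
  ⟨fun x hx => (h'.reg x hx).trans (h.reg x hx), fun a ha => (h'.arr a ha).trans (h.arr a ha)⟩

/-- The frame rule. The sets of written registers and arrays are computed from the program text, so
preservation facts about concrete programs reduce to `decide`. -/
theorem Exec.same {B : ℕ} {P : Prog} {s s' : State} {t : ℕ} (h : Exec B P s t s') :
    Same P s s' := by
  induction h with
  | skip s => exact .refl _ s
  | const s x k h => exact ⟨fun y hy => by simp_all [Prog.wregs], fun _ _ => rfl⟩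
  | op s o x y z h => exact ⟨fun y hy => by simp_all [Prog.wregs], fun _ _ => rfl⟩
  | load s x a y => exact ⟨fun y hy => by simp_all [Prog.wregs], fun _ _ => rfl⟩
  | store s a y z => exact ⟨fun _ _ => rfl, fun b hb => by simp_all [Prog.warrs]⟩
  | seq _ _ ih₁ ih₂ =>
    refine ⟨fun x hx => ?_, fun x hx => ?_⟩ <;> simp only [Prog.wregs, Prog.warrs, List.mem_append, not_or] at hx
    · rw [ih₂.reg x hx.2, ih₁.reg x hx.1]
    · rw [ih₂.arr x hx.2, ih₁.arr x hx.1]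
  | cond_true h _ ih =>
    refine ⟨fun x hx => ?_, fun x hx => ?_⟩ <;> simp only [Prog.wregs, Prog.warrs, List.mem_append, not_or] at hx
    · exact ih.reg x hx.1
    · exact ih.arr x hx.1
  | cond_false h _ ih =>
    refine ⟨fun x hx => ?_, fun x hx => ?_⟩ <;> simp only [Prog.wregs, Prog.warrs, List.mem_append, not_or] at hx
    · exact ih.reg x hx.2
    · exact ih.arr x hx.2
  | loop_done h => exact .refl _ _
  | loop_step h _ _ ih₁ ih₂ => exact ⟨fun x hx => (ih₂.reg x hx).trans (ih₁.reg x hx),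
      fun x hx => (ih₂.arr x hx).trans (ih₁.arr x hx)⟩

/-- From `s` the program halts within `T` steps in a state that satisfies `Q`. -/
def Runs (B : ℕ) (P : Prog) (s : State) (T : ℕ) (Q : State → Prop) : Prop :=
  ∃ t s', Exec B P s t s' ∧ t ≤ T ∧ Q s'

theorem Runs.imp {B : ℕ} {P : Prog} {s : State} {T T' : ℕ} {Q Q' : State → Prop}
    (h : Runs B P s T Q) (hT : T ≤ T') (hQ : ∀ s', Same P s s' → Q s' → Q' s') :
    Runs B P s T' Q' := by
  obtain ⟨t, s', he, ht, hq⟩ := h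
  exact ⟨t, s', he, ht.trans hT, hQ s' he.same hq⟩

/-- A weakest precondition, with a step counter that is passed on to the continuation. -/
def wp (B : ℕ) : Prog → (State → ℕ → Prop) → State → ℕ → Prop
  | .skip, K, s, t => K s (t + 1)
  | .const x k, K, s, t => k ≤ B ∧ K (s.setReg x k) (t + 1)
  | .op o x y z, K, s, t =>
    o.eval (s.reg y) (s.reg z) ≤ B ∧ K (s.setReg x (o.eval (s.reg y) (s.reg z))) (t + 1)
  | .load x a y, K, s, t => K (s.setReg x (s.arr a (s.reg y))) (t + 1)
  | .store a y z, K, s, t => K (s.setArr a (s.reg y) (s.reg z)) (t + 1)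
  | .seq p q, K, s, t => wp B p (wp B q K) s t
  | .cond y z p q, K, s, t =>
    (s.reg y < s.reg z → wp B p K s (t + 1)) ∧ (¬ s.reg y < s.reg z → wp B q K s (t + 1))
  | .loop y z p, K, s, t => ∃ t' s', Exec B (.loop y z p) s t' s' ∧ K s' (t + t')

theorem wp_seq {B : ℕ} {p q : Prog} {K : State → ℕ → Prop} {s : State} {t : ℕ} :
    wp B (.seq p q) K s t ↔ wp B p (wp B q K) s t := Iff.rfl

theorem wp_skip {B : ℕ} {K : State → ℕ → Prop} {s : State} {t : ℕ} :
    wp B .skip K s t ↔ K s (t + 1) := Iff.rfl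

theorem wp_const {B x k : ℕ} {K : State → ℕ → Prop} {s : State} {t : ℕ} :
    wp B (.const x k) K s t ↔ k ≤ B ∧ K (s.setReg x k) (t + 1) := Iff.rfl

theorem wp_op {B x y z : ℕ} {o : BinOp} {K : State → ℕ → Prop} {s : State} {t : ℕ} :
    wp B (.op o x y z) K s t ↔ o.eval (s.reg y) (s.reg z) ≤ B ∧
      K (s.setReg x (o.eval (s.reg y) (s.reg z))) (t + 1) := Iff.rfl

theorem wp_load {B x a y : ℕ} {K : State → ℕ → Prop} {s : State} {t : ℕ} :
    wp B (.load x a y) K s t ↔ K (s.setReg x (s.arr a (s.reg y))) (t + 1) := Iff.rfl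

theorem wp_store {B a y z : ℕ} {K : State → ℕ → Prop} {s : State} {t : ℕ} :
    wp B (.store a y z) K s t ↔ K (s.setArr a (s.reg y) (s.reg z)) (t + 1) := Iff.rfl

theorem wp_cond {B y z : ℕ} {p q : Prog} {K : State → ℕ → Prop} {s : State} {t : ℕ} :
    wp B (.cond y z p q) K s t ↔ (s.reg y < s.reg z → wp B p K s (t + 1)) ∧
      (¬ s.reg y < s.reg z → wp B q K s (t + 1)) := Iff.rfl

theorem wp_sound {B : ℕ} {P : Prog} : ∀ {K : State → ℕ → Prop} {s : State} {t : ℕ},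
    wp B P K s t → ∃ t' s', Exec B P s t' s' ∧ K s' (t + t') := by
  induction P with
  | skip => exact fun h => ⟨1, _, .skip _, h⟩
  | const x k => exact fun h => ⟨1, _, .const _ x k h.1, h.2⟩
  | op o x y z => exact fun h => ⟨1, _, .op _ o x y z h.1, h.2⟩
  | load x a y => exact fun h => ⟨1, _, .load _ x a y, h⟩
  | store a y z => exact fun h => ⟨1, _, .store _ a y z, h⟩
  | seq p q ihp ihq =>
    intro K s t h
    obtain ⟨t₁, s₁, h₁, k₁⟩ := ihp h
    obtain ⟨t₂, s₂, h₂, k₂⟩ := ihq k₁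
    exact ⟨t₁ + t₂, s₂, .seq h₁ h₂, by rwa [← add_assoc]⟩
  | cond y z p q ihp ihq =>
    intro K s t h
    by_cases c : s.reg y < s.reg z
    · obtain ⟨t₁, s₁, h₁, k₁⟩ := ihp (h.1 c)
      exact ⟨t₁ + 1, s₁, .cond_true c h₁, by rwa [add_comm t₁, ← add_assoc]⟩
    · obtain ⟨t₁, s₁, h₁, k₁⟩ := ihq (h.2 c)
      exact ⟨t₁ + 1, s₁, .cond_false c h₁, by rwa [add_comm t₁, ← add_assoc]⟩
  | loop y z p => exact fun h => h

/-- Lets an execution that is already known replace symbolic evaluation of a subprogram. For a loop,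
`wp` merely asks for such an execution, so loops always enter this way. -/
theorem wp_of_exec {B : ℕ} {P : Prog} {s s' : State} {t' : ℕ} (h : Exec B P s t' s') :
    ∀ {K : State → ℕ → Prop} {t : ℕ}, K s' (t + t') → wp B P K s t := by
  induction h with
  | skip s => exact fun h => h
  | const s x k h => exact fun h' => ⟨h, h'⟩
  | op s o x y z h => exact fun h' => ⟨h, h'⟩
  | load s x a y => exact fun h => h
  | store s a y z => exact fun h => h
  | seq _ _ ih₁ ih₂ => exact fun h => ih₁ (ih₂ (by rwa [add_assoc]))
  | cond_true h _ ih => exact fun h' => ⟨fun _ => ih (by rwa [add_assoc, add_comm 1]), fun c => absurd h c⟩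
  | cond_false h _ ih => exact fun h' => ⟨fun c => absurd c h, fun _ => ih (by rwa [add_assoc, add_comm 1])⟩
  | loop_done h => exact fun h' => ⟨1, _, .loop_done h, h'⟩
  | loop_step h hp hl _ _ => exact fun h' => ⟨_, _, .loop_step h hp hl, h'⟩

theorem Runs.of_wp {B : ℕ} {P : Prog} {s : State} {T : ℕ} {Q : State → Prop}
    (h : wp B P (fun s' t => t ≤ T ∧ Q s') s 0) : Runs B P s T Q := by
  obtain ⟨t', s', he, hk⟩ := wp_sound h
  exact ⟨t', s', he, by simpa using hk.1, hk.2⟩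

/-- The call rule: afterwards only the postcondition, the frame and the time bound of the subprogram
are remembered. -/
theorem Runs.wp {B : ℕ} {P : Prog} {s : State} {T : ℕ} {Q : State → Prop}
    {K : State → ℕ → Prop} {t : ℕ} (h : Runs B P s T Q)
    (hK : ∀ s' t', Same P s s' → Q s' → t' ≤ t + T → K s' t') : wp B P K s t := by
  obtain ⟨t', s', he, ht, hq⟩ := h
  exact wp_of_exec he (hK _ _ he.same hq (by omega))

theorem Runs.seq {B : ℕ} {P P' : Prog} {s : State} {T T' : ℕ} {Q Q' : State → Prop}
    (h : Runs B P s T Q) (h' : ∀ s', Same P s s' → Q s' → Runs B P' s' T' Q') :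
    Runs B (.seq P P') s (T + T') Q' := by
  obtain ⟨t, s', he, ht, hq⟩ := h
  obtain ⟨t', s'', he', ht', hq'⟩ := h' s' he.same hq
  exact ⟨t + t', s'', .seq he he', by omega, hq'⟩

/-- A loop with an invariant that is indexed by the number of rounds. -/
theorem Runs.loop {B y z N T : ℕ} {p : Prog} {s : State} (I : ℕ → State → Prop) (h0 : I 0 s)
    (hstep : ∀ i s', Same p s s' → I i s' → s'.reg y < s'.reg z →
      i < N ∧ MinRad.wp B p (fun s'' t => t ≤ T ∧ I (i + 1) s'') s' 0) :
    Runs B (.loop y z p) s (N * (T + 1) + 1) (fun s' => ∃ i ≤ N, I i s' ∧ ¬ s'.reg y < s'.reg z) := by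
  -- Induction on the number `k` of rounds that may still follow; `i + k = N` makes the invariant
  -- index grow as `k` shrinks.
  suffices H : ∀ k i s', i + k = N → Same p s s' → I i s' →
      Runs B (.loop y z p) s' (k * (T + 1) + 1)
        (fun s' => ∃ i ≤ N, I i s' ∧ ¬ s'.reg y < s'.reg z) from
    H N 0 s (by omega) (.refl _ _) h0
  intro k
  induction k with
  | zero =>
    intro i s' hi hs hI
    by_cases c : s'.reg y < s'.reg z
    · exact absurd (hstep i s' hs hI c).1 (by omega)
    · exact ⟨1, s', .loop_done c, by omega, i, by omega, hI, c⟩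
  | succ k ih =>
    intro i s' hi hs hI
    by_cases c : s'.reg y < s'.reg z
    · obtain ⟨t, s₁, he, ht, hI'⟩ := Runs.of_wp (hstep i s' hs hI c).2
      obtain ⟨t₂, s₂, he₂, ht₂, hq⟩ := ih (i + 1) s₁ (by omega) (hs.trans he.same) hI'
      exact ⟨t + t₂ + 1, s₂, .loop_step c he he₂, by rw [add_mul]; omega, hq⟩
    · exact ⟨1, s', .loop_done c, by rw [add_mul]; omega, i, by omega, hI, c⟩

/-- A loop that makes exactly `N` rounds. -/
theorem Runs.for {B y z N T : ℕ} {p : Prog} {s : State} (I : ℕ → State → Prop) (h0 : I 0 s)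
    (hlt : ∀ i s', Same p s s' → I i s' → (s'.reg y < s'.reg z ↔ i < N))
    (hstep : ∀ i s', Same p s s' → i < N → I i s' →
      MinRad.wp B p (fun s'' t => t ≤ T ∧ I (i + 1) s'') s' 0) :
    Runs B (.loop y z p) s (N * (T + 1) + 1) (I N) := by
  refine (Runs.loop I h0 fun i s' hs hI c => ?_).imp le_rfl fun s' hs => ?_
  · exact ⟨(hlt i s' hs hI).1 c, hstep i s' hs ((hlt i s' hs hI).1 c) hI⟩
  · rintro ⟨i, hi, hI, c⟩
    rw [hlt i s' ⟨hs.reg, hs.arr⟩ hI] at c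
    rwa [show N = i by omega]

/-- Run the programs of a list one after the other. -/
def Prog.block : List Prog → Prog
  | [] => .skip
  | [p] => p
  | p :: q :: l => .seq p (Prog.block (q :: l))

/-- `reg x := reg y` -/
def Prog.mov (x y : ℕ) : Prog := .op .lor x y y

/-- `reg x := reg x + 1`, with register `9` as a scratch register. -/
def Prog.inc (x : ℕ) : Prog := .seq (.const 9 1) (.op .add x x 9)

@[simp] theorem wp_mov {B x y : ℕ} {K : State → ℕ → Prop} {s : State} {t : ℕ} :
    wp B (.mov x y) K s t ↔ s.reg y ≤ B ∧ K (s.setReg x (s.reg y)) (t + 1) := by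
  simp [Prog.mov, wp, BinOp.eval]

/-! ## Truncated distances in edge lists -/

/-- Walks in a list of edges `(source, target, length)`. -/
inductive LWalk (E : List (ℕ × ℕ × ℕ)) : ℕ → ℕ → ℕ → Prop where
  | nil (v : ℕ) : LWalk E v v 0
  | cons {u v x w ℓ : ℕ} (h : (u, v, w) ∈ E) (p : LWalk E v x ℓ) : LWalk E u x (w + ℓ)

theorem LWalk.append {E : List (ℕ × ℕ × ℕ)} {u v x ℓ ℓ' : ℕ} (h : LWalk E u v ℓ)
    (h' : LWalk E v x ℓ') : LWalk E u x (ℓ + ℓ') := by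
  induction h with
  | nil v => simpa using h'
  | cons h _ ih => rw [add_assoc]; exact .cons h (ih h')

theorem LWalk.snoc {E : List (ℕ × ℕ × ℕ)} {u v x w ℓ : ℕ} (h : LWalk E u v ℓ)
    (h' : (v, x, w) ∈ E) : LWalk E u x (ℓ + w) := by
  simpa using h.append (.cons h' (.nil x))

theorem LWalk.le {E : List (ℕ × ℕ × ℕ)} (hE : ∀ e ∈ E, e.1 < e.2.1) {u v ℓ : ℕ}
    (h : LWalk E u v ℓ) : u ≤ v := by
  induction h with
  | nil v => exact le_rfl
  | cons h _ ih => exact (hE _ h).le.trans ih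

/-- Each edge raises the vertex by at least one, so a walk from `u` to `v` has at most `v - u`
edges. -/
theorem LWalk.length_le {E : List (ℕ × ℕ × ℕ)} (hE : ∀ e ∈ E, e.1 < e.2.1) {W : ℕ}
    (hW : ∀ e ∈ E, e.2.2 ≤ W) {u v ℓ : ℕ} (h : LWalk E u v ℓ) : ℓ + u * W ≤ v * W := by
  induction h with
  | nil v => simp
  | @cons u v x w ℓ h _ ih =>
    have h1 : u + 1 ≤ v := hE _ h
    have h2 : w ≤ W := hW _ h
    have h3 := Nat.mul_le_mul_right W h1
    rw [add_mul] at h3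
    omega

/-- The distance from `x` to `v`, truncated at `T`. -/
noncomputable def tdist (T : ℕ) (E : List (ℕ × ℕ × ℕ)) (x v : ℕ) : ℕ :=
  sInf {ℓ | LWalk E x v ℓ ∨ ℓ = T}

section
variable {T : ℕ} {E : List (ℕ × ℕ × ℕ)}

theorem tdist_le (x v : ℕ) : tdist T E x v ≤ T := Nat.sInf_le (Or.inr rfl)

theorem tdist_le_of_walk {x v ℓ : ℕ} (h : LWalk E x v ℓ) : tdist T E x v ≤ ℓ :=
  Nat.sInf_le (Or.inl h)

theorem tdist_cases (x v : ℕ) : LWalk E x v (tdist T E x v) ∨ tdist T E x v = T :=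
  Nat.sInf_mem (s := {ℓ | LWalk E x v ℓ ∨ ℓ = T}) ⟨T, Or.inr rfl⟩

theorem tdist_self (x : ℕ) : tdist T E x x = 0 := Nat.le_zero.1 (tdist_le_of_walk (.nil x))

/-- Truncation does no harm: if one summand is `T`, the right side is already as large as any
truncated distance. -/
theorem tdist_triangle (u c x : ℕ) : tdist T E u x ≤ tdist T E u c + tdist T E c x := by
  rcases tdist_cases (T := T) (E := E) u c with h | h
  · rcases tdist_cases (T := T) (E := E) c x with h' | h'
    · exact tdist_le_of_walk (h.append h')
    · exact (tdist_le _ _).trans (by omega)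
  · exact (tdist_le _ _).trans (by omega)

/-- The hypotheses are what a finished relaxation delivers: a value at most `T`, below the length of
every walk, and either `T` or the length of a walk. -/
theorem eq_tdist {x v d : ℕ} (h1 : d ≤ T) (h2 : ∀ ℓ, LWalk E x v ℓ → d ≤ ℓ)
    (h3 : LWalk E x v d ∨ d = T) : d = tdist T E x v := by
  apply le_antisymm
  · rcases tdist_cases (T := T) (E := E) x v with h | h
    · exact h2 _ h
    · rwa [h]
  · rcases h3 with h | h
    · exact tdist_le_of_walk h
    · rw [h]; exact tdist_le _ _

theorem tdist_eq_of_lt (hE : ∀ e ∈ E, e.1 < e.2.1) {x v : ℕ} (h : v < x) :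
    tdist T E x v = T := by
  rcases tdist_cases (T := T) (E := E) x v with h' | h'
  · exact absurd (h'.le hE) (by omega)
  · exact h'

/-- The truncated Min-distance. -/
noncomputable def mdist (T : ℕ) (E : List (ℕ × ℕ × ℕ)) (x v : ℕ) : ℕ :=
  min (tdist T E x v) (tdist T E v x)

theorem mdist_comm (x v : ℕ) : mdist T E x v = mdist T E v x := min_comm _ _

theorem mdist_self (x : ℕ) : mdist T E x x = 0 := by simp [mdist, tdist_self]

theorem mdist_le (x v : ℕ) : mdist T E x v ≤ T := (min_le_left _ _).trans (tdist_le _ _)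

/-- No walk goes downwards, so the other direction contributes `T` and drops out of the minimum. -/
theorem mdist_of_le (hE : ∀ e ∈ E, e.1 < e.2.1) {x v : ℕ} (h : x ≤ v) :
    mdist T E x v = tdist T E x v := by
  rcases h.eq_or_lt with rfl | h
  · simp [mdist]
  · rw [mdist, tdist_eq_of_lt hE h]
    exact min_eq_left (tdist_le _ _)

/-- The Min-distance is not a metric; the inequality is inherited from `tdist` because with `u ≤ c ≤
x` all three distances are taken in the same direction. -/
theorem mdist_triangle (hE : ∀ e ∈ E, e.1 < e.2.1) {u c x : ℕ} (h : u ≤ c) (h' : c ≤ x) :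
    mdist T E u x ≤ mdist T E u c + mdist T E c x := by
  rw [mdist_of_le hE h, mdist_of_le hE h', mdist_of_le hE (h.trans h')]
  exact tdist_triangle _ _ _

end

/-! ## Relaxing edges in topological order -/

/-- The state of a single-source computation on the vertices below `V`: `done` are the edges that
were relaxed, `S` are the lengths of the walks. -/
structure RelaxInv (V T : ℕ) (S : ℕ → ℕ → Prop) (done : List (ℕ × ℕ × ℕ)) (f : ℕ → ℕ) :
    Prop where
  closed : ∀ e ∈ done, f e.2.1 ≤ f e.1 + e.2.2
  sound : ∀ v < V, S v (f v) ∨ f v = T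
  le : ∀ v < V, f v ≤ T

/-- Since no relaxed edge starts at `b`, lowering `f b` cannot violate an inequality that was
established earlier, so one pass over the edges is enough. For soundness, `f a + w < f b ≤ T` rules
out `f a = T`. -/
theorem RelaxInv.relax_lt {V T : ℕ} {S : ℕ → ℕ → Prop} {done : List (ℕ × ℕ × ℕ)} {f : ℕ → ℕ}
    (h : RelaxInv V T S done f) {a b w : ℕ} (ha : a < V) (hb : b < V)
    (hS : ∀ ℓ, S a ℓ → S b (ℓ + w)) (hd : ∀ e ∈ done, e.1 ≠ b) (hab : a ≠ b)
    (hlt : f a + w < f b) :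
    RelaxInv V T S (done ++ [(a, b, w)]) (Function.update f b (f a + w)) := by
  have hle : ∀ v, Function.update f b (f a + w) v ≤ f v := fun v => by
    rw [Function.update_apply]; split_ifs with hv
    · subst hv; omega
    · exact le_rfl
  refine ⟨fun e he => ?_, fun v hv => ?_, fun v hv => (hle v).trans (h.le v hv)⟩
  · rw [List.mem_append, List.mem_singleton] at he
    rcases he with he | rfl
    · rw [Function.update_of_ne (hd e he)]
      exact (hle _).trans (h.closed e he)
    · simp only [Function.update_self, Function.update_of_ne hab]
      omega
  · rw [Function.update_apply]; split_ifs with hvb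
    · rcases h.sound a ha with h2 | h2
      · rw [hvb]; exact Or.inl (hS _ h2)
      · have := h.le b hb; omega
    · exact h.sound v hv

theorem RelaxInv.relax_ge {V T : ℕ} {S : ℕ → ℕ → Prop} {done : List (ℕ × ℕ × ℕ)} {f : ℕ → ℕ}
    (h : RelaxInv V T S done f) {a b w : ℕ} (hge : ¬ f a + w < f b) :
    RelaxInv V T S (done ++ [(a, b, w)]) f := by
  refine ⟨fun e he => ?_, h.sound, h.le⟩
  rw [List.mem_append, List.mem_singleton] at he
  rcases he with he | rfl
  · exact h.closed e he
  · simp only; omega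

/-- A feasible potential bounds walk lengths from below. This serves both the correctness of the
relaxations and the lower bound on distances in the reduction. -/
theorem LWalk.le_of_closed {E : List (ℕ × ℕ × ℕ)} {f : ℕ → ℕ}
    (hf : ∀ e ∈ E, f e.2.1 ≤ f e.1 + e.2.2) {u v ℓ : ℕ} (h : LWalk E u v ℓ) :
    f v ≤ f u + ℓ := by
  induction h with
  | nil v => simp
  | cons h _ ih => have := hf _ h; simp only at this; omega

theorem LWalk.le_of_closed_rev {E : List (ℕ × ℕ × ℕ)} {f : ℕ → ℕ}
    (hf : ∀ e ∈ E, f e.1 ≤ f e.2.1 + e.2.2) {u v ℓ : ℕ} (h : LWalk E u v ℓ) :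
    f u ≤ f v + ℓ := by
  induction h with
  | nil v => simp
  | cons h _ ih => have := hf _ h; simp only at this; omega

/-! ## The search for a centre -/

/-- The number of halving rounds, with ratio `3 / 4`. -/
def rounds : ℕ → ℕ
  | 0 => 0
  | N + 1 => rounds (3 * (N + 1) / 4) + 1
decreasing_by omega

theorem rounds_mono : ∀ {a b : ℕ}, a ≤ b → rounds a ≤ rounds b := by
  intro a b
  induction b using Nat.strong_induction_on generalizing a with
  | _ b ih =>
    intro h
    match a, b with
    | 0, _ => simp [rounds]
    | a + 1, b + 1 =>
      rw [rounds, rounds]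
      exact Nat.succ_le_succ (ih _ (by omega) (Nat.div_le_div_right (by omega)))

theorem rounds_lt {a b : ℕ} (hb : 0 < b) (h : 4 * a ≤ 3 * b) : rounds a < rounds b := by
  obtain ⟨b, rfl⟩ : ∃ c, b = c + 1 := ⟨b - 1, by omega⟩
  rw [rounds]
  exact Nat.lt_succ_of_le (rounds_mono (by omega))

/-- Every round divides the number by at least `4 / 3`; the summand 1 pays for the last round, from
a positive number to 0. -/
theorem rounds_le {N : ℕ} (hN : 1 ≤ N) : (rounds N : ℝ) ≤ 1 + Real.log N / Real.log (4 / 3) := by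
  have hl : 0 < Real.log (4 / 3) := Real.log_pos (by norm_num)
  induction N using Nat.strong_induction_on with
  | _ N ih =>
    obtain ⟨N, rfl⟩ : ∃ c, N = c + 1 := ⟨N - 1, by omega⟩
    rw [rounds]
    rcases Nat.eq_zero_or_pos (3 * (N + 1) / 4) with h | h
    · rw [h]
      simp only [rounds]
      have : 0 ≤ Real.log ((N + 1 : ℕ) : ℝ) := Real.log_natCast_nonneg _
      push_cast at this ⊢
      have := div_nonneg this hl.le
      linarith
    · have h1 := ih _ (by omega) h
      have h2 : ((3 * (N + 1) / 4 : ℕ) : ℝ) ≤ ((N + 1 : ℕ) : ℝ) / (4 / 3) := by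
        rw [le_div_iff₀ (by norm_num)]
        have : (3 * (N + 1) / 4) * 4 ≤ 3 * (N + 1) := Nat.div_mul_le_self _ _
        have : (((3 * (N + 1) / 4) * 4 : ℕ) : ℝ) ≤ ((3 * (N + 1) : ℕ) : ℝ) := by exact_mod_cast this
        push_cast at this ⊢
        linarith
      have h3 : Real.log ((3 * (N + 1) / 4 : ℕ) : ℝ) ≤ Real.log ((N + 1 : ℕ) : ℝ) - Real.log (4 / 3) := by
        rw [← Real.log_div (by positivity) (by norm_num)]
        exact Real.log_le_log (by exact_mod_cast h) h2
      have h4 := div_le_div_of_nonneg_right h3 hl.le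
      rw [sub_div, div_self hl.ne'] at h4
      push_cast at h1 h4 ⊢
      linarith

/-- The candidates for the centre. -/
def cands (e : ℕ → ℕ) (lo hi E : ℕ) : Finset ℕ := (Finset.Ico lo hi).filter fun y => e y < E

/-- `x` splits the candidates well. -/
def Splits (e : ℕ → ℕ) (C : Finset ℕ) (x : ℕ) : Prop :=
  C.card ≤ 4 * (C.filter fun y => e x ≤ e y).card ∧ C.card ≤ 4 * (C.filter fun y => y ≤ x).card ∧
    C.card ≤ 4 * (C.filter fun y => x ≤ y).card

/-- All bad elements lie in the upper set of the bad element with the least `f`, and by badness this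
upper set has fewer than a quarter of the elements. -/
theorem card_few (f : ℕ → ℕ) (C : Finset ℕ) :
    4 * (C.filter fun x => 4 * (C.filter fun y => f x ≤ f y).card < C.card).card ≤ C.card ∧
    (0 < C.card → 4 * (C.filter fun x => 4 * (C.filter fun y => f x ≤ f y).card < C.card).card < C.card) := by
  set D := C.filter fun x => 4 * (C.filter fun y => f x ≤ f y).card < C.card with hD
  rcases D.eq_empty_or_nonempty with h | h
  · simp [h]
  · obtain ⟨x, hx, hmin⟩ := D.exists_min_image f h
    have h1 : D ⊆ C.filter fun y => f x ≤ f y := fun y hy =>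
      Finset.mem_filter.2 ⟨(Finset.mem_filter.1 hy).1, hmin y hy⟩
    have h2 := Finset.card_le_card h1
    have h3 := (Finset.mem_filter.1 hx).2
    omega

/-- Each of the three conditions fails for fewer than a quarter of the candidates, so some candidate
satisfies all of them. -/
theorem exists_splits (e : ℕ → ℕ) {C : Finset ℕ} (hC : C.Nonempty) : ∃ x ∈ C, Splits e C x := by
  by_contra hcon
  push Not at hcon
  obtain ⟨M, hM⟩ := C.bddAbove
  have h0 := hC.card_pos
  have h1 := (card_few e C).2 h0
  have h2 := (card_few id C).2 h0
  -- Subtraction from the upper bound `M` reverses the order on `C`, which turns the same counting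
  -- lemma into the one for `y ≤ x`.
  have h3 := (card_few (fun y => M - y) C).2 h0
  set D1 := C.filter fun x => 4 * (C.filter fun y => e x ≤ e y).card < C.card
  set D2 := C.filter fun x => 4 * (C.filter fun y => id x ≤ id y).card < C.card
  set D3 := C.filter fun x => 4 * (C.filter fun y => M - x ≤ M - y).card < C.card
  have hsub : C ⊆ D1 ∪ D2 ∪ D3 := by
    intro x hx
    by_contra hx'
    simp only [Finset.mem_union, not_or] at hx'
    obtain ⟨⟨ha, hb⟩, hc⟩ := hx'
    refine hcon x hx ⟨?_, ?_, ?_⟩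
    · by_contra h; exact ha (Finset.mem_filter.2 ⟨hx, by omega⟩)
    · by_contra h
      refine hc (Finset.mem_filter.2 ⟨hx, ?_⟩)
      have : (C.filter fun y => M - x ≤ M - y) = C.filter fun y => y ≤ x := by
        apply Finset.filter_congr
        intro y hy
        have := hM hy; have := hM hx
        omega
      rw [this]; omega
    · by_contra h; exact hb (Finset.mem_filter.2 ⟨hx, by simpa using h⟩)
  have := Finset.card_le_card hsub
  have := Finset.card_union_le (D1 ∪ D2) D3
  have := Finset.card_union_le D1 D2
  omega

theorem card_of_splits {C C' D : Finset ℕ} (h : C.card ≤ 4 * D.card) (hD : D ⊆ C)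
    (hC' : C' ⊆ C \ D) : 4 * C'.card ≤ 3 * C.card := by
  have := Finset.card_le_card hC'
  rw [Finset.card_sdiff_of_subset hD] at this
  omega

theorem cands_shrink_e {e : ℕ → ℕ} {lo hi E x : ℕ} (h : Splits e (cands e lo hi E) x)
    (hE : e x < E) : 4 * (cands e lo hi (e x)).card ≤ 3 * (cands e lo hi E).card := by
  refine card_of_splits h.1 (Finset.filter_subset _ _) fun y hy => ?_
  simp only [cands, Finset.mem_filter, Finset.mem_sdiff] at hy ⊢
  exact ⟨⟨hy.1, hy.2.trans hE⟩, fun h => by omega⟩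

theorem cands_shrink_lo {e : ℕ → ℕ} {lo hi E x : ℕ} (h : Splits e (cands e lo hi E) x)
    (hx : lo ≤ x) : 4 * (cands e (x + 1) hi E).card ≤ 3 * (cands e lo hi E).card := by
  refine card_of_splits h.2.1 (Finset.filter_subset _ _) fun y hy => ?_
  simp only [cands, Finset.mem_filter, Finset.mem_sdiff, Finset.mem_Ico] at hy ⊢
  exact ⟨⟨⟨by omega, by omega⟩, hy.2⟩, fun h => by omega⟩

theorem cands_shrink_hi {e : ℕ → ℕ} {lo hi E x : ℕ} (h : Splits e (cands e lo hi E) x)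
    (hx : x ≤ hi) : 4 * (cands e lo x E).card ≤ 3 * (cands e lo hi E).card := by
  refine card_of_splits h.2.2 (Finset.filter_subset _ _) fun y hy => ?_
  simp only [cands, Finset.mem_filter, Finset.mem_sdiff, Finset.mem_Ico] at hy ⊢
  exact ⟨⟨⟨by omega, by omega⟩, hy.2⟩, fun h => by omega⟩

/-! ## The table of the distances inside blocks -/

/-- The edges that are stored in three arrays. -/
def edgeList (m : ℕ) (fa fb fw : ℕ → ℕ) : List (ℕ × ℕ × ℕ) :=
  (List.range m).map fun j => (fa j, fb j, fw j)

/-- Edges in topological order, and bounds for a machine word. -/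
structure Sorted (B n m k T W : ℕ) (fa fb fw : ℕ → ℕ) : Prop where
  lt : ∀ j < m, fa j < fb j
  lt_n : ∀ j < m, fb j < n
  mono : ∀ i j, i ≤ j → j < m → fa i ≤ fa j
  w_le : ∀ j < m, fw j ≤ W
  k_pos : 0 < k
  bound : T + W + n * k + m * k + n + m + k + 10 ≤ B

theorem Sorted.lt_of_mem {B n m k T W : ℕ} {fa fb fw : ℕ → ℕ} (h : Sorted B n m k T W fa fb fw) :
    ∀ e ∈ edgeList m fa fb fw, e.1 < e.2.1 := by
  intro e he
  obtain ⟨j, hj, rfl⟩ := List.mem_map.1 he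
  exact h.lt j (List.mem_range.1 hj)

theorem mem_edgeList {m : ℕ} {fa fb fw : ℕ → ℕ} {j : ℕ} (hj : j < m) :
    (fa j, fb j, fw j) ∈ edgeList m fa fb fw :=
  List.mem_map.2 ⟨j, List.mem_range.2 hj, rfl⟩

/-- The data that the later parts of the program read. -/
structure Ctx (n m k T : ℕ) (fa fb fw : ℕ → ℕ) (s : State) : Prop where
  r10 : s.reg 10 = n
  r11 : s.reg 11 = m
  r13 : s.reg 13 = T
  r14 : s.reg 14 = k
  a6 : s.arr 6 = fa
  a7 : s.arr 7 = fb
  a8 : s.arr 8 = fw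

theorem Ctx.same {n m k T : ℕ} {fa fb fw : ℕ → ℕ} {s s' : State} {P : Prog}
    (h : Ctx n m k T fa fb fw s) (hs : Same P s s')
    (hr : ∀ x ∈ [10, 11, 13, 14], x ∉ P.wregs) (ha : ∀ a ∈ [6, 7, 8], a ∉ P.warrs) :
    Ctx n m k T fa fb fw s' where
  r10 := (hs.reg 10 (hr 10 (by simp))).trans h.r10
  r11 := (hs.reg 11 (hr 11 (by simp))).trans h.r11
  r13 := (hs.reg 13 (hr 13 (by simp))).trans h.r13
  r14 := (hs.reg 14 (hr 14 (by simp))).trans h.r14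
  a6 := (hs.arr 6 (ha 6 (by simp))).trans h.a6
  a7 := (hs.arr 7 (ha 7 (by simp))).trans h.a7
  a8 := (hs.arr 8 (ha 8 (by simp))).trans h.a8

theorem Ctx.setReg {n m k T : ℕ} {fa fb fw : ℕ → ℕ} {s : State}
    (h : Ctx n m k T fa fb fw s) {x : ℕ} (v : ℕ) (hx : x ∉ [10, 11, 13, 14]) :
    Ctx n m k T fa fb fw (s.setReg x v) := by
  simp only [List.mem_cons, List.not_mem_nil, or_false, not_or] at hx
  exact ⟨by simp [Ne.symm hx.1, h.r10], by simp [Ne.symm hx.2.1, h.r11],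
    by simp [Ne.symm hx.2.2.1, h.r13], by simp [Ne.symm hx.2.2.2, h.r14], h.a6, h.a7, h.a8⟩

theorem forall_le_update {f g : ℕ → ℕ} {i v : ℕ} (h : ∀ j < i, f j = g j) (hv : v = g i) :
    ∀ j ≤ i, Function.update f i v j = g j := by
  intro j hj
  rw [Function.update_apply]
  split_ifs with hji
  · rw [hv, hji]
  · exact h j (by omega)

/-- The machine only tests `<`, so equality of the index of `v` in its block (register `21`) and the
column (register `22`) is tested by two nested comparisons. -/
def tableInitBody : Prog := .block [.op .div 21 20 14, .op .mod 21 21 14, .op .mod 22 20 14,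
  .store 10 20 13, .const 9 0, .cond 21 22 .skip (.cond 22 21 .skip (.store 10 20 9)), .inc 20]

/-- Array `10`, cell `v * k + ξ`: the distance from the vertex with index `ξ` in the block of `v`
to `v`. -/
def tableInit : Prog := .block [.const 20 0, .op .mul 23 10 14, .loop 20 23 tableInitBody]

theorem tableInit_runs {B n m k T W : ℕ} {fa fb fw : ℕ → ℕ} (hS : Sorted B n m k T W fa fb fw)
    {s : State} (hc : Ctx n m k T fa fb fw s) :
    Runs B tableInit s (n * k * 20 + 10) fun s' =>
      ∀ i < n * k, s'.arr 10 i = if i / k % k = i % k then 0 else T := by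
  have hb := hS.bound
  apply Runs.of_wp
  simp only [tableInit, Prog.block, wp_seq, wp_const, wp_op, BinOp.eval]
  refine ⟨by omega, by simp [hc.r10, hc.r14]; omega, ?_⟩
  refine Runs.wp (T := n * k * (19 + 1) + 1) (Runs.for (N := n * k) (I := fun i s' => s'.reg 20 = i ∧
    ∀ j < i, s'.arr 10 j = if j / k % k = j % k then 0 else T) ?_ ?_ ?_) ?_
  · simp
  · intro i s' hs hI
    have := hs.reg 23 (by decide)
    simp [hc.r10, hc.r14] at this
    rw [hI.1, this]
  · intro i s' hs hi hI
    have hc' := ((hc.setReg 0 (by decide)).setReg _ (by decide)).same hs (by decide) (by decide)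
    have h1 : i / k ≤ i := Nat.div_le_self _ _
    have h2 : i / k % k ≤ i / k := Nat.mod_le _ _
    have h3 : i % k ≤ i := Nat.mod_le _ _
    simp [tableInitBody, Prog.block, Prog.inc, wp, BinOp.eval, hc'.r13, hc'.r14, hI.1]
    refine ⟨by omega, by omega, by omega, fun h => ⟨by omega, by omega, ?_⟩,
      fun h => ⟨fun h' => ⟨by omega, by omega, ?_⟩, fun h' => ⟨by omega, by omega, ?_⟩⟩⟩
    · exact forall_le_update hI.2 (by rw [if_neg (by omega)])
    · exact forall_le_update hI.2 (by rw [if_neg (by omega)])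
    · exact forall_le_update hI.2 (by rw [if_pos (by omega)])
  · intro s' t' _ hQ ht
    exact ⟨by omega, hQ.2⟩

/-- Relax the edge from `reg 24` to `reg 25` of length `reg 26` in array `A`. -/
def relaxAt (A : ℕ) : Prog := .block [.load 27 A 24, .op .add 27 27 26, .load 28 A 25,
  .cond 27 28 (.store A 25 27) .skip]

/-- Round `i` relaxes the edge `i / k` in column `i % k` of the table; edges that leave their block
are skipped. -/
def tableRelaxBody : Prog := .block [.op .div 21 20 14, .op .mod 22 20 14, .load 24 6 21,
  .load 25 7 21, .load 26 8 21, .op .div 27 24 14, .op .div 28 25 14,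
  .cond 27 28 .skip (.block [.op .mul 24 24 14, .op .add 24 24 22, .op .mul 25 25 14,
    .op .add 25 25 22, relaxAt 10]), .inc 20]

def tableRelax : Prog := .block [.const 20 0, .op .mul 23 11 14, .loop 20 23 tableRelaxBody]

/-- The edges between the cells of the table. -/
def tableEdges (k : ℕ) (fa fb fw : ℕ → ℕ) (i : ℕ) : List (ℕ × ℕ × ℕ) :=
  ((List.range i).filter fun j => fa (j / k) / k = fb (j / k) / k).map fun j =>
    (fa (j / k) * k + j % k, fb (j / k) * k + j % k, fw (j / k))

theorem tableEdges_succ_of_eq {k : ℕ} {fa fb fw : ℕ → ℕ} {i : ℕ}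
    (h : fa (i / k) / k = fb (i / k) / k) : tableEdges k fa fb fw (i + 1) =
      tableEdges k fa fb fw i ++ [(fa (i / k) * k + i % k, fb (i / k) * k + i % k, fw (i / k))] := by
  simp [tableEdges, List.range_succ, List.filter_append, h]

theorem tableEdges_succ_of_ne {k : ℕ} {fa fb fw : ℕ → ℕ} {i : ℕ}
    (h : fa (i / k) / k ≠ fb (i / k) / k) :
    tableEdges k fa fb fw (i + 1) = tableEdges k fa fb fw i := by
  simp [tableEdges, List.range_succ, List.filter_append, h]

/-- The lengths of the walks that the table accounts for. -/
def TableWalk (E : List (ℕ × ℕ × ℕ)) (k i ℓ : ℕ) : Prop :=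
  LWalk E (i / k / k * k + i % k) (i / k) ℓ

theorem mul_add_lt {a n k x : ℕ} (ha : a < n) (hx : x < k) : a * k + x < n * k := by
  have := Nat.mul_le_mul_right k ha
  rw [Nat.succ_mul] at this
  omega

theorem mul_add_div' {a k x : ℕ} (hx : x < k) : (a * k + x) / k = a := by
  rw [mul_comm, Nat.mul_add_div (by omega), Nat.div_eq_of_lt hx, add_zero]

theorem mul_add_mod' {a k x : ℕ} (hx : x < k) : (a * k + x) % k = x := by
  rw [mul_comm, Nat.mul_add_mod, Nat.mod_eq_of_lt hx]

theorem mul_add_cancel {a b k x y : ℕ} (hx : x < k) (hy : y < k) (h : a * k + x = b * k + y) :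
    a = b ∧ x = y := by
  have h1 := congrArg (· / k) h
  have h2 := congrArg (· % k) h
  simp only [mul_add_div' hx, mul_add_div' hy, mul_add_mod' hx, mul_add_mod' hy] at h1 h2
  exact ⟨h1, h2⟩

/-- The table is one relaxation on `k` disjoint copies of the vertex set, one for each index of a
source within its block. The cells of the sources keep the value 0 because a relaxation only
succeeds if the old value is positive. -/
theorem tableRelax_runs {B n m k T W : ℕ} {fa fb fw : ℕ → ℕ} (hS : Sorted B n m k T W fa fb fw)
    {s : State} (hc : Ctx n m k T fa fb fw s)
    (h10 : ∀ i < n * k, s.arr 10 i = if i / k % k = i % k then 0 else T) :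
    Runs B tableRelax s (m * k * 30 + 10) fun s' =>
      (∀ i < n * k, i / k % k = i % k → s'.arr 10 i = 0) ∧
      RelaxInv (n * k) T (TableWalk (edgeList m fa fb fw) k) (tableEdges k fa fb fw (m * k))
        (s'.arr 10) := by
  have hb := hS.bound
  have hk := hS.k_pos
  apply Runs.of_wp
  simp only [tableRelax, Prog.block, wp_seq, wp_const, wp_op, BinOp.eval]
  refine ⟨by omega, by simp [hc.r11, hc.r14]; omega, ?_⟩
  refine Runs.wp (T := m * k * (29 + 1) + 1) (Runs.for (N := m * k) (I := fun i s' => s'.reg 20 = i ∧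
    (∀ i < n * k, i / k % k = i % k → s'.arr 10 i = 0) ∧
      RelaxInv (n * k) T (TableWalk (edgeList m fa fb fw) k) (tableEdges k fa fb fw i)
        (s'.arr 10)) ?_ ?_ ?_) ?_
  · refine ⟨by simp, fun i hi h => by simp [h10 i hi, h], fun e he => by simp [tableEdges] at he,
      fun i hi => ?_, fun i hi => ?_⟩
    · simp only [State.setReg_arr, h10 i hi]
      split_ifs with h
      · left
        rw [TableWalk, ← h, Nat.div_add_mod']
        exact .nil _
      · exact Or.inr rfl
    · simp only [State.setReg_arr, h10 i hi]; split_ifs <;> omega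
  · intro i s' hs hI
    have := hs.reg 23 (by decide)
    simp [hc.r11, hc.r14] at this
    rw [hI.1, this]
  · intro i s' hs hi hI
    have hc' := ((hc.setReg 0 (by decide)).setReg _ (by decide)).same hs (by decide) (by decide)
    obtain ⟨hi20, hz, hR⟩ := hI
    have hj : i / k < m := by rwa [Nat.div_lt_iff_lt_mul hk]
    have hx : i % k < k := Nat.mod_lt _ hk
    have hab := hS.lt _ hj
    have hbn := hS.lt_n _ hj
    have hw := hS.w_le _ hj
    have h1 : i / k ≤ i := Nat.div_le_self _ _
    have h2 := mul_add_lt (hab.trans hbn) hx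
    have h3 := mul_add_lt hbn hx
    have h4 := Nat.div_le_self (fa (i / k)) k
    have h5 := Nat.div_le_self (fb (i / k)) k
    have h6 := hR.le _ h2
    have h7 := Nat.div_le_div_right (c := k) hab.le
    simp [tableRelaxBody, relaxAt, Prog.block, Prog.inc, wp, BinOp.eval, hc'.r14, hc'.a6, hc'.a7, hc'.a8, hi20]
    refine ⟨by omega, by omega, by omega, by omega, fun h => ⟨by omega, by omega, hz, ?_⟩,
      fun h => ⟨by omega, by omega, by omega, by omega, by omega, fun h' => ⟨by omega, by omega, ?_, ?_⟩,
      fun h' => ⟨by omega, by omega, hz, ?_⟩⟩⟩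
    · rwa [tableEdges_succ_of_ne (by omega)]
    · intro v hv hv'
      rw [Function.update_apply]
      split_ifs with hvb
      · rw [← hvb, hz v hv hv'] at h'; omega
      · exact hz v hv hv'
    · rw [tableEdges_succ_of_eq (by omega)]
      refine hR.relax_lt h2 h3 ?_ ?_ ?_ h'
      · intro ℓ hℓ
        simp only [TableWalk, mul_add_div' hx, mul_add_mod' hx] at hℓ ⊢
        rw [show fb (i / k) / k = fa (i / k) / k by omega]
        exact hℓ.snoc (mem_edgeList hj)
      -- A treated edge in the same column has a source at most `fa (i / k)`, which is strictly
      -- before the target of the present edge.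
      · intro e he
        obtain ⟨i', hi', rfl⟩ := List.mem_map.1 he
        have hi'' := List.mem_range.1 (List.mem_filter.1 hi').1
        intro heq
        have := (mul_add_cancel (Nat.mod_lt _ hk) hx heq).1
        have := hS.mono _ _ (Nat.div_le_div_right (c := k) hi''.le) hj
        omega
      · intro heq
        have := (mul_add_cancel hx hx heq).1
        omega
    · rw [tableEdges_succ_of_eq (by omega)]
      exact hR.relax_ge (by omega)
  · intro s' t' _ hQ ht
    exact ⟨by omega, hQ.2⟩

/-- Walks are increasing, so a walk between two vertices of one block never leaves the block; it
only uses edges that the table relaxes. -/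
theorem tdist_of_table {B n m k T W : ℕ} {fa fb fw f : ℕ → ℕ} (hS : Sorted B n m k T W fa fb fw)
    (hz : ∀ i < n * k, i / k % k = i % k → f i = 0)
    (hR : RelaxInv (n * k) T (TableWalk (edgeList m fa fb fw) k) (tableEdges k fa fb fw (m * k)) f)
    {x v : ℕ} (hx : x < n) (hv : v < n) (hxv : x / k = v / k) :
    f (v * k + x % k) = tdist T (edgeList m fa fb fw) x v := by
  have hk := hS.k_pos
  have hxk : x % k < k := Nat.mod_lt _ hk
  have hlt := mul_add_lt hv hxk
  refine eq_tdist (hR.le _ hlt) (fun ℓ hℓ => ?_) ?_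
  · have key : ∀ u v ℓ, LWalk (edgeList m fa fb fw) u v ℓ → u / k = v / k →
        f (v * k + x % k) ≤ f (u * k + x % k) + ℓ := by
      intro u v ℓ h
      induction h with
      | nil v => simp
      | @cons u y v w ℓ h p ih =>
        intro huv
        have h1 : u < y := hS.lt_of_mem _ h
        have h2 : y ≤ v := p.le hS.lt_of_mem
        have h3 := Nat.div_le_div_right (c := k) h1.le
        have h4 := Nat.div_le_div_right (c := k) h2
        have h5 := ih (by omega)
        obtain ⟨j, hj, hje⟩ := List.mem_map.1 h
        simp only [Prod.mk.injEq] at hje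
        obtain ⟨rfl, rfl, rfl⟩ := hje
        have h6 := hR.closed (fa j * k + x % k, fb j * k + x % k, fw j) (by
          refine List.mem_map.2 ⟨j * k + x % k, List.mem_filter.2 ⟨List.mem_range.2
            (mul_add_lt (List.mem_range.1 hj) hxk), ?_⟩, ?_⟩
          · rw [mul_add_div' hxk]; simp only [decide_eq_true_eq]; omega
          · rw [mul_add_div' hxk, mul_add_mod' hxk])
        simp only at h6
        omega
    have h1 := key x v ℓ hℓ hxv
    rw [hz (x * k + x % k) (mul_add_lt hx hxk) (by rw [mul_add_div' hxk, mul_add_mod' hxk])] at h1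
    omega
  · rcases hR.sound _ hlt with h | h
    · left
      rw [TableWalk, mul_add_div' hxk, mul_add_mod' hxk, ← hxv, Nat.div_add_mod'] at h
      exact h
    · exact Or.inr h

/-! ## The eccentricities inside blocks -/

/-- Round `i` compares `x = i / k` with the vertex `y` of index `i % k` in the block of `x`. The
distance from the smaller to the larger of them is stored in the cells of the larger one. The last
block may be incomplete, whence the test of `y` against `n`. -/
def blockEccBody : Prog := .block [.op .div 21 20 14, .op .mod 22 20 14, .op .div 24 21 14,
  .op .mul 24 24 14, .op .add 24 24 22,
  .cond 24 10 (.block [.cond 24 21 (.block [.op .mul 25 21 14, .op .add 25 25 22])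
      (.block [.op .mul 25 24 14, .op .mod 26 21 14, .op .add 25 25 26]),
    .load 27 10 25, .load 28 11 21, .cond 28 27 (.store 11 21 27) .skip]) .skip, .inc 20]

/-- Array `11`: the eccentricities inside blocks. -/
def blockEcc : Prog := .block [.const 20 0, .op .mul 23 10 14, .loop 20 23 blockEccBody]

/-- `e` bounds the eccentricities inside blocks, and is bounded by the eccentricities. -/
structure IsBlockEcc (n k T : ℕ) (E : List (ℕ × ℕ × ℕ)) (e : ℕ → ℕ) : Prop where
  le : ∀ x < n, ∀ y < n, x / k = y / k → mdist T E x y ≤ e x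
  ex : ∀ x < n, ∃ y < n, e x = mdist T E x y

theorem blockEcc_runs {B n m k T W : ℕ} {fa fb fw : ℕ → ℕ} (hS : Sorted B n m k T W fa fb fw)
    {s : State} (hc : Ctx n m k T fa fb fw s)
    (hT : ∀ x < n, ∀ v < n, x / k = v / k →
      s.arr 10 (v * k + x % k) = tdist T (edgeList m fa fb fw) x v)
    (h11 : ∀ x < n, s.arr 11 x = 0) :
    Runs B blockEcc s (n * k * 30 + 10) fun s' =>
      IsBlockEcc n k T (edgeList m fa fb fw) (s'.arr 11) := by
  have hb := hS.bound
  have hk := hS.k_pos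
  apply Runs.of_wp
  simp only [blockEcc, Prog.block, wp_seq, wp_const, wp_op, BinOp.eval]
  refine ⟨by omega, by simp [hc.r10, hc.r14]; omega, ?_⟩
  refine Runs.wp (T := n * k * (29 + 1) + 1) (Runs.for (N := n * k) (I := fun i s' => s'.reg 20 = i ∧
    (∀ x < n, ∀ y < n, x / k = y / k → x * k + y % k < i →
      mdist T (edgeList m fa fb fw) x y ≤ s'.arr 11 x) ∧
    (∀ x < n, ∃ y < n, s'.arr 11 x = mdist T (edgeList m fa fb fw) x y)) ?_ ?_ ?_) ?_
  · refine ⟨by simp, by simp, fun x hx => ⟨x, hx, by simp [h11 x hx, mdist_self]⟩⟩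
  · intro i s' hs hI
    have := hs.reg 23 (by decide)
    simp [hc.r10, hc.r14] at this
    rw [hI.1, this]
  · intro i s' hs hi hI
    have hc' := ((hc.setReg 0 (by decide)).setReg _ (by decide)).same hs (by decide) (by decide)
    have h10 : s'.arr 10 = s.arr 10 := hs.arr 10 (by decide)
    obtain ⟨hi20, hle, hex⟩ := hI
    have hx : i / k < n := by rwa [Nat.div_lt_iff_lt_mul hk]
    have hξ : i % k < k := Nat.mod_lt _ hk
    have h1 : i / k ≤ i := Nat.div_le_self _ _
    have h2 : i / k / k ≤ i / k := Nat.div_le_self _ _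
    have h3 := mul_add_lt hx hξ
    have h4 : i / k / k * k + i % k < n * k := mul_add_lt (by omega) hξ
    have h5 : i / k % k < k := Nat.mod_lt _ hk
    -- The number `x * k + y % k` determines a pair of vertices of one block, so round `i` adds
    -- exactly one pair.
    have hm : ∀ x y, x / k = y / k → x * k + y % k ≤ i → x * k + y % k < i ∨
        (x = i / k ∧ y = i / k / k * k + i % k) := by
      intro x y hxy hle
      rcases hle.lt_or_eq with h | h
      · exact Or.inl h
      · right
        have hy : y % k < k := Nat.mod_lt _ hk
        rw [← h, mul_add_div' hy, mul_add_mod' hy, hxy, Nat.div_add_mod']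
        exact ⟨rfl, rfl⟩
    have upd : ∀ y d, y < n → y = i / k / k * k + i % k →
        d = mdist T (edgeList m fa fb fw) (i / k) y →
        (s'.arr 11 (i / k) < d → (∀ x < n, ∀ y < n, x / k = y / k → x * k + y % k ≤ i →
          mdist T (edgeList m fa fb fw) x y ≤ Function.update (s'.arr 11) (i / k) d x) ∧
          ∀ x < n, ∃ y < n, Function.update (s'.arr 11) (i / k) d x =
            mdist T (edgeList m fa fb fw) x y) ∧
        (d ≤ s'.arr 11 (i / k) → ∀ x < n, ∀ y < n, x / k = y / k → x * k + y % k ≤ i →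
          mdist T (edgeList m fa fb fw) x y ≤ s'.arr 11 x) := by
      intro y d hy hyi hd
      refine ⟨fun hlt => ⟨fun x' hx' y' hy' hxy' h' => ?_, fun x' hx' => ?_⟩,
        fun hge x' hx' y' hy' hxy' h' => ?_⟩
      · rw [Function.update_apply]
        rcases hm x' y' hxy' h' with h | ⟨rfl, rfl⟩
        · have := hle x' hx' y' hy' hxy' h
          split_ifs with hc
          · subst hc; omega
          · exact this
        · rw [if_pos rfl, hd, hyi]
      · rw [Function.update_apply]
        split_ifs with hc
        · exact ⟨y, hy, by rw [hc, hd]⟩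
        · exact hex x' hx'
      · rcases hm x' y' hxy' h' with h | ⟨rfl, rfl⟩
        · exact hle x' hx' y' hy' hxy' h
        · rw [← hyi, ← hd]; exact hge
    simp [blockEccBody, Prog.block, Prog.inc, wp, BinOp.eval, hc'.r14, hc'.r10, h10, hi20]
    have hdiv : (i / k / k * k + i % k) / k = i / k / k := mul_add_div' hξ
    have hmod : (i / k / k * k + i % k) % k = i % k := mul_add_mod' hξ
    refine ⟨by omega, by omega, by omega, by omega, by omega, fun hy => ⟨fun hyx => ?_, fun hyx => ?_⟩,
      fun hy => ⟨by omega, by omega, fun x' hx' y' hy' hxy' h' => ?_, hex⟩⟩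
    · have hd : s.arr 10 (i / k * k + i % k) =
          mdist T (edgeList m fa fb fw) (i / k) (i / k / k * k + i % k) := by
        rw [mdist_comm, mdist_of_le hS.lt_of_mem hyx.le, ← hT _ hy _ hx hdiv, hmod]
      have := upd _ _ hy rfl hd
      exact ⟨by omega, by omega, fun h => ⟨by omega, by omega, this.1 h⟩,
        fun h => ⟨by omega, by omega, this.2 h, hex⟩⟩
    · have hd : s.arr 10 ((i / k / k * k + i % k) * k + i / k % k) =
          mdist T (edgeList m fa fb fw) (i / k) (i / k / k * k + i % k) := by
        rw [mdist_of_le hS.lt_of_mem hyx, ← hT _ hx _ hy hdiv.symm]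
      have := upd _ _ hy rfl hd
      have := mul_add_lt hy h5
      exact ⟨by omega, by omega, by omega, fun h => ⟨by omega, by omega, by tauto⟩,
        fun h => ⟨by omega, by omega, by tauto, hex⟩⟩
    · rcases hm x' y' hxy' h' with h | ⟨rfl, rfl⟩
      · exact hle x' hx' y' hy' hxy' h
      · omega
  · intro s' t' _ hQ ht
    refine ⟨by omega, fun x hx y hy hxy => hQ.2.1 x hx y hy hxy ?_, hQ.2.2⟩
    exact mul_add_lt hx (Nat.mod_lt _ hk)

/-! ## Distances from and to a vertex -/

def distInitBody : Prog := .block [.store 12 20 13, .store 13 20 13, .inc 20]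

def distInit : Prog := .block [.const 20 0, .loop 20 10 distInitBody, .const 9 0, .store 12 56 9,
  .store 13 56 9]

theorem distInit_runs {B n m k T W : ℕ} {fa fb fw : ℕ → ℕ} (hS : Sorted B n m k T W fa fb fw)
    {s : State} (hc : Ctx n m k T fa fb fw s) :
    Runs B distInit s (n * 10 + 10) fun s' =>
      (∀ v < n, s'.arr 12 v = if v = s.reg 56 then 0 else T) ∧
      (∀ v < n, s'.arr 13 v = if v = s.reg 56 then 0 else T) := by
  have hb := hS.bound
  apply Runs.of_wp
  simp only [distInit, Prog.block, wp_seq, wp_const]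
  refine ⟨by omega, ?_⟩
  refine Runs.wp (T := n * (9 + 1) + 1) (Runs.for (N := n) (I := fun i s' => s'.reg 20 = i ∧
    (∀ v < i, s'.arr 12 v = T) ∧ (∀ v < i, s'.arr 13 v = T)) ?_ ?_ ?_) ?_
  · simp
  · intro i s' hs hI
    have hc' := (hc.setReg 0 (by decide)).same hs (by decide) (by decide)
    rw [hI.1, hc'.r10]
  · intro i s' hs hi hI
    have hc' := (hc.setReg 0 (by decide)).same hs (by decide) (by decide)
    simp [distInitBody, Prog.block, Prog.inc, wp, BinOp.eval, hc'.r13, hI.1]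
    exact ⟨by omega, by omega, forall_le_update hI.2.1 rfl, forall_le_update hI.2.2 rfl⟩
  · intro s' t' hs hQ ht
    have h56 : s'.reg 56 = s.reg 56 := by simpa using hs.reg 56 (by decide)
    simp only [wp_seq, wp_const, wp_store]
    simp only [State.setReg_reg, State.setArr_reg, State.setArr_arr, State.setReg_arr, h56]
    refine ⟨by omega, by omega, fun v hv => ?_, fun v hv => ?_⟩
    · simp [Function.update_apply, hQ.2.1 v hv]
    · simp [Function.update_apply, hQ.2.2 v hv]

def distFromBody : Prog := .block [.load 24 6 20, .load 25 7 20, .load 26 8 20, relaxAt 12, .inc 20]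

def distFrom : Prog := .block [.const 20 0, .loop 20 11 distFromBody]

theorem edgeList_succ (i : ℕ) (fa fb fw : ℕ → ℕ) :
    edgeList (i + 1) fa fb fw = edgeList i fa fb fw ++ [(fa i, fb i, fw i)] := by
  simp [edgeList, List.range_succ]

theorem distFrom_runs {B n m k T W x : ℕ} {fa fb fw : ℕ → ℕ} (hS : Sorted B n m k T W fa fb fw)
    {s : State} (hc : Ctx n m k T fa fb fw s) (hx : x < n)
    (h12 : ∀ v < n, s.arr 12 v = if v = x then 0 else T) :
    Runs B distFrom s (m * 20 + 10) fun s' =>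
      ∀ v < n, s'.arr 12 v = tdist T (edgeList m fa fb fw) x v := by
  have hb := hS.bound
  apply Runs.of_wp
  simp only [distFrom, Prog.block, wp_seq, wp_const]
  refine ⟨by omega, ?_⟩
  refine Runs.wp (T := m * (19 + 1) + 1) (Runs.for (N := m) (I := fun i s' => s'.reg 20 = i ∧
    s'.arr 12 x = 0 ∧ RelaxInv n T (LWalk (edgeList m fa fb fw) x) (edgeList i fa fb fw)
      (s'.arr 12)) ?_ ?_ ?_) ?_
  · refine ⟨by simp, by simp [h12 x hx], fun e he => by simp [edgeList] at he, fun v hv => ?_,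
      fun v hv => ?_⟩
    · simp only [State.setReg_arr, h12 v hv]
      split_ifs with h
      · subst h; exact Or.inl (.nil _)
      · exact Or.inr rfl
    · simp only [State.setReg_arr, h12 v hv]; split_ifs <;> omega
  · intro i s' hs hI
    have hc' := (hc.setReg 0 (by decide)).same hs (by decide) (by decide)
    rw [hI.1, hc'.r11]
  · intro i s' hs hi hI
    have hc' := (hc.setReg 0 (by decide)).same hs (by decide) (by decide)
    obtain ⟨hi20, hz, hR⟩ := hI
    have hab := hS.lt _ hi
    have hbn := hS.lt_n _ hi
    have hw := hS.w_le _ hi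
    have h6 := hR.le (fa i) (hab.trans hbn)
    simp [distFromBody, relaxAt, Prog.block, Prog.inc, wp, BinOp.eval, hc'.a6, hc'.a7, hc'.a8, hi20]
    refine ⟨by omega, fun h' => ⟨by omega, by omega, ?_, ?_⟩,
      fun h' => ⟨by omega, by omega, hz, ?_⟩⟩
    · rw [Function.update_apply]
      split_ifs with hvb
      · rw [← hvb, hz] at h'; omega
      · exact hz
    · rw [edgeList_succ]
      refine hR.relax_lt (hab.trans hbn) hbn (fun ℓ hℓ => hℓ.snoc (mem_edgeList hi)) ?_ hab.ne h'
      intro e he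
      obtain ⟨i', hi', rfl⟩ := List.mem_map.1 he
      have := hS.mono _ _ (List.mem_range.1 hi').le hi
      simp only; omega
    · rw [edgeList_succ]
      exact hR.relax_ge (by omega)
  · intro s' t' _ hQ ht
    refine ⟨by omega, fun v hv => eq_tdist (hQ.2.2.le v hv) (fun ℓ hℓ => ?_) (hQ.2.2.sound v hv)⟩
    have := hℓ.le_of_closed hQ.2.2.closed
    omega

/-- The edges are read from the last to the first with their ends exchanged, so that relaxation
propagates the distances backwards to the sources. -/
def distToBody : Prog := .block [.op .sub 21 11 20, .const 9 1, .op .sub 21 21 9, .load 25 6 21,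
  .load 24 7 21, .load 26 8 21, relaxAt 13, .inc 20]

def distTo : Prog := .block [.const 20 0, .loop 20 11 distToBody]

/-- The last `i` of the `m` edges, reversed. -/
def revEdges (m : ℕ) (fa fb fw : ℕ → ℕ) (i : ℕ) : List (ℕ × ℕ × ℕ) :=
  (List.range i).map fun j => (fb (m - j - 1), fa (m - j - 1), fw (m - j - 1))

theorem revEdges_succ (i m : ℕ) (fa fb fw : ℕ → ℕ) :
    revEdges m fa fb fw (i + 1) =
      revEdges m fa fb fw i ++ [(fb (m - i - 1), fa (m - i - 1), fw (m - i - 1))] := by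
  simp [revEdges, List.range_succ]

theorem distTo_runs {B n m k T W x : ℕ} {fa fb fw : ℕ → ℕ} (hS : Sorted B n m k T W fa fb fw)
    {s : State} (hc : Ctx n m k T fa fb fw s) (hx : x < n)
    (h13 : ∀ v < n, s.arr 13 v = if v = x then 0 else T) :
    Runs B distTo s (m * 20 + 10) fun s' =>
      ∀ v < n, s'.arr 13 v = tdist T (edgeList m fa fb fw) v x := by
  have hb := hS.bound
  apply Runs.of_wp
  simp only [distTo, Prog.block, wp_seq, wp_const]
  refine ⟨by omega, ?_⟩
  refine Runs.wp (T := m * (19 + 1) + 1) (Runs.for (N := m) (I := fun i s' => s'.reg 20 = i ∧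
    s'.arr 13 x = 0 ∧ RelaxInv n T (fun v => LWalk (edgeList m fa fb fw) v x) (revEdges m fa fb fw i)
      (s'.arr 13)) ?_ ?_ ?_) ?_
  · refine ⟨by simp, by simp [h13 x hx], fun e he => by simp [revEdges] at he, fun v hv => ?_,
      fun v hv => ?_⟩
    · simp only [State.setReg_arr, h13 v hv]
      split_ifs with h
      · subst h; exact Or.inl (.nil _)
      · exact Or.inr rfl
    · simp only [State.setReg_arr, h13 v hv]; split_ifs <;> omega
  · intro i s' hs hI
    have hc' := (hc.setReg 0 (by decide)).same hs (by decide) (by decide)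
    rw [hI.1, hc'.r11]
  · intro i s' hs hi hI
    have hc' := (hc.setReg 0 (by decide)).same hs (by decide) (by decide)
    obtain ⟨hi20, hz, hR⟩ := hI
    have hi' : m - i - 1 < m := by omega
    have hab := hS.lt _ hi'
    have hbn := hS.lt_n _ hi'
    have hw := hS.w_le _ hi'
    have h6 := hR.le _ hbn
    simp [distToBody, relaxAt, Prog.block, Prog.inc, wp, BinOp.eval, hc'.r11, hc'.a6, hc'.a7, hc'.a8, hi20]
    refine ⟨by omega, by omega, by omega, by omega, fun h' => ⟨by omega, by omega, ?_, ?_⟩,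
      fun h' => ⟨by omega, by omega, hz, ?_⟩⟩
    · rw [Function.update_apply]
      split_ifs with hvb
      · rw [← hvb, hz] at h'; omega
      · exact hz
    · rw [revEdges_succ]
      refine hR.relax_lt hbn (hab.trans hbn)
        (fun ℓ hℓ => by rw [add_comm]; exact .cons (mem_edgeList hi') hℓ) ?_ hab.ne' h'
      -- The edges treated so far have sources at least `fa (m - i - 1)` and hence targets strictly
      -- after it, so none of the reversed edges starts there. The sorting by source serves both
      -- directions.
      intro e he
      obtain ⟨j, hj, rfl⟩ := List.mem_map.1 he
      have hj := List.mem_range.1 hj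
      have := hS.mono (m - i - 1) (m - j - 1) (by omega) (by omega)
      have := hS.lt (m - j - 1) (by omega)
      simp only; omega
    · rw [revEdges_succ]
      exact hR.relax_ge (by omega)
  · intro s' t' _ hQ ht
    refine ⟨by omega, fun v hv => eq_tdist (hQ.2.2.le v hv) (fun ℓ hℓ => ?_) (hQ.2.2.sound v hv)⟩
    have := hℓ.le_of_closed_rev (f := s'.arr 13) (fun e he => by
      obtain ⟨j, hj, rfl⟩ := List.mem_map.1 he
      have hj := List.mem_range.1 hj
      refine hQ.2.2.closed (fb j, fa j, fw j) (List.mem_map.2 ⟨m - j - 1, List.mem_range.2 (by omega), ?_⟩)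
      rw [show m - (m - j - 1) - 1 = j by omega])
    omega

def eccOfBody : Prog := .block [.load 27 12 20, .load 28 13 20, .cond 28 27 (.mov 27 28) .skip,
  .cond 60 27 (.block [.mov 60 27, .mov 61 20]) .skip, .inc 20]

/-- The eccentricity of the vertex in register `56` and a farthest vertex, in registers `60`
and `61`. -/
def eccOf : Prog := .block [distInit, distFrom, distTo, .const 60 0, .mov 61 56, .const 20 0,
  .loop 20 10 eccOfBody]

theorem eccOf_runs {B n m k T W x : ℕ} {fa fb fw : ℕ → ℕ} (hS : Sorted B n m k T W fa fb fw)
    {s : State} (hc : Ctx n m k T fa fb fw s) (hx : x < n) (h56 : s.reg 56 = x) :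
    Runs B eccOf s (n * 30 + m * 40 + 50) fun s' =>
      s'.reg 61 < n ∧ s'.reg 60 = mdist T (edgeList m fa fb fw) x (s'.reg 61) ∧
        ∀ v < n, mdist T (edgeList m fa fb fw) x v ≤ s'.reg 60 := by
  have hb := hS.bound
  apply Runs.of_wp
  simp only [eccOf, Prog.block, wp_seq]
  refine (distInit_runs hS hc).wp fun s₁ t₁ hs₁ hQ₁ ht₁ => ?_
  have hc₁ := hc.same hs₁ (by decide) (by decide)
  have h56₁ := (hs₁.reg 56 (by decide)).trans h56
  rw [h56] at hQ₁
  refine (distFrom_runs hS hc₁ hx hQ₁.1).wp fun s₂ t₂ hs₂ hQ₂ ht₂ => ?_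
  have hc₂ := hc₁.same hs₂ (by decide) (by decide)
  have h56₂ := (hs₂.reg 56 (by decide)).trans h56₁
  have h13₂ := hs₂.arr 13 (by decide)
  refine (distTo_runs hS hc₂ hx (by rw [h13₂]; exact hQ₁.2)).wp fun s₃ t₃ hs₃ hQ₃ ht₃ => ?_
  have hc₃ := hc₂.same hs₃ (by decide) (by decide)
  have h56₃ := (hs₃.reg 56 (by decide)).trans h56₂
  have h12₃ := hs₃.arr 12 (by decide)
  rw [← h12₃] at hQ₂
  refine ⟨by omega, ?_⟩
  simp only [wp_seq, wp_mov, wp_const]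
  refine ⟨by simp; omega, by omega, ?_⟩
  refine Runs.wp (T := n * (14 + 1) + 1) (Runs.for (N := n) (I := fun i s' => s'.reg 20 = i ∧
    s'.reg 61 < n ∧ s'.reg 60 = mdist T (edgeList m fa fb fw) x (s'.reg 61) ∧
        ∀ v < i, mdist T (edgeList m fa fb fw) x v ≤ s'.reg 60) ?_ ?_ ?_) ?_
  · simp [h56₃, hx, mdist_self]
  · intro i s' hs hI
    have h10 := hs.reg 10 (by decide)
    simp [hc₃.r10] at h10
    rw [hI.1, h10]
  · intro i s' hs hi hI
    have h12 : s'.arr 12 = s₃.arr 12 := hs.arr 12 (by decide)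
    have h13 : s'.arr 13 = s₃.arr 13 := hs.arr 13 (by decide)
    obtain ⟨hi20, h61, h60, hle⟩ := hI
    have h1 := tdist_le (T := T) (E := edgeList m fa fb fw) x i
    have h2 := tdist_le (T := T) (E := edgeList m fa fb fw) i x
    simp [eccOfBody, Prog.block, Prog.inc, wp, BinOp.eval, h12, h13, hi20, hQ₂ i hi, hQ₃ i hi]
    have key : ∀ d, d = mdist T (edgeList m fa fb fw) x i →
        (s'.reg 60 < d → ∀ v ≤ i, mdist T (edgeList m fa fb fw) x v ≤ d) ∧
        (d ≤ s'.reg 60 → ∀ v ≤ i, mdist T (edgeList m fa fb fw) x v ≤ s'.reg 60) := by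
      intro d hd
      refine ⟨fun h v hv => ?_, fun h v hv => ?_⟩ <;> rcases hv.lt_or_eq with h' | rfl
      · exact (hle v h').trans h.le
      · exact hd.ge
      · exact hle v h'
      · exact hd.ge.trans h
    refine ⟨fun h => ⟨by omega, ?_⟩, fun h => ?_⟩
    · have hd : tdist T (edgeList m fa fb fw) i x = mdist T (edgeList m fa fb fw) x i :=
        (min_eq_right h.le).symm
      exact ⟨fun h' => ⟨by omega, by omega, by omega, by omega, hi, hd, (key _ hd).1 h'⟩,
        fun h' => ⟨by omega, by omega, h61, h60, (key _ hd).2 h'⟩⟩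
    · have hd : tdist T (edgeList m fa fb fw) x i = mdist T (edgeList m fa fb fw) x i :=
        (min_eq_left h).symm
      exact ⟨fun h' => ⟨by omega, by omega, by omega, by omega, hi, hd, (key _ hd).1 h'⟩,
        fun h' => ⟨by omega, by omega, h61, h60, (key _ hd).2 h'⟩⟩
  · intro s' t' _ hQ ht
    exact ⟨by omega, hQ.2⟩

/-! ## Choosing a candidate -/

def countBody : Prog := .block [.load 55 11 50, .const 9 1,
  .cond 55 44 (.block [.op .add 51 51 9, .cond 55 47 .skip (.op .add 52 52 9),
    .cond 46 50 .skip (.op .add 53 53 9), .cond 50 46 .skip (.op .add 54 54 9)]) .skip, .inc 50]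

/-- Count the candidates, and those that a choice of the vertex in register `46` can discard. -/
def count : Prog := .block [.mov 50 42, .const 51 0, .const 52 0, .const 53 0, .const 54 0,
  .loop 50 43 countBody]

theorem card_cands_succ (e : ℕ → ℕ) (lo i E : ℕ) (p : ℕ → Prop) [DecidablePred p] :
    ((cands e lo (lo + (i + 1)) E).filter p).card =
      ((cands e lo (lo + i) E).filter p).card + if e (lo + i) < E ∧ p (lo + i) then 1 else 0 := by
  have : Finset.Ico lo (lo + (i + 1)) = insert (lo + i) (Finset.Ico lo (lo + i)) := by
    ext y; simp only [Finset.mem_Ico, Finset.mem_insert]; omega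
  simp only [cands, this, Finset.filter_filter]
  rw [Finset.filter_insert]
  split_ifs with h
  · rw [Finset.card_insert_of_notMem (by simp)]
  · rfl

theorem card_cands_le (e : ℕ → ℕ) (lo hi E : ℕ) : (cands e lo hi E).card ≤ hi - lo :=
  (Finset.card_filter_le _ _).trans (by simp)

theorem count_runs {B lo hi E x : ℕ} {e : ℕ → ℕ} {s : State} (hlo : lo ≤ B) (hB : hi + 1 ≤ B)
    (h42 : s.reg 42 = lo) (h43 : s.reg 43 = hi) (h44 : s.reg 44 = E)
    (h46 : s.reg 46 = x) (h47 : s.reg 47 = e x) (h11 : s.arr 11 = e) :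
    Runs B count s ((hi - lo) * 20 + 10) fun s' =>
      s'.reg 51 = (cands e lo hi E).card ∧
      s'.reg 52 = ((cands e lo hi E).filter fun y => e x ≤ e y).card ∧
      s'.reg 53 = ((cands e lo hi E).filter fun y => y ≤ x).card ∧
      s'.reg 54 = ((cands e lo hi E).filter fun y => x ≤ y).card := by
  apply Runs.of_wp
  simp only [count, Prog.block, wp_seq, wp_mov, wp_const]
  refine ⟨by omega, by omega, by omega, by omega, by omega, ?_⟩
  refine Runs.wp (T := (hi - lo) * (19 + 1) + 1) (Runs.for (N := hi - lo) (I := fun i s' =>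
    s'.reg 50 = lo + i ∧ s'.reg 51 = (cands e lo (lo + i) E).card ∧
      s'.reg 52 = ((cands e lo (lo + i) E).filter fun y => e x ≤ e y).card ∧
      s'.reg 53 = ((cands e lo (lo + i) E).filter fun y => y ≤ x).card ∧
      s'.reg 54 = ((cands e lo (lo + i) E).filter fun y => x ≤ y).card) ?_ ?_ ?_) ?_
  · simp [h42, cands]
  · intro i s' hs hI
    have := hs.reg 43 (by decide)
    simp [h43] at this
    rw [hI.1, this]
    omega
  · intro i s' hs hi' ⟨hI, h51, h52, h53, h54⟩
    have h44' := hs.reg 44 (by decide)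
    have h46' := hs.reg 46 (by decide)
    have h47' := hs.reg 47 (by decide)
    have h11' := hs.arr 11 (by decide)
    simp [h44, h46, h47, h11] at h44' h46' h47' h11'
    have hcard := card_cands_le e lo (lo + i) E
    have c0 := card_cands_succ e lo i E fun _ => True
    have c1 := card_cands_succ e lo i E fun y => e x ≤ e y
    have c2 := card_cands_succ e lo i E fun y => y ≤ x
    have c3 := card_cands_succ e lo i E fun y => x ≤ y
    have f1 := Finset.card_filter_le (cands e lo (lo + i) E) fun y => e x ≤ e y
    have f2 := Finset.card_filter_le (cands e lo (lo + i) E) fun y => y ≤ x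
    have f3 := Finset.card_filter_le (cands e lo (lo + i) E) fun y => x ≤ y
    simp only [Finset.filter_true, and_true] at c0
    rw [c0, c1, c2, c3]
    simp [countBody, Prog.block, Prog.inc, wp, BinOp.eval, h44', h46', h47', h11', hI, h51, h52, h53,
      h54]
    clear c0 c1 c2 c3
    by_cases g0 : e (lo + i) < E
    · by_cases g1 : e x ≤ e (lo + i) <;> by_cases g2 : lo + i ≤ x <;> by_cases g3 : x ≤ lo + i <;>
        simp [g0, g1, g2, g3] <;> omega
    · simp [g0]; omega
  · intro s' t' hs hQ ht
    rcases le_total lo hi with h | h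
    · rw [show lo + (hi - lo) = hi by omega] at hQ
      exact ⟨by omega, hQ.2⟩
    · have h1 : cands e lo (lo + (hi - lo)) E = cands e lo hi E := by
        rw [show lo + (hi - lo) = lo by omega]
        simp [cands, Finset.Ico_eq_empty_of_le h]
      rw [h1] at hQ
      exact ⟨by omega, hQ.2⟩

/-- Every candidate is tested by a full count, quadratic in the block length. As `k * k ≤ 2 * n`,
this is `O(n)`. -/
def selectBody : Prog := .block [.load 47 11 46, .cond 47 44 (.block [count, .const 9 4,
  .op .mul 52 52 9, .op .mul 53 53 9, .op .mul 54 54 9,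
  .cond 52 51 .skip (.cond 53 51 .skip (.cond 54 51 .skip (.block [.const 57 1, .mov 56 46])))])
  .skip, .inc 46]

/-- Choose a candidate that splits the candidates well; register `57` tells whether there is one. -/
def select : Prog := .block [.const 57 0, .mov 46 42, .loop 46 43 selectBody]

/-- What `select` achieves. -/
def Selected (e : ℕ → ℕ) (C : Finset ℕ) (s : State) : Prop :=
  (s.reg 57 = 0 ∧ C = ∅) ∨ (s.reg 57 = 1 ∧ s.reg 56 ∈ C ∧ Splits e C (s.reg 56))

theorem select_runs {B lo hi E k : ℕ} {e : ℕ → ℕ} {s : State} (hlo : lo ≤ B)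
    (hB : hi + 1 ≤ B) (hk : hi ≤ lo + k) (hkB : 4 * k + 4 ≤ B)
    (h42 : s.reg 42 = lo) (h43 : s.reg 43 = hi) (h44 : s.reg 44 = E) (h11 : s.arr 11 = e) :
    Runs B select s (k * (k * 20 + 40) + 10) (Selected e (cands e lo hi E)) := by
  apply Runs.of_wp
  simp only [select, Prog.block, wp_seq, wp_mov, wp_const]
  refine ⟨by omega, by simp; omega, ?_⟩
  refine Runs.wp (T := (hi - lo) * (k * 20 + 39 + 1) + 1) (Runs.for (N := hi - lo) (I := fun i s' =>
    s'.reg 46 = lo + i ∧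
      ((s'.reg 57 = 0 ∧ ∀ x ∈ cands e lo hi E, x < lo + i → ¬ Splits e (cands e lo hi E) x) ∨
      (s'.reg 57 = 1 ∧ s'.reg 56 ∈ cands e lo hi E ∧ Splits e (cands e lo hi E) (s'.reg 56))))
      ?_ ?_ ?_) ?_
  · simp only [State.setReg_reg]
    refine ⟨by simp [h42], Or.inl ⟨by simp, fun x hx h => ?_⟩⟩
    have := (Finset.mem_Ico.1 (Finset.mem_filter.1 hx).1).1
    omega
  · intro i s' hs hI
    have := hs.reg 43 (by decide)
    simp [h43] at this
    rw [hI.1, this]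
    omega
  · intro i s' hs hi' ⟨hI, hsel⟩
    have h42' := hs.reg 42 (by decide)
    have h43' := hs.reg 43 (by decide)
    have h44' := hs.reg 44 (by decide)
    have h11' := hs.arr 11 (by decide)
    simp [h42, h43, h44, h11] at h42' h43' h44' h11'
    simp only [selectBody, Prog.block, wp_seq, wp_load, wp_cond, h11', hI]
    have hnext : ∀ r : ℕ, r = 0 ∧ (∀ x ∈ cands e lo hi E, x < lo + i →
        ¬ Splits e (cands e lo hi E) x) → ¬ (lo + i ∈ cands e lo hi E ∧
        Splits e (cands e lo hi E) (lo + i)) →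
        r = 0 ∧ ∀ x ∈ cands e lo hi E, x < lo + (i + 1) → ¬ Splits e (cands e lo hi E) x := by
      rintro r ⟨h, h'⟩ hn
      refine ⟨h, fun x hx hlt hsp => ?_⟩
      rcases (show x ≤ lo + i by omega).lt_or_eq with h1 | rfl
      · exact h' x hx h1 hsp
      · exact hn ⟨hx, hsp⟩
    constructor
    · intro hE
      have hmem : lo + i ∈ cands e lo hi E :=
        Finset.mem_filter.2 ⟨Finset.mem_Ico.2 ⟨by omega, by omega⟩, by simpa [h44'] using hE⟩
      refine (count_runs (x := lo + i) (e := e) hlo hB (E := E) (by simpa) (by simpa) (by simpa)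
        (by simpa) (by simp) (by simpa)).wp fun s₁ t₁ hs₁ ⟨h51, h52, h53, h54⟩ ht₁ => ?_
      have h46₁ := hs₁.reg 46 (by decide)
      have h56₁ := hs₁.reg 56 (by decide)
      have h57₁ := hs₁.reg 57 (by decide)
      simp [hI] at h46₁ h56₁ h57₁
      have hcard := card_cands_le e lo hi E
      have f1 := Finset.card_filter_le (cands e lo hi E) fun y => e (lo + i) ≤ e y
      have f2 := Finset.card_filter_le (cands e lo hi E) fun y => y ≤ lo + i
      have f3 := Finset.card_filter_le (cands e lo hi E) fun y => lo + i ≤ y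
      have hk20 : (hi - lo) * 20 ≤ k * 20 := by omega
      simp only [wp_seq, wp_const, wp_op, BinOp.eval, wp_cond, wp_mov]
      simp [Prog.inc, wp, BinOp.eval, h51, h52, h53, h54, h46₁, h57₁, h56₁]
      refine ⟨by omega, by omega, by omega, by omega, fun h => ?_, fun h₁ => ⟨fun h => ?_,
        fun h₂ => ⟨fun h => ?_, fun h₃ => ?_⟩⟩⟩
      · exact ⟨by omega, by omega, by omega, by omega, hsel.imp_left fun h' => hnext _ h' fun h' => by have := h'.2.1; omega⟩
      · exact ⟨by omega, by omega, by omega, by omega, hsel.imp_left fun h' => hnext _ h' fun h' => by have := h'.2.2.1; omega⟩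
      · exact ⟨by omega, by omega, by omega, by omega, hsel.imp_left fun h' => hnext _ h' fun h' => by have := h'.2.2.2; omega⟩
      · exact ⟨by omega, by omega, by omega, by omega, by omega, by omega, hmem, by omega, by omega,
          by omega⟩
    · intro hE
      have hE' : ¬ (lo + i ∈ cands e lo hi E ∧ Splits e (cands e lo hi E) (lo + i)) := fun h =>
        hE (by simpa [h44'] using (Finset.mem_filter.1 h.1).2)
      simp [Prog.inc, wp, BinOp.eval, hI]
      exact ⟨by omega, by omega, by omega, hsel.imp_left fun h' => hnext _ h' hE'⟩
  · intro s' t' hs ⟨_, hQ⟩ ht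
    have h1 : (hi - lo) * (k * 20 + 39 + 1) ≤ k * (k * 20 + 39 + 1) :=
      Nat.mul_le_mul_right _ (by omega)
    rw [show k * 20 + 39 + 1 = k * 20 + 40 from rfl] at h1 ht
    refine ⟨by omega, hQ.imp_left fun h => ⟨h.1, ?_⟩⟩
    by_contra hne
    obtain ⟨x, hx, hsp⟩ := exists_splits e (Finset.nonempty_iff_ne_empty.2 hne)
    have := (Finset.mem_Ico.1 (Finset.mem_filter.1 hx).1)
    exact h.2 x hx (by omega) hsp

/-! ## The search in one block and in all blocks -/

/-- `b` is `T` or the eccentricity of a vertex. -/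
def Genuine (n T : ℕ) (E : List (ℕ × ℕ × ℕ)) (b : ℕ) : Prop :=
  b = T ∨ ∃ x < n, (∃ w < n, b = mdist T E x w) ∧ ∀ v < n, mdist T E x v ≤ b

/-- `b` is at most twice the eccentricity of `c`. -/
def Covered (n T : ℕ) (E : List (ℕ × ℕ × ℕ)) (b c : ℕ) : Prop :=
  ∀ d, (∀ v < n, mdist T E c v ≤ d) → b ≤ 2 * d

theorem Genuine.le {n T b : ℕ} {E : List (ℕ × ℕ × ℕ)} (h : Genuine n T E b) : b ≤ T := by
  rcases h with h | ⟨x, _, ⟨w, _, h⟩, _⟩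
  · exact h.le
  · exact h ▸ mdist_le _ _

/-- The distance between `x` and `w` splits at `c` into two parts, each at most the eccentricity of
`c`. -/
theorem covered_of_between {n T x w c : ℕ} {E : List (ℕ × ℕ × ℕ)}
    (hE : ∀ e ∈ E, e.1 < e.2.1) (hx : x < n) (hw : w < n)
    (hc : (w ≤ c ∧ c ≤ x) ∨ (x ≤ c ∧ c ≤ w)) : Covered n T E (mdist T E x w) c := by
  intro d hd
  have h1 := hd x hx
  have h2 := hd w hw
  rcases hc with ⟨h, h'⟩ | ⟨h, h'⟩
  · have := mdist_triangle (T := T) hE h h'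
    rw [mdist_comm w x, mdist_comm w c] at this
    omega
  · have := mdist_triangle (T := T) hE h h'
    rw [mdist_comm x c] at this
    omega

/-- Register `61` holds a farthest vertex `w` of the chosen `x`. If `w` lies before the block, the
candidates up to `x` are discarded; if it lies inside, those with `e` at least the eccentricity of
`x`; if it lies after the block, those from `x` on. -/
def searchStep : Prog := .block [eccOf, .cond 60 15 (.mov 15 60) .skip,
  .cond 61 40 (.block [.mov 42 56, .inc 42]) (.cond 61 41 (.mov 44 60) (.mov 43 56)), select]

/-- Improve the bound in register `15` with the vertices of the block that starts at the vertex in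
register `40`. -/
def searchBlock : Prog := .block [.mov 42 40, .op .add 41 40 14, .cond 10 41 (.mov 41 10) .skip,
  .mov 43 41, .mov 44 13, .inc 44, select, .const 8 0, .loop 8 57 searchStep]

/-- The invariant of the search in the block `β`. -/
structure SearchInv (n k T β best₀ : ℕ) (E : List (ℕ × ℕ × ℕ)) (e : ℕ → ℕ) (lo hi Em : ℕ) (s : State) :
    Prop where
  r42 : s.reg 42 = lo
  r43 : s.reg 43 = hi
  r44 : s.reg 44 = Em
  lo_ge : β * k ≤ lo
  hi_le : hi ≤ min (β * k + k) n
  lo_le : lo ≤ n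
  genuine : Genuine n T E (s.reg 15)
  le : s.reg 15 ≤ best₀
  cover : ∀ c < n, c / k = β → c ∈ cands e lo hi Em ∨ Covered n T E (s.reg 15) c
  sel : Selected e (cands e lo hi Em) s

theorem div_eq_iff_block {k β c : ℕ} (hk : 0 < k) : c / k = β ↔ β * k ≤ c ∧ c < β * k + k := by
  rw [Nat.div_eq_iff hk]
  omega

/-- Every vertex of the block remains a candidate until it is covered by the current bound. Each
round computes one eccentricity and discards a quarter of the candidates. -/
theorem searchBlock_runs {B n m k T W β : ℕ} {fa fb fw e : ℕ → ℕ}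
    (hS : Sorted B n m k T W fa fb fw) {s : State} (hc : Ctx n m k T fa fb fw s)
    (he : IsBlockEcc n k T (edgeList m fa fb fw) e) (h11 : s.arr 11 = e) (h40 : s.reg 40 = β * k)
    (hβ : β * k < n) (hkB : 4 * k + 4 ≤ B) (hg : Genuine n T (edgeList m fa fb fw) (s.reg 15)) :
    Runs B searchBlock s
      ((rounds k + 1) * (n * 30 + m * 40 + k * (k * 20 + 40) + 100)) fun s' =>
      Genuine n T (edgeList m fa fb fw) (s'.reg 15) ∧ s'.reg 15 ≤ s.reg 15 ∧
      ∀ c < n, c / k = β → Covered n T (edgeList m fa fb fw) (s'.reg 15) c := by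
  have hb := hS.bound
  have hk := hS.k_pos
  set E := edgeList m fa fb fw with hE
  have heT : ∀ c < n, e c < T + 1 := fun c hcn => by
    obtain ⟨y, _, h⟩ := he.ex c hcn
    have := mdist_le (T := T) (E := E) c y
    omega
  apply Runs.of_wp
  simp only [searchBlock, Prog.block, Prog.inc, wp_seq, wp_mov, wp_op, BinOp.eval]
  simp [hc.r10, hc.r14, h40, wp_cond]
  -- Shared by the two outcomes of the computation of the block end `b`, which is cut off at `n`.
  have main : ∀ (s₁ : State) (t b : ℕ), Ctx n m k T fa fb fw s₁ → s₁.arr 11 = e →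
      s₁.reg 40 = β * k → s₁.reg 41 = b → s₁.reg 42 = β * k → s₁.reg 43 = b →
      s₁.reg 44 = T + 1 → s₁.reg 15 = s.reg 15 → t ≤ 20 → b = min (β * k + k) n →
      wp B select (wp B ((Prog.const 8 0).seq (Prog.loop 8 57 searchStep)) fun s' t ↦
        t ≤ (rounds k + 1) * (n * 30 + m * 40 + k * (k * 20 + 40) + 100) ∧
        Genuine n T E (s'.reg 15) ∧ s'.reg 15 ≤ s.reg 15 ∧
        ∀ c < n, c / k = β → Covered n T E (s'.reg 15) c) s₁ t := by
    intro s₁ t b hc₁ h11₁ h40₁ h41₁ h42₁ h43₁ h44₁ h15₁ ht hbd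
    refine (select_runs (k := k) (by omega) (by omega) (by omega) hkB h42₁ h43₁ h44₁ h11₁).wp
      fun s₂ t₂ hs₂ hQ₂ ht₂ => ?_
    have hc₂ := hc₁.same hs₂ (by decide) (by decide)
    have h11₂ := (hs₂.arr 11 (by decide)).trans h11₁
    have h15₂ := (hs₂.reg 15 (by decide)).trans h15₁
    have h40₂ := (hs₂.reg 40 (by decide)).trans h40₁
    have h41₂ := (hs₂.reg 41 (by decide)).trans h41₁
    have h42₂ := (hs₂.reg 42 (by decide)).trans h42₁
    have h43₂ := (hs₂.reg 43 (by decide)).trans h43₁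
    have h44₂ := (hs₂.reg 44 (by decide)).trans h44₁
    simp only [wp_seq, wp_const]
    refine ⟨by omega, ?_⟩
    -- The rounds made so far plus `rounds` of the number of remaining candidates never exceed
    -- `rounds k`; this bounds the number of iterations.
    refine Runs.wp (T := rounds k * (n * 30 + m * 40 + k * (k * 20 + 40) + 80 + 1) + 1)
      (Runs.loop (N := rounds k) (I := fun i s' => ∃ lo hi Em,
        SearchInv n k T β (s.reg 15) E e lo hi Em s' ∧
          i + rounds (cands e lo hi Em).card ≤ rounds k) ?_ ?_) ?_
    · refine ⟨β * k, b, T + 1, ⟨by simpa, by simpa, by simpa, le_rfl, by omega, by omega,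
        by simpa [h15₂], by simp [h15₂], fun c hcn hcβ => Or.inl ?_, hQ₂⟩, ?_⟩
      · rw [div_eq_iff_block hk] at hcβ
        exact Finset.mem_filter.2 ⟨Finset.mem_Ico.2 ⟨by omega, by omega⟩, heT c hcn⟩
      · have := card_cands_le e (β * k) b (T + 1)
        simpa using rounds_mono (this.trans (by omega))
    · rintro i s₃ hs₃ ⟨lo, hi, Em, hI, hi'⟩ hlt
      have hc₃ := (hc₂.setReg 0 (by decide)).same hs₃ (by decide) (by decide)
      have h8₃ := hs₃.reg 8 (by decide)
      have h11₃ := hs₃.arr 11 (by decide)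
      have h40₃ := hs₃.reg 40 (by decide)
      have h41₃ := hs₃.reg 41 (by decide)
      simp [h11₂, h40₂, h41₂] at h8₃ h11₃ h40₃ h41₃
      rcases hI.sel with ⟨h57, _⟩ | ⟨h57, hx, hsp⟩
      · omega
      set x := s₃.reg 56 with hxdef
      have hxm := Finset.mem_filter.1 hx
      have hxI := Finset.mem_Ico.1 hxm.1
      have hhi := hI.hi_le
      have hlo := hI.lo_ge
      have hpos : 0 < (cands e lo hi Em).card := Finset.card_pos.2 ⟨x, hx⟩
      have hxn : x < n := by omega
      refine ⟨by have := rounds_lt hpos (a := 0) (by omega); omega, ?_⟩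
      simp only [searchStep, Prog.block, wp_seq]
      refine (eccOf_runs hS hc₃ hxn hxdef.symm).wp fun s₄ t₄ hs₄ ⟨hw, hval, hmax⟩ ht₄ => ?_
      have hc₄ := hc₃.same hs₄ (by decide) (by decide)
      have h11₄ := (hs₄.arr 11 (by decide)).trans h11₃
      have h40₄ := (hs₄.reg 40 (by decide)).trans h40₃
      have h41₄ := (hs₄.reg 41 (by decide)).trans h41₃
      have h42₄ := (hs₄.reg 42 (by decide)).trans hI.r42
      have h43₄ := (hs₄.reg 43 (by decide)).trans hI.r43
      have h44₄ := (hs₄.reg 44 (by decide)).trans hI.r44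
      have h15₄ := hs₄.reg 15 (by decide)
      have h56₄ := hs₄.reg 56 (by decide)
      rw [← hxdef] at h56₄
      rw [← hE] at hval hmax
      set w := s₄.reg 61 with hwdef
      set val := s₄.reg 60 with hvaldef
      have hvT : val ≤ T := hval ▸ mdist_le _ _
      have hbest := hI.genuine.le
      -- What all three cases have in common: whenever the new candidate set lost a quarter and
      -- every lost candidate is covered by `val`, the invariant survives the next selection.
      have cont : ∀ (s₅ : State) (t₅ lo' hi' Em' : ℕ), Ctx n m k T fa fb fw s₅ → s₅.arr 11 = e →
          s₅.reg 15 = min (s₃.reg 15) val → s₅.reg 42 = lo' → s₅.reg 43 = hi' → s₅.reg 44 = Em' →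
          t₅ ≤ t₄ + 10 → lo ≤ lo' → hi' ≤ hi → lo' ≤ n →
          4 * (cands e lo' hi' Em').card ≤ 3 * (cands e lo hi Em).card →
          (∀ c ∈ cands e lo hi Em, c ∈ cands e lo' hi' Em' ∨ Covered n T E val c) →
          wp B select (fun s'' t ↦ t ≤ n * 30 + m * 40 + k * (k * 20 + 40) + 80 ∧
            ∃ lo hi Em, SearchInv n k T β (s.reg 15) E e lo hi Em s'' ∧
              i + 1 + rounds (cands e lo hi Em).card ≤ rounds k) s₅ t₅ := by
        intro s₅ t₅ lo' hi₁ Em' hc₅ h11₅ h15₅ h42₅ h43₅ h44₅ ht₅ hlo' hhi' hlon hcard hcov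
        refine (select_runs (k := k) (by omega) (by omega) (by omega) hkB h42₅ h43₅ h44₅ h11₅).wp
          fun s₆ t₆ hs₆ hQ₆ ht₆ => ?_
        have h15₆ := (hs₆.reg 15 (by decide)).trans h15₅
        refine ⟨by omega, lo', hi₁, Em', ⟨(hs₆.reg 42 (by decide)).trans h42₅,
          (hs₆.reg 43 (by decide)).trans h43₅, (hs₆.reg 44 (by decide)).trans h44₅, by omega,
          by omega, hlon, ?_, ?_, fun c hcn hcβ => ?_, hQ₆⟩, ?_⟩
        · rw [h15₆]
          rcases min_choice (s₃.reg 15) val with h | h <;> rw [h]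
          · exact hI.genuine
          · exact Or.inr ⟨x, hxn, ⟨w, hw, hval⟩, hmax⟩
        · have := hI.le; omega
        · rcases hI.cover c hcn hcβ with h | h
          · refine (hcov c h).imp_right fun h d hd => ?_
            have := h d hd; omega
          · refine Or.inr fun d hd => ?_
            have := h d hd; omega
        · have := rounds_lt hpos hcard
          omega
      have hcov : ∀ c, (w ≤ c ∧ c ≤ x) ∨ (x ≤ c ∧ c ≤ w) → Covered n T E val c := fun c h => by
        rw [hval]; exact covered_of_between hS.lt_of_mem hxn hw h
      have hxk : x / k = β := (div_eq_iff_block hk).2 ⟨by omega, by omega⟩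
      have fin : ∀ (s₅ : State) (t₅ : ℕ), Ctx n m k T fa fb fw s₅ → s₅.arr 11 = e →
          s₅.reg 15 = min (s₃.reg 15) val → s₅.reg 42 = lo → s₅.reg 43 = hi → s₅.reg 44 = Em →
          s₅.reg 40 = β * k → s₅.reg 41 = b → s₅.reg 56 = x → s₅.reg 60 = val → s₅.reg 61 = w →
          t₅ ≤ t₄ + 2 →
          wp B (.cond 61 40 (.seq (.mov 42 56) (.inc 42)) (.cond 61 41 (.mov 44 60) (.mov 43 56)))
            (wp B select (fun s'' t ↦ t ≤ n * 30 + m * 40 + k * (k * 20 + 40) + 80 ∧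
            ∃ lo hi Em, SearchInv n k T β (s.reg 15) E e lo hi Em s'' ∧
              i + 1 + rounds (cands e lo hi Em).card ≤ rounds k)) s₅ t₅ := by
        intro s₅ t₅ hc₅ h11₅ h15₅ h42₅ h43₅ h44₅ h40₅ h41₅ h56₅ h60₅ h61₅ ht₅
        simp only [wp_cond, Prog.inc, wp_seq, wp_mov, wp_const, wp_op, BinOp.eval, h40₅, h41₅,
          h56₅, h60₅, h61₅, State.setReg_reg]
        refine ⟨fun hwa => ⟨by omega, by omega, by simp; omega, ?_⟩, fun hwa => ⟨fun hwb =>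
          ⟨by omega, ?_⟩, fun hwb => ⟨by omega, ?_⟩⟩⟩
        -- Here `w` precedes the block, so each discarded `c` satisfies `w ≤ c ≤ x`.
        · refine cont _ _ (x + 1) hi Em (((hc₅.setReg _ (by decide)).setReg _ (by decide)).setReg _
            (by decide)) (by simpa) (by simpa) (by simp) (by simpa) (by simpa) (by omega) (by omega)
            le_rfl (by omega) (cands_shrink_lo hsp hxI.1) fun c hcc => ?_
          by_cases hcx : c ≤ x
          · have := Finset.mem_Ico.1 (Finset.mem_filter.1 hcc).1
            exact Or.inr (hcov c (Or.inl ⟨by omega, hcx⟩))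
          · refine Or.inl ?_
            simp only [cands, Finset.mem_filter, Finset.mem_Ico] at hcc ⊢
            exact ⟨⟨by omega, by omega⟩, hcc.2⟩
        · have hwk : w / k = β := (div_eq_iff_block hk).2 ⟨by omega, by omega⟩
          have h1 := he.le x hxn w hw (hxk.trans hwk.symm)
          -- Since `w` is in the block, `e x` is at least the distance to `w`; being attained at
          -- some vertex, it is also at most the eccentricity.
          have h2 : e x = val := by
            obtain ⟨y, hy, hey⟩ := he.ex x hxn
            have := hmax y hy
            omega
          refine cont _ _ lo hi val (hc₅.setReg _ (by decide)) (by simpa) (by simpa) (by simpa)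
            (by simpa) (by simp) (by omega) le_rfl le_rfl hI.lo_le ?_ fun c hcc => ?_
          · rw [← h2]; exact cands_shrink_e hsp hxm.2
          · simp only [cands, Finset.mem_filter, Finset.mem_Ico] at hcc ⊢
            by_cases hcv : e c < val
            · exact Or.inl ⟨hcc.1, hcv⟩
            -- Such a `c` has eccentricity at least `e c ≥ val`, even without the factor two.
            · refine Or.inr fun d hd => ?_
              obtain ⟨y, hy, hey⟩ := he.ex c (by omega)
              have := hd y hy
              omega
        -- Here `w` comes after the block, so each discarded `c` satisfies `x ≤ c ≤ w`.
        · refine cont _ _ lo x Em (hc₅.setReg _ (by decide)) (by simpa) (by simpa) (by simpa)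
            (by simp) (by simpa) (by omega) le_rfl (by omega) hI.lo_le (cands_shrink_hi hsp (by omega))
            fun c hcc => ?_
          have hci := Finset.mem_Ico.1 (Finset.mem_filter.1 hcc).1
          by_cases hcx : x ≤ c
          · exact Or.inr (hcov c (Or.inr ⟨hcx, by omega⟩))
          · refine Or.inl ?_
            simp only [cands, Finset.mem_filter, Finset.mem_Ico] at hcc ⊢
            exact ⟨⟨by omega, by omega⟩, hcc.2⟩
      rw [wp_seq, wp_cond]
      refine ⟨fun h => ?_, fun h => ?_⟩
      · rw [wp_mov, wp_seq]
        refine ⟨by omega, fin _ _ (hc₄.setReg _ (by decide)) ?_ ?_ ?_ ?_ ?_ ?_ ?_ ?_ ?_ ?_ ?_⟩ <;>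
          simp <;> omega
      · rw [wp_skip, wp_seq]
        refine fin _ _ hc₄ ?_ ?_ ?_ ?_ ?_ ?_ ?_ ?_ ?_ ?_ ?_ <;> omega
    · rintro s₃ t₃ hs₃ ⟨i, hi', ⟨lo, hi, Em, hI, _⟩, hlt⟩ ht₃
      have h8₃ : s₃.reg 8 = 0 := by simpa using hs₃.reg 8 (by decide)
      refine ⟨?_, hI.genuine, hI.le, fun c hcn hcβ => ?_⟩
      · rw [add_mul]
        have : rounds k * (n * 30 + m * 40 + k * (k * 20 + 40) + 80 + 1) ≤
          rounds k * (n * 30 + m * 40 + k * (k * 20 + 40) + 100) := Nat.mul_le_mul_left _ (by omega)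
        omega
      · rcases hI.sel with ⟨_, h⟩ | ⟨h, _⟩
        · rcases hI.cover c hcn hcβ with h' | h'
          · rw [h] at h'; simp at h'
          · exact h'
        · omega
  refine ⟨by omega, by omega, fun h => ⟨by omega, ?_⟩, fun h => ?_⟩
  · simp only [wp_seq, wp_mov, wp_const, wp_op, BinOp.eval]
    refine ⟨by simp; omega, by simp [hc.r13]; omega, by omega, by simp [hc.r13]; omega, ?_⟩
    refine main _ _ n ?_ (by simpa) (by simpa) (by simp) (by simp) (by simp) (by simp [hc.r13])
      (by simp) (by omega) (by omega)
    iterate 7 refine Ctx.setReg ?_ _ (by decide)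
    exact hc
  · simp only [wp_skip, wp_seq, wp_mov, wp_const, wp_op, BinOp.eval]
    refine ⟨by simp; omega, by simp [hc.r13]; omega, by omega, by simp [hc.r13]; omega, ?_⟩
    refine main _ _ (β * k + k) ?_ (by simpa) (by simpa) (by simp) (by simp) (by simp)
      (by simp [hc.r13]) (by simp) (by omega) (by omega)
    iterate 6 refine Ctx.setReg ?_ _ (by decide)
    exact hc

def searchBody : Prog := .seq searchBlock (.op .add 40 40 14)

def search : Prog := .block [.mov 15 13, .const 40 0, .loop 40 10 searchBody]

theorem search_runs {B n m k T W : ℕ} {fa fb fw : ℕ → ℕ}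
    (hS : Sorted B n m k T W fa fb fw) {s : State} (hc : Ctx n m k T fa fb fw s)
    (he : IsBlockEcc n k T (edgeList m fa fb fw) (s.arr 11)) (hn : n ≤ k * k) (hkB : 4 * k + 4 ≤ B) :
    Runs B search s
      (k * ((rounds k + 1) * (n * 30 + m * 40 + k * (k * 20 + 40) + 100) + 2) + 10) fun s' =>
      Genuine n T (edgeList m fa fb fw) (s'.reg 15) ∧
      ∀ c < n, Covered n T (edgeList m fa fb fw) (s'.reg 15) c := by
  have hb := hS.bound
  have hk := hS.k_pos
  apply Runs.of_wp
  simp only [search, Prog.block, wp_seq, wp_mov, wp_const, hc.r13]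
  refine ⟨by omega, by omega, ?_⟩
  refine Runs.wp (T := k * ((rounds k + 1) * (n * 30 + m * 40 + k * (k * 20 + 40) + 100) + 1 + 1) + 1)
    (Runs.loop (N := k) (I := fun i s' => s'.reg 40 = i * k ∧
      Genuine n T (edgeList m fa fb fw) (s'.reg 15) ∧
      ∀ c < n, c < i * k → Covered n T (edgeList m fa fb fw) (s'.reg 15) c) ?_ ?_) ?_
  · exact ⟨by simp, Or.inl (by simp), by simp⟩
  · intro i s₁ hs₁ ⟨h40, hg, hcov⟩ hlt
    have hc₁ := ((hc.setReg _ (by decide)).setReg _ (by decide)).same hs₁ (by decide) (by decide)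
    have h11₁ : s₁.arr 11 = s.arr 11 := hs₁.arr 11 (by decide)
    rw [h40, hc₁.r10] at hlt
    -- A block start `i * k` below `n ≤ k * k` forces `i < k`: there are at most `k` blocks.
    refine ⟨Nat.lt_of_mul_lt_mul_right (hlt.trans_le hn), ?_⟩
    rw [searchBody, wp_seq]
    refine (searchBlock_runs hS hc₁ he h11₁ h40 hlt hkB hg).wp fun s₂ t₂ hs₂ ⟨hg₂, hle, hcov₂⟩ ht₂ => ?_
    have hc₂ := hc₁.same hs₂ (by decide) (by decide)
    have h40₂ := (hs₂.reg 40 (by decide)).trans h40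
    simp only [wp_op, BinOp.eval, h40₂, hc₂.r14, State.setReg_reg]
    refine ⟨by omega, by omega, by simp [add_mul], by simpa, fun c hcn hci => ?_⟩
    simp only [show ¬ 15 = 40 by decide, if_false]
    by_cases h : c < i * k
    · intro d hd
      exact hle.trans (hcov c hcn h d hd)
    · refine hcov₂ c hcn ((div_eq_iff_block hk).2 ⟨by omega, ?_⟩)
      rwa [add_mul, one_mul] at hci
  · rintro s₁ t₁ hs₁ ⟨i, hi, ⟨h40, hg, hcov⟩, hge⟩ ht₁
    have hc₁ := ((hc.setReg _ (by decide)).setReg _ (by decide)).same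
      (P := .loop 40 10 searchBody) hs₁ (by decide) (by decide)
    rw [h40, hc₁.r10] at hge
    change t₁ ≤ 0 + 1 + 1 +
      (k * ((rounds k + 1) * (n * 30 + m * 40 + k * (k * 20 + 40) + 100) + 2) + 1) at ht₁
    exact ⟨by omega, hg, fun c hcn => hcov c hcn (by omega)⟩

/-! ## Reading the graph -/

/-- The edges of an encoded graph are stored in the array `A`. -/
structure Input (n m W : ℕ) (A : ℕ → ℕ) : Prop where
  src_lt : ∀ e < m, A (e * 3 + 2) < n
  dst_lt : ∀ e < m, A (e * 3 + 3) < n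
  wt_le : ∀ e < m, A (e * 3 + 4) ≤ W

/-- A linked list, in the array `nx`; pointers are shifted by one, and `0` is the empty list. -/
def Chain (nx : ℕ → ℕ) : ℕ → List ℕ → Prop
  | h, [] => h = 0
  | h, e :: l => h = e + 1 ∧ Chain nx (nx e) l

theorem Chain.congr {nx nx' : ℕ → ℕ} {h : ℕ} {l : List ℕ} (hc : Chain nx h l)
    (hl : ∀ e ∈ l, nx' e = nx e) : Chain nx' h l := by
  induction l generalizing h with
  | nil => exact hc
  | cons e l ih =>
    refine ⟨hc.1, ?_⟩
    rw [hl e (by simp)]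
    exact ih hc.2 fun e' he' => hl e' (by simp [he'])

/-- The first `i` edges with source `v`, the last one first. -/
def outEdges (A : ℕ → ℕ) (v i : ℕ) : List ℕ :=
  ((List.range i).filter fun e => A (e * 3 + 2) = v).reverse

theorem mem_outEdges {A : ℕ → ℕ} {v i e : ℕ} :
    e ∈ outEdges A v i ↔ e < i ∧ A (e * 3 + 2) = v := by
  simp [outEdges]

/-- The numbers `n` and `m` occupy the cells 0 and 1, so edge `e` occupies the cells `3e + 2`, `3e +
3` and `3e + 4`. Prepending it to the list of its source takes two stores. -/
def readBody : Prog := .block [.const 9 3, .op .mul 21 20 9, .const 9 2, .op .add 21 21 9,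
  .load 23 0 21, .const 9 1, .op .add 21 21 9, .load 24 0 21, .op .add 21 21 9, .load 25 0 21,
  .load 26 2 23, .store 1 20 26, .op .add 20 20 9, .store 2 23 20,
  .load 26 3 24, .op .add 26 26 9, .store 3 24 26, .cond 12 25 (.mov 12 25) .skip]

/-- Build linked lists of the edges by their sources in the arrays `1` and `2`, the in-degrees in
array `3`, and the largest edge length in register `12`. -/
def readEdges : Prog := .block [.const 12 0, .const 20 0, .loop 20 11 readBody]

theorem readEdges_runs {B n m W : ℕ} {s : State} (hin : Input n m W (s.arr 0))
    (h11 : s.reg 11 = m) (hB : 3 * m + W + 10 ≤ B) (h2 : s.arr 2 = 0) (h3 : s.arr 3 = 0) :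
    Runs B readEdges s (m * 30 + 10) fun s' =>
      (∀ e < m, s.arr 0 (e * 3 + 4) ≤ s'.reg 12) ∧ s'.reg 12 ≤ W ∧
      (∀ v, s'.arr 3 v = ((Finset.range m).filter fun e => s.arr 0 (e * 3 + 3) = v).card) ∧
      ∀ v, Chain (s'.arr 1) (s'.arr 2 v) (outEdges (s.arr 0) v m) := by
  apply Runs.of_wp
  simp only [readEdges, Prog.block, wp_seq, wp_const]
  refine ⟨by omega, by omega, ?_⟩
  refine Runs.wp (T := m * (29 + 1) + 1) (Runs.for (N := m) (I := fun i s' => s'.reg 20 = i ∧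
      (∀ e < i, s.arr 0 (e * 3 + 4) ≤ s'.reg 12) ∧ s'.reg 12 ≤ W ∧
      (∀ v, s'.arr 3 v = ((Finset.range i).filter fun e => s.arr 0 (e * 3 + 3) = v).card) ∧
      ∀ v, Chain (s'.arr 1) (s'.arr 2 v) (outEdges (s.arr 0) v i)) ?_ ?_ ?_) ?_
  · simp [h2, h3, outEdges, Chain]
  · intro i s' hs hI
    have h11' := hs.reg 11 (by decide)
    simp [h11] at h11'
    rw [hI.1, h11']
  · intro i s' hs hi ⟨h20, hle, hW, hdeg, hch⟩
    have h0 : s'.arr 0 = s.arr 0 := hs.arr 0 (by decide)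
    have hw := hin.wt_le i hi
    have hd : s'.arr 3 (s.arr 0 (i * 3 + 3)) ≤ i := by
      rw [hdeg]; simpa using Finset.card_filter_le (Finset.range i) _
    have hdeg' : ∀ v, Function.update (s'.arr 3) (s.arr 0 (i * 3 + 3))
        (s'.arr 3 (s.arr 0 (i * 3 + 3)) + 1) v =
        ((Finset.range (i + 1)).filter fun e => s.arr 0 (e * 3 + 3) = v).card := by
      intro v
      rw [Finset.range_add_one, Finset.filter_insert, Function.update_apply]
      split_ifs with h h' h'
      · rw [Finset.card_insert_of_notMem (by simp), hdeg, h]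
      · exact absurd h.symm h'
      · exact absurd h'.symm h
      · exact hdeg v
    have hch' : ∀ v, Chain (Function.update (s'.arr 1) i (s'.arr 2 (s.arr 0 (i * 3 + 2))))
        (Function.update (s'.arr 2) (s.arr 0 (i * 3 + 2)) (i + 1) v) (outEdges (s.arr 0) v (i + 1)) := by
      intro v
      -- The link cell `i` belongs to none of the lists of the first `i` edges, so writing it leaves
      -- them intact.
      have hcong : ∀ v, Chain (Function.update (s'.arr 1) i (s'.arr 2 (s.arr 0 (i * 3 + 2))))
          (s'.arr 2 v) (outEdges (s.arr 0) v i) := fun v => (hch v).congr fun e he => by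
        rw [Function.update_of_ne (mem_outEdges.1 he).1.ne]
      rw [outEdges, List.range_succ, List.filter_append, Function.update_apply]
      split_ifs with h
      · simp only [List.filter_singleton, ← h, decide_true, cond_true, List.reverse_append,
          List.reverse_singleton, List.singleton_append]
        refine ⟨rfl, ?_⟩
        rw [Function.update_self]
        have h2 := hcong v
        rw [← h] at h2
        exact h2
      · simp only [List.filter_singleton, show ¬ s.arr 0 (i * 3 + 2) = v from fun h' => h h'.symm,
          decide_false, cond_false, List.append_nil]
        exact hcong v
    simp [readBody, Prog.block, wp, BinOp.eval, h20, h0, show i * 3 + 2 + 1 = i * 3 + 3 from rfl,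
      show i * 3 + 3 + 1 = i * 3 + 4 from rfl]
    refine ⟨by omega, by omega, by omega, by omega, by omega, by omega, by omega, by omega, by omega,
      fun h => ⟨by omega, fun e he => ?_, hw, hdeg', hch'⟩,
      fun h => ⟨fun e he => ?_, hW, hdeg', hch'⟩⟩
    · rcases he.lt_or_eq with he | rfl
      · exact (hle e he).trans h.le
      · exact le_rfl
    · rcases he.lt_or_eq with he | rfl
      · exact hle e he
      · exact h
  · rintro s' t' hs ⟨_, hQ⟩ ht
    exact ⟨by omega, hQ⟩

/-! ## Topological sorting -/

/-- The queue `q` is stored in the array `a`, and the positions of its elements in `p`. -/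
def QueueRep (q : List ℕ) (a p : ℕ → ℕ) : Prop := ∀ j v, q[j]? = some v → a j = v ∧ p v = j

theorem QueueRep.push {q : List ℕ} {a p : ℕ → ℕ} (h : QueueRep q a p) {v : ℕ} (hv : v ∉ q) :
    QueueRep (q ++ [v]) (Function.update a q.length v) (Function.update p v q.length) := by
  intro j u hu
  rcases lt_or_ge j q.length with hj | hj
  · rw [List.getElem?_append_left hj] at hu
    have huq : u ∈ q := List.mem_of_getElem? hu
    rw [Function.update_of_ne hj.ne, Function.update_of_ne (by rintro rfl; exact hv huq)]
    exact h j u hu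
  · rw [List.getElem?_append_right hj, List.getElem?_singleton] at hu
    split_ifs at hu with hj'
    simp only [Option.some.injEq] at hu
    subst hu
    have : j = q.length := by omega
    simp [this]

theorem QueueRep.pos_lt {q : List ℕ} {a p : ℕ → ℕ} (h : QueueRep q a p) {v : ℕ} (hv : v ∈ q) :
    p v < q.length ∧ q[p v]? = some v := by
  obtain ⟨j, hj, rfl⟩ := List.getElem_of_mem hv
  have := h j _ (List.getElem?_eq_getElem hj)
  rw [this.2]
  exact ⟨hj, List.getElem?_eq_getElem hj⟩

theorem QueueRep.pos_inj {q : List ℕ} {a p : ℕ → ℕ} (h : QueueRep q a p) {u v : ℕ} (hu : u ∈ q)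
    (hv : v ∈ q) (huv : p u = p v) : u = v := by
  have h1 := (h.pos_lt hu).2
  rw [huv, (h.pos_lt hv).2] at h1
  exact (Option.some.inj h1).symm

/-- The stored positions show that the queue has no repetition; the rest is the pigeonhole
principle. -/
theorem QueueRep.length_le {q : List ℕ} {a p : ℕ → ℕ} (h : QueueRep q a p) {n : ℕ}
    (hn : ∀ v ∈ q, v < n) : q.length ≤ n := by
  have hnd : q.Nodup := by
    rw [List.nodup_iff_injective_getElem]
    intro i j hij
    simp only at hij
    have h1 := h _ _ (List.getElem?_eq_getElem i.2)
    have h2 := h _ _ (List.getElem?_eq_getElem j.2)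
    rw [← hij, h1.2] at h2
    exact Fin.ext h2.2
  simpa using (hnd.subperm (l₂ := List.range n) fun v hv => List.mem_range.2 (hn v hv)).length_le

def queueInitBody : Prog := .block [.load 32 3 30, .const 9 1,
  .cond 32 9 (.block [.store 4 31 30, .store 5 30 31, .op .add 31 31 9]) .skip, .op .add 30 30 9]

def queueInit : Prog := .block [.const 30 0, .const 31 0, .loop 30 10 queueInitBody]

theorem queueInit_runs {B n : ℕ} {s : State} (h10 : s.reg 10 = n) (hB : n + 10 ≤ B) :
    Runs B queueInit s (n * 20 + 10) fun s' => ∃ q : List ℕ, s'.reg 31 = q.length ∧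
      QueueRep q (s'.arr 4) (s'.arr 5) ∧ ∀ v, v ∈ q ↔ v < n ∧ s.arr 3 v = 0 := by
  apply Runs.of_wp
  simp only [queueInit, Prog.block, wp_seq, wp_const]
  refine ⟨by omega, by omega, ?_⟩
  refine Runs.wp (T := n * (19 + 1) + 1) (Runs.for (N := n) (I := fun i s' => s'.reg 30 = i ∧
      ∃ q : List ℕ, s'.reg 31 = q.length ∧
      QueueRep q (s'.arr 4) (s'.arr 5) ∧ ∀ v, v ∈ q ↔ v < i ∧ s.arr 3 v = 0) ?_ ?_ ?_) ?_
  · exact ⟨by simp, [], by simp, fun j v h => by simp at h, by simp⟩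
  · intro i s' hs hI
    have h10' := hs.reg 10 (by decide)
    simp [h10] at h10'
    rw [hI.1, h10']
  · rintro i s' hs hi ⟨h30, q, h31, hq, hmem⟩
    have h3 : s'.arr 3 = s.arr 3 := hs.arr 3 (by decide)
    have hlen := hq.length_le fun v hv => ((hmem v).1 hv).1
    simp only [queueInitBody, Prog.block, wp_seq, wp_const, wp_load, wp_cond, wp_store, wp_op, wp_skip]
    simp [BinOp.eval, h30, h31, h3]
    refine ⟨by omega, fun h => ⟨by omega, by omega, q ++ [i], by simp, hq.push ?_, fun v => ?_⟩,
      fun h => ⟨by omega, q, rfl, hq, fun v => ?_⟩⟩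
    · rw [hmem]; omega
    · rw [List.mem_append, hmem, List.mem_singleton]
      constructor
      · rintro (⟨h1, h2⟩ | rfl)
        · exact ⟨by omega, h2⟩
        · exact ⟨by omega, h⟩
      · rintro ⟨h1, h2⟩
        rcases (show v ≤ i by omega).lt_or_eq with h' | h'
        · exact Or.inl ⟨h', h2⟩
        · exact Or.inr h'
    · rw [hmem]
      constructor
      · rintro ⟨h1, h2⟩
        exact ⟨by omega, h2⟩
      · rintro ⟨h1, h2⟩
        rcases (show v ≤ i by omega).lt_or_eq with h' | rfl
        · exact ⟨h', h2⟩
        · omega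
  · rintro s' t' hs ⟨_, hQ⟩ ht
    exact ⟨by omega, hQ⟩

/-- Advance to the next vertex of the queue. -/
def sortNext : Prog := .block [.op .add 30 30 9, .load 35 4 30, .load 33 2 35]

/-- Output the edge that the pointer in register `33` stands for. -/
def sortEdge : Prog := .block [.op .sub 36 33 9, .store 6 34 30, .const 37 3, .op .mul 38 36 37,
  .op .add 38 38 37, .load 39 0 38, .store 7 34 39, .op .add 38 38 9, .load 40 0 38, .store 8 34 40,
  .op .add 34 34 9, .load 41 3 39, .op .sub 41 41 9, .store 3 39 41,
  .cond 41 9 (.block [.store 4 31 39, .store 5 39 31, .op .add 31 31 9]) .skip, .load 33 1 36]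

def sortBody : Prog := .block [.const 9 1, .cond 33 9 sortNext sortEdge]

/-- Topological sorting: the positions of the vertices in array `5`, and the edges, sorted by the
positions of their sources, in the arrays `6` (position of the source), `7` (target), `8` (length). -/
def sortEdges : Prog := .block [queueInit, .const 30 0, .load 35 4 30, .load 33 2 35, .const 34 0,
  .loop 30 31 sortBody]

/-- The invariant of the topological sorting; `em` are the edges that were output, `rem` are the
edges of the current vertex that are still to be output. -/
structure SortInv (n m : ℕ) (A : ℕ → ℕ) (q em rem : List ℕ) (i : ℕ) (s : State) : Prop where
  r30 : s.reg 30 = i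
  r31 : s.reg 31 = q.length
  r34 : s.reg 34 = em.length
  rep : QueueRep q (s.arr 4) (s.arr 5)
  q_lt : ∀ v ∈ q, v < n
  i_le : i ≤ q.length
  indeg : ∀ v, s.arr 3 v = ((Finset.range m).filter fun e => A (e * 3 + 3) = v ∧ e ∉ em).card
  q_iff : ∀ v < n, v ∈ q ↔ s.arr 3 v = 0
  em_lt : ∀ e ∈ em, e < m
  em_nodup : em.Nodup
  src_mem : ∀ e ∈ em, A (e * 3 + 2) ∈ q
  src_le : ∀ e ∈ em, s.arr 5 (A (e * 3 + 2)) ≤ i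
  out : ∀ j e, em[j]? = some e → s.arr 6 j = s.arr 5 (A (e * 3 + 2)) ∧ s.arr 7 j = A (e * 3 + 3) ∧
    s.arr 8 j = A (e * 3 + 4)
  sorted : ∀ j j', j ≤ j' → j' < em.length → s.arr 6 j ≤ s.arr 6 j'
  topo : ∀ e < m, A (e * 3 + 3) ∈ q → A (e * 3 + 2) ∈ q ∧
    s.arr 5 (A (e * 3 + 2)) < s.arr 5 (A (e * 3 + 3))
  fin : ∀ e < m, A (e * 3 + 2) ∈ q → s.arr 5 (A (e * 3 + 2)) < i → e ∈ em
  cur : ∀ u, q[i]? = some u → (∀ e < m, A (e * 3 + 2) = u → e ∈ em ∨ e ∈ rem) ∧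
    (∀ e ∈ rem, e < m ∧ A (e * 3 + 2) = u ∧ e ∉ em) ∧ rem.Nodup ∧ Chain (s.arr 1) (s.reg 33) rem

/-- An exhausted edge list means that all edges of the current vertex were output. The next queue
cell may lie past the end of the queue; what is loaded then is harmless, because `cur` only speaks
of existing queue entries. -/
theorem SortInv.next {n m i : ℕ} {A : ℕ → ℕ} {q em rem : List ℕ} {s : State}
    (h : SortInv n m A q em rem i s) (hi : i < q.length) (h33 : s.reg 33 < 1)
    (hch : ∀ v, Chain (s.arr 1) (s.arr 2 v) (outEdges A v m)) (v35 v9 : ℕ) :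
    SortInv n m A q em (outEdges A (s.arr 4 (i + 1)) m) (i + 1)
      ((((s.setReg 9 v9).setReg 30 (i + 1)).setReg 35 v35).setReg 33 (s.arr 2 (s.arr 4 (i + 1)))) where
  r30 := by simp
  r31 := by simpa using h.r31
  r34 := by simpa using h.r34
  rep := h.rep
  q_lt := h.q_lt
  i_le := hi
  indeg := h.indeg
  q_iff := h.q_iff
  em_lt := h.em_lt
  em_nodup := h.em_nodup
  src_mem := h.src_mem
  src_le e he := (h.src_le e he).trans (by omega)
  out := h.out
  sorted := h.sorted
  topo := h.topo
  fin e he hq hlt := by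
    rcases (Nat.lt_succ_iff.1 hlt).lt_or_eq with h' | h'
    · exact h.fin e he hq h'
    · obtain ⟨h1, _, _, h2⟩ := h.cur (A (e * 3 + 2)) (by rw [← h']; exact (h.rep.pos_lt hq).2)
      refine (h1 e he rfl).resolve_right fun hr => ?_
      cases rem with
      | nil => simp at hr
      | cons a l => have := h2.1; omega
  cur u hu := by
    have hu4 := (h.rep _ _ hu).1
    have hu5 := (h.rep _ _ hu).2
    rw [hu4]
    refine ⟨fun e he hs => Or.inr (mem_outEdges.2 ⟨he, hs⟩), fun e he => ?_, ?_, ?_⟩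
    · obtain ⟨h1, h2⟩ := mem_outEdges.1 he
      refine ⟨h1, h2, fun hem => ?_⟩
      have := h.src_le e hem
      rw [h2, hu5] at this
      omega
    · exact List.nodup_reverse.2 (List.nodup_range.filter _)
    · simpa using hch u

theorem indeg_append {m : ℕ} {A : ℕ → ℕ} {em : List ℕ} {e : ℕ} (he : e < m) (hem : e ∉ em) (v : ℕ) :
    ((Finset.range m).filter fun e' => A (e' * 3 + 3) = v ∧ e' ∉ em ++ [e]).card =
      ((Finset.range m).filter fun e' => A (e' * 3 + 3) = v ∧ e' ∉ em).card -
        if v = A (e * 3 + 3) then 1 else 0 := by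
  split_ifs with h
  · rw [← Finset.card_erase_of_mem (a := e) (by simp [he, hem, h])]
    congr 1
    ext e'
    simp only [Finset.mem_filter, Finset.mem_erase, List.mem_append, List.mem_singleton, not_or]
    tauto
  · rw [Nat.sub_zero]
    congr 1
    ext e'
    simp only [Finset.mem_filter, List.mem_append, List.mem_singleton, not_or]
    constructor
    · tauto
    · rintro ⟨h1, h2, h3⟩
      refine ⟨h1, h2, h3, ?_⟩
      rintro rfl
      exact h h2.symm

/-- The part of the invariant of the topological sorting that does not depend on whether a vertex
is appended to the queue. -/
theorem SortInv.edge {n m W i : ℕ} {A : ℕ → ℕ} {q q' em rem : List ℕ} {e : ℕ} {s s' : State}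
    (h : SortInv n m A q em (e :: rem) i s) (hA : Input n m W A) (hi : i < q.length)
    (h30 : s'.reg 30 = i) (h31 : s'.reg 31 = q'.length) (h34 : s'.reg 34 = em.length + 1)
    (h33 : s'.reg 33 = s.arr 1 e) (h1 : s'.arr 1 = s.arr 1)
    (h3 : s'.arr 3 = Function.update (s.arr 3) (A (e * 3 + 3)) (s.arr 3 (A (e * 3 + 3)) - 1))
    (h6 : s'.arr 6 = Function.update (s.arr 6) em.length i)
    (h7 : s'.arr 7 = Function.update (s.arr 7) em.length (A (e * 3 + 3)))
    (h8 : s'.arr 8 = Function.update (s.arr 8) em.length (A (e * 3 + 4)))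
    (hq : (s.arr 3 (A (e * 3 + 3)) ≠ 1 ∧ q' = q ∧ s'.arr 4 = s.arr 4 ∧ s'.arr 5 = s.arr 5) ∨
      (s.arr 3 (A (e * 3 + 3)) = 1 ∧ q' = q ++ [A (e * 3 + 3)] ∧
        s'.arr 4 = Function.update (s.arr 4) q.length (A (e * 3 + 3)) ∧
        s'.arr 5 = Function.update (s.arr 5) (A (e * 3 + 3)) q.length)) :
    SortInv n m A q' (em ++ [e]) rem i s' := by
  obtain ⟨u, hu⟩ : ∃ u, q[i]? = some u := ⟨_, List.getElem?_eq_getElem hi⟩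
  obtain ⟨hc1, hc2, hc3, hc4⟩ := h.cur u hu
  obtain ⟨hem, hsu, hnem⟩ := hc2 e (by simp)
  have hpu : s.arr 5 u = i := (h.rep _ _ hu).2
  have huq : u ∈ q := List.mem_of_getElem? hu
  have hvn := hA.dst_lt e hem
  set v := A (e * 3 + 3) with hv
  have hpos : 0 < s.arr 3 v := by
    rw [h.indeg, Finset.card_pos]
    exact ⟨e, by simp [hem, hnem, hv]⟩
  -- The edge `e` into `v` was not yet output, so the counter of `v` is positive and `v` was not
  -- queued.
  have hvq : v ∉ q := fun h' => by have := (h.q_iff v hvn).1 h'; omega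
  have hsub : ∀ x ∈ q, x ∈ q' ∧ s'.arr 5 x = s.arr 5 x := by
    intro x hx
    rcases hq with ⟨_, rfl, _, h5⟩ | ⟨_, rfl, _, h5⟩
    · exact ⟨hx, by rw [h5]⟩
    · refine ⟨by simp [hx], ?_⟩
      rw [h5, Function.update_of_ne]
      rintro rfl; exact hvq hx
  have hrep : QueueRep q' (s'.arr 4) (s'.arr 5) := by
    rcases hq with ⟨_, rfl, h4, h5⟩ | ⟨_, rfl, h4, h5⟩
    · rw [h4, h5]; exact h.rep
    · rw [h4, h5]; exact h.rep.push hvq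
  have hmem : ∀ x, x ∈ q' ↔ x ∈ q ∨ (x = v ∧ s.arr 3 v = 1) := by
    intro x
    rcases hq with ⟨h', rfl, _, _⟩ | ⟨h', rfl, _, _⟩
    · simp [h']
    · simp [h']
  have hlen : q.length ≤ q'.length := by
    rcases hq with ⟨_, rfl, _, _⟩ | ⟨_, rfl, _, _⟩ <;> simp
  have hqi : q'[i]? = some u := by
    rcases hq with ⟨_, rfl, _, _⟩ | ⟨_, rfl, _, _⟩
    · exact hu
    · rw [List.getElem?_append_left hi]; exact hu
  have hsrc : ∀ x ∈ em ++ [e], A (x * 3 + 2) ∈ q ∧ s.arr 5 (A (x * 3 + 2)) ≤ i := by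
    intro x hx
    rcases List.mem_append.1 hx with hx | hx
    · exact ⟨h.src_mem x hx, h.src_le x hx⟩
    · rw [List.mem_singleton.1 hx, hsu]; exact ⟨huq, hpu.le⟩
  have hind : ∀ x, s'.arr 3 x =
      ((Finset.range m).filter fun e' => A (e' * 3 + 3) = x ∧ e' ∉ em ++ [e]).card := by
    intro x
    rw [indeg_append hem hnem, ← h.indeg, h3, Function.update_apply]
    split_ifs with hx
    · rw [hx]
    · simp
  refine ⟨h30, h31, by simpa using h34, hrep, fun x hx => ?_, by omega, hind, fun x hx => ?_,
    fun x hx => ?_, ?_, fun x hx => (hsub _ (hsrc x hx).1).1, fun x hx => ?_, fun j x hj => ?_, ?_,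
    fun x hx hxq => ?_, fun x hx hxq hlt => ?_, fun u' hu' => ?_⟩
  · rcases (hmem x).1 hx with h' | ⟨rfl, _⟩
    · exact h.q_lt x h'
    · exact hvn
  · rw [hmem, h.q_iff x hx, h3, Function.update_apply]
    split_ifs with hxv
    · rw [hxv]; omega
    · simp [hxv]
  · rcases List.mem_append.1 hx with hx | hx
    · exact h.em_lt x hx
    · rwa [List.mem_singleton.1 hx]
  · exact List.nodup_append.2 ⟨h.em_nodup, by simp, fun a ha b hb => by
      rw [List.mem_singleton.1 hb]; rintro rfl; exact hnem ha⟩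
  · rw [(hsub _ (hsrc x hx).1).2]; exact (hsrc x hx).2
  · rw [(hsub _ (hsrc x (List.mem_of_getElem? hj)).1).2, h6, h7, h8]
    rcases lt_or_ge j em.length with hj' | hj'
    · rw [List.getElem?_append_left hj'] at hj
      simp only [Function.update_of_ne hj'.ne]
      exact h.out j x hj
    · rw [List.getElem?_append_right hj', List.getElem?_singleton] at hj
      split_ifs at hj with hj0
      simp only [Option.some.injEq] at hj
      subst hj
      have : j = em.length := by omega
      subst this
      simp [hsu, hpu, hv]
  · intro j j' hjj hj'
    rw [List.length_append, List.length_singleton] at hj'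
    rw [h6]
    rcases (Nat.lt_succ_iff.1 hj').lt_or_eq with h' | h'
    · rw [Function.update_of_ne h'.ne, Function.update_of_ne (by omega)]
      exact h.sorted j j' hjj h'
    · rw [h', Function.update_self, Function.update_apply]
      split_ifs with hj0
      · exact le_rfl
      · have hlt : j < em.length := by omega
        have hje := List.getElem?_eq_getElem hlt
        rw [(h.out j _ hje).1]
        exact h.src_le _ (List.mem_of_getElem? hje)
  · rcases (hmem _).1 hxq with h' | ⟨h', h''⟩
    · obtain ⟨h4, h5⟩ := h.topo x hx h'
      exact ⟨(hsub _ h4).1, by rw [(hsub _ h4).2, (hsub _ h').2]; exact h5⟩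
    -- The counter of `v` has just dropped to 0, so every edge into `v` was output, and its source
    -- is at a position at most `i`, before the end of the queue where `v` is put.
    · have hxem : x ∈ em ++ [e] := by
        by_contra hx'
        have h0 := hind v
        rw [h3, Function.update_self, h'', Nat.sub_self, eq_comm, Finset.card_eq_zero] at h0
        have : x ∈ (∅ : Finset ℕ) := h0 ▸ Finset.mem_filter.2 ⟨Finset.mem_range.2 hx, h', hx'⟩
        simp at this
      have hs := hsrc x hxem
      refine ⟨(hsub _ hs.1).1, ?_⟩
      rw [(hsub _ hs.1).2, h']
      rcases hq with ⟨h1', _⟩ | ⟨_, _, _, h5⟩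
      · exact absurd h'' h1'
      · rw [h5, Function.update_self]; omega
  · rcases (hmem _).1 hxq with h' | ⟨h', h''⟩
    · rw [(hsub _ h').2] at hlt
      exact List.mem_append_left _ (h.fin x hx h' hlt)
    · rcases hq with ⟨h1', _⟩ | ⟨_, _, _, h5⟩
      · exact absurd h'' h1'
      · rw [h', h5, Function.update_self] at hlt; omega
  · rw [hqi] at hu'
    obtain rfl := Option.some.inj hu'
    refine ⟨fun x hx hxs => ?_, fun x hx => ?_, (List.nodup_cons.1 hc3).2, ?_⟩
    · rcases hc1 x hx hxs with h' | h'
      · exact Or.inl (List.mem_append_left _ h')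
      · rcases List.mem_cons.1 h' with rfl | h'
        · exact Or.inl (by simp)
        · exact Or.inr h'
    · obtain ⟨a1, a2, a3⟩ := hc2 x (by simp [hx])
      refine ⟨a1, a2, fun hx' => ?_⟩
      rcases List.mem_append.1 hx' with h' | h'
      · exact a3 h'
      · rw [List.mem_singleton.1 h'] at hx
        exact (List.nodup_cons.1 hc3).1 hx
    · rw [h1, h33]; exact hc4.2

/-- The arrays `a`, `b`, `w` hold the edges of the graph in `A`, sorted by the positions `p` of their
sources; `f` is the function that is applied to the targets. -/
structure SortedGraph (n m : ℕ) (A p a b w : ℕ → ℕ) (f : ℕ → ℕ) : Prop where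
  pos_lt : ∀ v < n, p v < n
  pos_inj : ∀ u < n, ∀ v < n, p u = p v → u = v
  topo : ∀ e < m, p (A (e * 3 + 2)) < p (A (e * 3 + 3))
  of_out : ∀ j < m, ∃ e < m, a j = p (A (e * 3 + 2)) ∧ b j = f (A (e * 3 + 3)) ∧ w j = A (e * 3 + 4)
  out_of : ∀ e < m, ∃ j < m, a j = p (A (e * 3 + 2)) ∧ b j = f (A (e * 3 + 3)) ∧ w j = A (e * 3 + 4)
  mono : ∀ j j', j ≤ j' → j' < m → a j ≤ a j'

/-- The place where acyclicity makes the sorting succeed. When the queue is used up, all edges of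
queued vertices were output; by well-founded induction all in-edges of any vertex were output, so
its counter is 0 and it was queued. -/
theorem SortInv.sortedGraph {n m W : ℕ} {A : ℕ → ℕ} {q em rem : List ℕ} {s : State}
    (h : SortInv n m A q em rem q.length s) (hA : Input n m W A)
    (hwf : WellFounded fun u v => ∃ e < m, A (e * 3 + 2) = u ∧ A (e * 3 + 3) = v) :
    SortedGraph n m A (s.arr 5) (s.arr 6) (s.arr 7) (s.arr 8) id := by
  have hfin : ∀ e < m, A (e * 3 + 2) ∈ q → e ∈ em := fun e he hq =>
    h.fin e he hq (h.rep.pos_lt hq).1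
  have hall : ∀ v < n, v ∈ q := by
    intro v
    induction v using hwf.induction with
    | _ v ih =>
      intro hv
      rw [h.q_iff v hv, h.indeg, Finset.card_eq_zero, Finset.filter_eq_empty_iff]
      rintro e he ⟨h1, h2⟩
      have he := Finset.mem_range.1 he
      exact h2 (hfin e he (ih _ ⟨e, he, rfl, h1⟩ (hA.src_lt e he)))
  have hem : ∀ e < m, e ∈ em := fun e he => hfin e he (hall _ (hA.src_lt e he))
  have hperm : em.Perm (List.range m) :=
    (List.perm_ext_iff_of_nodup h.em_nodup List.nodup_range).2 fun e =>
      ⟨fun he => List.mem_range.2 (h.em_lt e he), fun he => hem e (List.mem_range.1 he)⟩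
  have hlen : em.length = m := by simpa using hperm.length_eq
  refine ⟨fun v hv => ?_, fun u hu v hv => h.rep.pos_inj (hall u hu) (hall v hv), fun e he => ?_,
    fun j hj => ?_, fun e he => ?_, fun j j' hjj hj' => h.sorted j j' hjj (by omega)⟩
  · exact (h.rep.pos_lt (hall v hv)).1.trans_le (h.rep.length_le h.q_lt)
  · exact (h.topo e he (hall _ (hA.dst_lt e he))).2
  · have hj' : j < em.length := by omega
    exact ⟨em[j], h.em_lt _ (List.getElem_mem _), h.out j _ (List.getElem?_eq_getElem hj')⟩
  · obtain ⟨j, hj, hje⟩ := List.getElem_of_mem (hem e he)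
    exact ⟨j, by omega, h.out j e (by rw [List.getElem?_eq_getElem hj, hje])⟩

theorem sortEdges_runs {B n m W : ℕ} {A : ℕ → ℕ} {s : State} (hA : Input n m W A)
    (hwf : WellFounded fun u v => ∃ e < m, A (e * 3 + 2) = u ∧ A (e * 3 + 3) = v)
    (h10 : s.reg 10 = n) (hB : n + 3 * m + W + 10 ≤ B) (h0 : s.arr 0 = A)
    (hdeg : ∀ v, s.arr 3 v = ((Finset.range m).filter fun e => A (e * 3 + 3) = v).card)
    (hch : ∀ v, Chain (s.arr 1) (s.arr 2 v) (outEdges A v m)) :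
    Runs B sortEdges s ((n + m) * 40 + n * 20 + 50) fun s' =>
      SortedGraph n m A (s'.arr 5) (s'.arr 6) (s'.arr 7) (s'.arr 8) id := by
  apply Runs.of_wp
  simp only [sortEdges, Prog.block, wp_seq]
  refine (queueInit_runs h10 (by omega)).wp fun s₁ t₁ hs₁ ⟨q, h31, hq, hmem⟩ ht₁ => ?_
  have h0₁ := (hs₁.arr 0 (by decide)).trans h0
  have h1₁ := hs₁.arr 1 (by decide)
  have h2₁ := hs₁.arr 2 (by decide)
  have h3₁ := hs₁.arr 3 (by decide)
  simp only [wp_seq, wp_const, wp_load]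
  refine ⟨by omega, by omega, ?_⟩
  -- Each round either outputs an edge or advances in the queue, so `em.length + i ≤ m + n` counts
  -- the rounds.
  refine Runs.wp (T := (n + m) * (39 + 1) + 1) (Runs.loop (N := n + m) (I := fun k s' =>
    ∃ q em rem i, SortInv n m A q em rem i s' ∧ k = em.length + i) ?_ ?_) ?_
  · refine ⟨q, [], outEdges A (s₁.arr 4 0) m, 0, ⟨by simp, by simpa using h31, by simp, hq,
      fun v hv => ((hmem v).1 hv).1, by omega, by simpa [h3₁] using hdeg, fun v hv => ?_, by simp,
      by simp, by simp, by simp, by simp, by simp, fun e he hv => ?_, by simp, fun u hu => ?_⟩, by simp⟩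
    · simp [hmem, hv, h3₁]
    · have := ((hmem _).1 hv).2
      rw [hdeg, Finset.card_eq_zero, Finset.filter_eq_empty_iff] at this
      exact absurd rfl (this (Finset.mem_range.2 he))
    · have hu4 := (hq _ _ hu).1
      rw [hu4]
      refine ⟨fun e he hs => Or.inr (mem_outEdges.2 ⟨he, hs⟩), fun e he => ?_, ?_, ?_⟩
      · obtain ⟨h1, h2⟩ := mem_outEdges.1 he
        exact ⟨h1, h2, by simp⟩
      · exact List.nodup_reverse.2 (List.nodup_range.filter _)
      · simpa [hu4, h1₁, h2₁] using hch u
  · rintro k s₂ hs₂ ⟨q, em, rem, i, hI, rfl⟩ hlt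
    have h0₂ : s₂.arr 0 = A := (hs₂.arr 0 (by decide)).trans h0₁
    have h1₂ : s₂.arr 1 = s.arr 1 := (hs₂.arr 1 (by decide)).trans h1₁
    have h2₂ : s₂.arr 2 = s.arr 2 := (hs₂.arr 2 (by decide)).trans h2₁
    rw [hI.r30, hI.r31] at hlt
    have hqn := hI.rep.length_le hI.q_lt
    have hem : em.length ≤ m := by
      simpa using (hI.em_nodup.subperm (l₂ := List.range m) fun e he =>
        List.mem_range.2 (hI.em_lt e he)).length_le
    refine ⟨by omega, ?_⟩
    simp only [sortBody, Prog.block, wp_seq, wp_const, wp_cond]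
    refine ⟨by omega, fun h33 => ?_, fun h33 => ?_⟩
    · simp at h33
      simp only [sortNext, Prog.block, wp_seq, wp_op, wp_load, BinOp.eval]
      have hch₂ : ∀ v, Chain (s₂.arr 1) (s₂.arr 2 v) (outEdges A v m) := by
        rw [h1₂, h2₂]; exact hch
      have := hI.next hlt (by omega) hch₂ (s₂.arr 4 (i + 1)) 1
      simp only [State.setReg_reg, State.setReg_arr, hI.r30, if_true, show ¬ 30 = 9 by decide, if_false]
      exact ⟨by omega, by omega, q, em, _, i + 1, this, by omega⟩
    · simp at h33
      obtain ⟨u, hu⟩ : ∃ u, q[i]? = some u := ⟨_, List.getElem?_eq_getElem hlt⟩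
      obtain ⟨-, hc2, -, hc4⟩ := hI.cur u hu
      cases rem with
      | nil => exact absurd hc4 h33
      | cons e rem =>
        have h33e : s₂.reg 33 = e + 1 := hc4.1
        have hem' := (hc2 e (by simp)).1
        have hd := hA.dst_lt e hem'
        have hdle : s₂.arr 3 (A (e * 3 + 3)) ≤ m := by
          rw [hI.indeg]; simpa using Finset.card_filter_le (Finset.range m) _
        have hpos : 0 < s₂.arr 3 (A (e * 3 + 3)) := by
          rw [hI.indeg, Finset.card_pos]
          exact ⟨e, by simp [hem', (hc2 e (by simp)).2.2]⟩
        simp only [sortEdge, Prog.block, wp_seq, wp_op, wp_load, wp_store, wp_const, wp_cond, wp_skip,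
          BinOp.eval]
        simp [h33e, h0₂, hI.r30, hI.r31, hI.r34, show e * 3 + 3 + 1 = e * 3 + 4 from rfl]
        refine ⟨by omega, by omega, by omega, by omega, by omega, by omega, by omega, fun hz => ⟨by omega,
          q ++ [A (e * 3 + 3)], em ++ [e], rem, i, ?_, ?_⟩, fun hz => ⟨q, em ++ [e], rem, i, ?_, ?_⟩⟩
        · refine hI.edge hA hlt ?_ ?_ ?_ ?_ ?_ ?_ ?_ ?_ ?_ (Or.inr ⟨by omega, rfl, ?_, ?_⟩) <;>
            simp [hI.r30]
        · simp; omega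
        · refine hI.edge hA hlt ?_ ?_ ?_ ?_ ?_ ?_ ?_ ?_ ?_ (Or.inl ⟨by omega, rfl, ?_, ?_⟩) <;>
            simp [hI.r30, hI.r31]
        · simp; omega
  · rintro s₂ t₂ hs₂ ⟨k, hk, ⟨q, em, rem, i, hI, rfl⟩, hge⟩ ht₂
    rw [hI.r30, hI.r31] at hge
    have hi := hI.i_le
    obtain rfl : i = q.length := by omega
    exact ⟨by omega, hI.sortedGraph hA hwf⟩

def placeBody : Prog := .block [.load 21 7 20, .load 21 5 21, .store 7 20 21, .inc 20]

/-- Replace the targets of the edges by their positions. -/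
def placeTargets : Prog := .block [.const 20 0, .loop 20 11 placeBody]

theorem placeTargets_runs {B n m : ℕ} {A : ℕ → ℕ} {s : State} (h11 : s.reg 11 = m) (hB : m + 10 ≤ B)
    (hG : SortedGraph n m A (s.arr 5) (s.arr 6) (s.arr 7) (s.arr 8) id) :
    Runs B placeTargets s (m * 10 + 10) fun s' =>
      SortedGraph n m A (s.arr 5) (s.arr 6) (s'.arr 7) (s.arr 8) (s.arr 5) := by
  apply Runs.of_wp
  simp only [placeTargets, Prog.block, wp_seq, wp_const]
  refine ⟨by omega, ?_⟩
  refine Runs.wp (T := m * (9 + 1) + 1) (Runs.for (N := m) (I := fun i s' => s'.reg 20 = i ∧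
    (∀ j < i, s'.arr 7 j = s.arr 5 (s.arr 7 j)) ∧ ∀ j, i ≤ j → s'.arr 7 j = s.arr 7 j) ?_ ?_ ?_) ?_
  · simp
  · intro i s' hs hI
    have h11' := hs.reg 11 (by decide)
    simp [h11] at h11'
    rw [hI.1, h11']
  · rintro i s' hs hi ⟨h20, h7, h7'⟩
    have h5 : s'.arr 5 = s.arr 5 := hs.arr 5 (by decide)
    simp [placeBody, Prog.block, Prog.inc, wp, BinOp.eval, h20, h5]
    refine ⟨by omega, by omega, forall_le_update h7 (by rw [h7' i le_rfl]), fun j hj => ?_⟩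
    rw [Function.update_of_ne (by omega)]
    exact h7' j (by omega)
  · rintro s' t' hs ⟨_, h7, _⟩ ht
    refine ⟨by omega, hG.pos_lt, hG.pos_inj, hG.topo, fun j hj => ?_, fun e he => ?_, hG.mono⟩
    · obtain ⟨e, he, h1, h2, h3⟩ := hG.of_out j hj
      exact ⟨e, he, h1, by rw [h7 j hj, h2]; rfl, h3⟩
    · obtain ⟨j, hj, h1, h2, h3⟩ := hG.out_of e he
      exact ⟨j, hj, h1, by rw [h7 j hj, h2]; rfl, h3⟩

/-! ## The algorithm -/

def sqrtBody : Prog := .seq (.inc 14) (.op .mul 16 14 14)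

/-- The square root of register `10`, rounded up, in register `14`. -/
def sqrtCeil : Prog := .block [.const 14 0, .const 16 0, .loop 16 10 sqrtBody]

/-- The loop stops at the first square that is at least `n`. The square before is less than `n`, and
`(i + 1)² ≤ 2 (i² + 1) ≤ 2n`. -/
theorem sqrtCeil_runs {B n : ℕ} {s : State} (hn : 1 ≤ n) (h10 : s.reg 10 = n) (hB : n * n + 10 ≤ B) :
    Runs B sqrtCeil s (n * 10 + 10) fun s' => 1 ≤ s'.reg 14 ∧ s'.reg 14 ≤ n ∧
      n ≤ s'.reg 14 * s'.reg 14 ∧ s'.reg 14 * s'.reg 14 ≤ 2 * n := by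
  apply Runs.of_wp
  simp only [sqrtCeil, Prog.block, wp_seq, wp_const]
  refine ⟨by omega, by omega, ?_⟩
  refine Runs.wp (T := n * (9 + 1) + 1) (Runs.loop (N := n) (I := fun i s' => s'.reg 14 = i ∧
    s'.reg 16 = i * i ∧ i * i ≤ 2 * n) ?_ ?_) ?_
  · simp
  · rintro i s' hs ⟨h14, h16, hi⟩ hlt
    have h10' := hs.reg 10 (by decide)
    simp [h10] at h10'
    rw [h16, h10'] at hlt
    have hin : i < n := (Nat.le_mul_self i).trans_lt hlt
    have h1 : (i + 1) * (i + 1) ≤ n * n := Nat.mul_le_mul hin hin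
    have h2 := Nat.le_mul_self n
    refine ⟨hin, ?_⟩
    simp [sqrtBody, Prog.inc, wp, BinOp.eval, h14]
    refine ⟨by omega, by omega, by omega, ?_⟩
    rcases Nat.lt_or_ge i 2 with h3 | h3
    · interval_cases i <;> omega
    · nlinarith [sq_nonneg ((i : ℤ) - 2)]
  · rintro s' t' hs ⟨i, hi, ⟨h14, h16, hi'⟩, hge⟩ ht
    have h10' := hs.reg 10 (by decide)
    simp [h10] at h10'
    rw [h16, h10'] at hge
    refine ⟨by omega, ?_, by omega, by rw [h14]; omega, by rw [h14]; exact hi'⟩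
    rw [h14]
    by_contra h
    obtain rfl : i = 0 := by omega
    omega

/-- The search for an approximate centre, after the edges were sorted. -/
def radiusSearch : Prog := .seq (.block [.op .mul 13 10 12, .op .add 13 13 13, .inc 13, sqrtCeil])
  (.block [tableInit, tableRelax, blockEcc, search,
    .cond 15 13 (.block [.const 0 1, .mov 1 15]) (.const 0 0)])

def radiusMain : Prog := .block [readEdges, sortEdges, placeTargets, radiusSearch]

/-- The approximation algorithm. -/
def radiusProg : Prog := .block [.const 20 0, .load 10 0 20, .const 20 1, .load 11 0 20,
  .op .add 21 11 11, .op .add 21 21 20, .cond 21 10 (.const 0 0) radiusMain]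

/-- At most `k` blocks with `r + 1` linear-time computations each; the table costs `(n + m) k`, and
the quadratic selection is linear in `n` by `k * k ≤ 2 * n`. -/
theorem search_time {n m k r : ℕ} (hk : 1 ≤ k) (hkk : k * k ≤ 2 * n) :
    n * k * 50 + m * k * 30 + k * ((r + 1) * (n * 30 + m * 40 + k * (k * 20 + 40) + 100) + 2) +
      n * 10 + 100 ≤ k * (r + 1) * ((n + m + 1) * 600) := by
  have h0 : k * (k * 20 + 40) ≤ 120 * n := by
    have : k ≤ k * k := Nat.le_mul_self k
    rw [mul_add, ← mul_assoc]
    omega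
  have h1 : k ≤ k * (r + 1) := Nat.le_mul_of_pos_right _ (by omega)
  have h2 : k * ((r + 1) * (n * 30 + m * 40 + k * (k * 20 + 40) + 100)) ≤
      k * (r + 1) * ((n + m + 1) * 150) := by
    rw [← mul_assoc]
    exact Nat.mul_le_mul_left _ (by omega)
  have h3 : k * (n + m + 1) ≤ k * (r + 1) * (n + m + 1) := Nat.mul_le_mul_right _ h1
  have h4 : 1 * (n + m + 1) ≤ k * (n + m + 1) := Nat.mul_le_mul_right _ hk
  have h5 : k * (n + m + 1) = n * k + m * k + k := by ring
  have h6 : k * (r + 1) * ((n + m + 1) * 150) = k * (r + 1) * (n + m + 1) * 150 := by ring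
  have h7 : k * (r + 1) * ((n + m + 1) * 600) = k * (r + 1) * (n + m + 1) * 600 := by ring
  rw [mul_add k]
  omega

theorem radiusSearch_runs {B n m W : ℕ} {s : State} (hn : 1 ≤ n)
    (h10 : s.reg 10 = n) (h11 : s.reg 11 = m) (h12 : s.reg 12 = W)
    (hB : 2 * (n * W + 1) + W + 2 * (n * n) + m * n + 5 * n + m + 20 ≤ B)
    (h11z : ∀ x < n, s.arr 11 x = 0)
    (lt : ∀ j < m, s.arr 6 j < s.arr 7 j) (lt_n : ∀ j < m, s.arr 7 j < n)
    (mono : ∀ i j, i ≤ j → j < m → s.arr 6 i ≤ s.arr 6 j) (w_le : ∀ j < m, s.arr 8 j ≤ W) :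
    ∃ k, 1 ≤ k ∧ k ≤ n ∧ k * k ≤ 2 * n ∧
    Runs B radiusSearch s (k * (rounds k + 1) * ((n + m + 1) * 600)) fun s' =>
      ∃ b, Genuine n (2 * (n * W) + 1) (edgeList m (s.arr 6) (s.arr 7) (s.arr 8)) b ∧
      (∀ c < n, Covered n (2 * (n * W) + 1) (edgeList m (s.arr 6) (s.arr 7) (s.arr 8)) b c) ∧
      (b < 2 * (n * W) + 1 → s'.reg 0 = 1 ∧ s'.reg 1 = b) ∧
      (2 * (n * W) + 1 ≤ b → s'.reg 0 = 0) := by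
  -- Finite distances are at most `n * W`, so a bound that is at most twice a finite eccentricity
  -- stays strictly below `T`, and the value `T` can safely mean `∞`.
  set T := 2 * (n * W) + 1 with hT
  have init : wp B (.block [.op .mul 13 10 12, .op .add 13 13 13, .inc 13, sqrtCeil])
      (fun s' t => 1 ≤ s'.reg 14 ∧ s'.reg 14 ≤ n ∧
      n ≤ s'.reg 14 * s'.reg 14 ∧ s'.reg 14 * s'.reg 14 ≤ 2 * n ∧ s'.reg 13 = T ∧ t ≤ n * 10 + 20 ∧
      Same (.block [.op .mul 13 10 12, .op .add 13 13 13, .inc 13, sqrtCeil]) s s') s 0 := by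
    simp only [Prog.block, Prog.inc, wp_seq, wp_op, wp_const, BinOp.eval]
    simp only [State.setReg_reg, h10, h12, if_true]
    refine ⟨by omega, by omega, by omega, by simp; omega, ?_⟩
    refine (sqrtCeil_runs hn (by simpa) (by omega)).wp fun s' t hs ⟨h1, h2, h3, h4⟩ ht => ?_
    refine ⟨h1, h2, h3, h4, ?_, by omega, ?_⟩
    · rw [hs.reg 13 (by decide)]; simp; omega
    · refine ⟨fun x hx => ?_, fun a ha => ?_⟩
      · have hx' : x ∉ [13, 13, 9, 13, 14, 16, 9, 14, 16] := hx
        rw [hs.reg x (fun h => hx' (by have : x ∈ [14, 16, 9, 14, 16] := h; simp at this ⊢; omega))]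
        simp only [List.mem_cons, not_or] at hx'
        simp [hx']
      · rw [hs.arr a (fun h => by have : a ∈ ([] : List ℕ) := h; simp at this)]
        rfl
  obtain ⟨t₁, s₁, he₁, hk1, hkn, hkk, hkk', h13₁, ht₁, hs₁⟩ := wp_sound init
  set k := s₁.reg 14 with hkdef
  have hnk : n * k ≤ n * n := Nat.mul_le_mul_left _ hkn
  have hmk : m * k ≤ m * n := Nat.mul_le_mul_left _ hkn
  have hS : Sorted B n m k T W (s.arr 6) (s.arr 7) (s.arr 8) :=
    ⟨lt, lt_n, mono, w_le, hk1, by omega⟩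
  have hc₁ : Ctx n m k T (s.arr 6) (s.arr 7) (s.arr 8) s₁ :=
    ⟨(hs₁.reg 10 (by decide)).trans h10, (hs₁.reg 11 (by decide)).trans h11, h13₁, rfl,
      hs₁.arr 6 (by decide), hs₁.arr 7 (by decide), hs₁.arr 8 (by decide)⟩
  refine ⟨k, hk1, hkn, hkk', ?_⟩
  have rest : wp B (.block [tableInit, tableRelax, blockEcc, search,
      .cond 15 13 (.block [.const 0 1, .mov 1 15]) (.const 0 0)])
      (fun s' t => t ≤ (k * (rounds k + 1) * ((n + m + 1) * 600)) ∧
      ∃ b, Genuine n T (edgeList m (s.arr 6) (s.arr 7) (s.arr 8)) b ∧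
      (∀ c < n, Covered n T (edgeList m (s.arr 6) (s.arr 7) (s.arr 8)) b c) ∧
      (b < T → s'.reg 0 = 1 ∧ s'.reg 1 = b) ∧ (T ≤ b → s'.reg 0 = 0)) s₁ (0 + t₁) := by
    simp only [Prog.block, wp_seq]
    refine (tableInit_runs hS hc₁).wp fun s₂ t₂ hs₂ hQ₂ ht₂ => ?_
    have hc₂ := hc₁.same hs₂ (by decide) (by decide)
    refine (tableRelax_runs hS hc₂ hQ₂).wp fun s₃ t₃ hs₃ hQ₃ ht₃ => ?_
    have hc₃ := hc₂.same hs₃ (by decide) (by decide)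
    have h11₃ : s₃.arr 11 = s.arr 11 :=
      ((hs₃.arr 11 (by decide)).trans (hs₂.arr 11 (by decide))).trans (hs₁.arr 11 (by decide))
    refine (blockEcc_runs hS hc₃ (fun x hx v hv hxv => tdist_of_table hS hQ₃.1 hQ₃.2 hx hv hxv)
      (by rwa [h11₃])).wp fun s₄ t₄ hs₄ hQ₄ ht₄ => ?_
    have hc₄ := hc₃.same hs₄ (by decide) (by decide)
    refine (search_runs hS hc₄ hQ₄ hkk (by omega)).wp fun s₅ t₅ hs₅ ⟨hg, hcov⟩ ht₅ => ?_
    have hc₅ := hc₄.same hs₅ (by decide) (by decide)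
    have htime : t₅ + 10 ≤ k * (rounds k + 1) * ((n + m + 1) * 600) := by
      have := search_time (r := rounds k) (m := m) hk1 hkk'
      omega
    have hbT := hg.le
    simp only [wp_cond, wp_seq, wp_const, wp_mov, hc₅.r13]
    refine ⟨fun h => ⟨by omega, by simp; omega, by omega, s₅.reg 15, hg, hcov, fun _ => by simp,
      fun h' => by omega⟩, fun h => ⟨by omega, by omega, s₅.reg 15, hg, hcov, fun h' => by omega,
      fun _ => by simp⟩⟩
  obtain ⟨t₂, s₂, he₂, ht₂, hQ⟩ := wp_sound rest
  exact ⟨_, _, .seq he₁ he₂, by omega, hQ⟩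

/-! ## Distances and eccentricities -/

namespace WDigraph

variable {G : WDigraph}

theorem dist_le_iff {u v : Fin G.n} {d : ℕ} : G.dist u v ≤ d ↔ ∃ ℓ ≤ d, G.Walk u v ℓ := by
  constructor
  · intro h
    by_contra! hcon
    have h1 : ((d + 1 : ℕ) : ℕ∞) ≤ G.dist u v := by
      refine le_iInf₂ fun ℓ hℓ => ?_
      have : d < ℓ := by
        by_contra hlt
        exact hcon ℓ (by omega) hℓ
      exact_mod_cast this
    have h2 : d + 1 ≤ d := by exact_mod_cast h1.trans h
    omega
  · rintro ⟨ℓ, hℓ, hw⟩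
    exact (iInf₂_le ℓ hw).trans (by exact_mod_cast hℓ)

theorem minEcc_le_iff {c : Fin G.n} {d : ℕ} :
    G.minEcc c ≤ d ↔ ∀ v, ∃ ℓ ≤ d, G.Walk c v ℓ ∨ G.Walk v c ℓ := by
  rw [minEcc, iSup_le_iff]
  refine forall_congr' fun v => ?_
  rw [min_le_iff, dist_le_iff, dist_le_iff]
  constructor
  · rintro (⟨ℓ, h, h'⟩ | ⟨ℓ, h, h'⟩)
    exacts [⟨ℓ, h, .inl h'⟩, ⟨ℓ, h, .inr h'⟩]
  · rintro ⟨ℓ, h, h' | h'⟩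
    exacts [.inl ⟨ℓ, h, h'⟩, .inr ⟨ℓ, h, h'⟩]

theorem exists_minEcc_eq_minRadius (hn : 1 ≤ G.n) : ∃ c, G.minEcc c = G.minRadius := by
  have : Nonempty (Fin G.n) := ⟨⟨0, hn⟩⟩
  exact exists_eq_ciInf_of_finite

theorem IsDAG.wf (h : G.IsDAG) : WellFounded G.Adj := by
  have : IsTrans (Fin G.n) (Relation.TransGen G.Adj) := ⟨fun _ _ _ => .trans⟩
  have : Std.Irrefl (Relation.TransGen G.Adj) := ⟨h⟩
  exact Subrelation.wf Relation.TransGen.single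
    (Finite.wellFounded_of_trans_of_irrefl (Relation.TransGen G.Adj))

/-- The edges have at most `2m` ends. -/
theorem exists_isolated (h : 2 * G.m < G.n) :
    ∃ v : Fin G.n, ∀ e ∈ G.edges, e.1 ≠ v ∧ e.2.1 ≠ v := by
  by_contra! hcon
  have h1 : (Finset.univ : Finset (Fin G.n)) ⊆
      (G.edges.map fun e => e.1).toFinset ∪ (G.edges.map fun e => e.2.1).toFinset := by
    intro v _
    obtain ⟨e, he, hv⟩ := hcon v
    simp only [Finset.mem_union, List.mem_toFinset, List.mem_map]
    by_cases h1 : e.1 = v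
    · exact .inl ⟨e, he, h1⟩
    · exact .inr ⟨e, he, hv h1⟩
  have h2 := (Finset.card_le_card h1).trans (Finset.card_union_le _ _)
  have h3 := List.toFinset_card_le (G.edges.map fun e => e.1)
  have h4 := List.toFinset_card_le (G.edges.map fun e => e.2.1)
  rw [List.length_map] at h3 h4
  rw [Finset.card_univ, Fintype.card_fin] at h2
  unfold m at h
  omega

theorem Walk.eq_of_isolated {v : Fin G.n} (hv : ∀ e ∈ G.edges, e.1 ≠ v ∧ e.2.1 ≠ v)
    {x y : Fin G.n} {ℓ : ℕ} (h : G.Walk x y ℓ) (hxy : x = v ∨ y = v) : x = y := by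
  induction h with
  | nil => rfl
  | cons h _ ih =>
    rcases hxy with rfl | rfl
    · exact absurd rfl (hv _ h).1
    · exact absurd (ih (.inr rfl)) (hv _ h).2

/-- With at least two vertices, any centre is disconnected from some vertex: from the isolated one,
or, if it is isolated itself, from any other. -/
theorem minRadius_eq_top (h : 2 * G.m + 1 < G.n) : G.minRadius = ⊤ := by
  obtain ⟨v, hv⟩ := exists_isolated (G := G) (by omega)
  have : Nontrivial (Fin G.n) := Fin.nontrivial_iff_two_le.2 (by omega)
  rw [minRadius, iInf_eq_top]
  intro c
  by_contra hc
  obtain ⟨d, hd⟩ := ENat.ne_top_iff_exists.1 hc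
  have h1 := minEcc_le_iff.1 hd.ge
  obtain ⟨x, hx, hcx⟩ : ∃ x, x ≠ c ∧ (c = v ∨ x = v) := by
    by_cases hcv : c = v
    · obtain ⟨x, hx⟩ := exists_ne c
      exact ⟨x, hx, .inl hcv⟩
    · exact ⟨v, fun h => hcv h.symm, .inr rfl⟩
  obtain ⟨ℓ, -, hw | hw⟩ := h1 x
  · exact hx (hw.eq_of_isolated hv hcx).symm
  · exact hx (hw.eq_of_isolated hv hcx.symm)

/-! ## The encoding of a graph -/

theorem _root_.MinRad.getD_le_foldr_max (l : List ℕ) (i : ℕ) : l.getD i 0 ≤ l.foldr max 0 := by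
  induction l generalizing i with
  | nil => simp
  | cons a l ih =>
    cases i with
    | zero => simp
    | succ i => simpa using .inr (ih i)

theorem _root_.MinRad.foldr_max_le {l : List ℕ} {M : ℕ} (h : ∀ x ∈ l, x ≤ M) : l.foldr max 0 ≤ M := by
  induction l with
  | nil => simp
  | cons a l ih =>
    simp only [List.forall_mem_cons] at h
    exact max_le h.1 (ih h.2)

theorem flatMap_getD {n : ℕ} (l : List (Fin n × Fin n × ℕ)) {e : ℕ} (he : e < l.length) :
    (l.flatMap fun e => [e.1.val, e.2.1.val, e.2.2]).getD (e * 3) 0 = l[e].1 ∧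
    (l.flatMap fun e => [e.1.val, e.2.1.val, e.2.2]).getD (e * 3 + 1) 0 = l[e].2.1 ∧
    (l.flatMap fun e => [e.1.val, e.2.1.val, e.2.2]).getD (e * 3 + 2) 0 = l[e].2.2 := by
  induction l generalizing e with
  | nil => simp at he
  | cons a l ih =>
    cases e with
    | zero => simp
    | succ e =>
      have := ih (e := e) (by simpa using he)
      simpa [add_mul, add_right_comm _ 3] using this

/-- The contents of array `0`. -/
def mem (G : WDigraph) (i : ℕ) : ℕ := G.encode.getD i 0

theorem initState_arr_zero : (initState G.encode).arr 0 = G.mem := by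
  funext i
  simp [initState, mem]

theorem mem_src {e : ℕ} (he : e < G.m) : G.mem (e * 3 + 2) = (G.edges[e]'he).1 := by
  simpa [mem, encode] using (flatMap_getD G.edges he).1

theorem mem_dst {e : ℕ} (he : e < G.m) : G.mem (e * 3 + 3) = (G.edges[e]'he).2.1 := by
  simpa [mem, encode] using (flatMap_getD G.edges he).2.1

theorem mem_wt {e : ℕ} (he : e < G.m) : G.mem (e * 3 + 4) = (G.edges[e]'he).2.2 := by
  simpa [mem, encode] using (flatMap_getD G.edges he).2.2

theorem length_encode : G.encode.length = 3 * G.m + 2 := by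
  simp [encode, List.length_flatMap, m, mul_comm]

theorem mem_add_le (i : ℕ) : G.mem i + 3 * G.m + 2 ≤ inputSize G.encode := by
  have := getD_le_foldr_max G.encode i
  rw [inputSize, length_encode, mem]
  omega

theorem exists_edge {u v : Fin G.n} {w : ℕ} (h : (u, v, w) ∈ G.edges) :
    ∃ e < G.m, G.mem (e * 3 + 2) = u ∧ G.mem (e * 3 + 3) = v ∧ G.mem (e * 3 + 4) = w := by
  obtain ⟨e, he, h⟩ := List.getElem_of_mem h
  refine ⟨e, he, ?_⟩
  rw [mem_src he, mem_dst he, mem_wt he, h]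
  exact ⟨rfl, rfl, rfl⟩

theorem exists_mem_edges {e : ℕ} (he : e < G.m) : ∃ u v : Fin G.n, ∃ w,
    (u, v, w) ∈ G.edges ∧ G.mem (e * 3 + 2) = u ∧ G.mem (e * 3 + 3) = v ∧ G.mem (e * 3 + 4) = w :=
  ⟨_, _, _, List.getElem_mem he, mem_src he, mem_dst he, mem_wt he⟩

theorem input : Input G.n G.m (inputSize G.encode) G.mem := by
  refine ⟨fun e he => ?_, fun e he => ?_, fun e he => ?_⟩
  · rw [mem_src he]; exact Fin.is_lt _
  · rw [mem_dst he]; exact Fin.is_lt _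
  · have := G.mem_add_le (e * 3 + 4)
    omega

/-- On vertices this is well-foundedness of the adjacency relation; the predecessors of an arbitrary
number are vertices. -/
theorem IsDAG.wf_mem (h : G.IsDAG) :
    WellFounded fun u v => ∃ e < G.m, G.mem (e * 3 + 2) = u ∧ G.mem (e * 3 + 3) = v := by
  have key : ∀ v : Fin G.n,
      Acc (fun u v => ∃ e < G.m, G.mem (e * 3 + 2) = u ∧ G.mem (e * 3 + 3) = v) v.val := by
    intro v
    induction v using h.wf.induction with
    | _ v ih =>
      refine ⟨_, ?_⟩
      rintro _ ⟨e, he, rfl, hv⟩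
      obtain ⟨a, b, w, hmem, ha, hb, -⟩ := exists_mem_edges he
      rw [ha]
      obtain rfl : b = v := Fin.ext (hb.symm.trans hv)
      exact ih a ⟨w, hmem⟩
  refine ⟨fun v => ⟨_, ?_⟩⟩
  rintro _ ⟨e, he, rfl, -⟩
  obtain ⟨a, b, w, -, ha, -⟩ := exists_mem_edges he
  rw [ha]
  exact key a

end WDigraph

/-! ## Correctness of the approximation -/

theorem SortedGraph.mem_iff {G : WDigraph} {p a b w : ℕ → ℕ}
    (hG : SortedGraph G.n G.m G.mem p a b w p) {u v : Fin G.n} {x : ℕ} :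
    (p u, p v, x) ∈ edgeList G.m a b w ↔ (u, v, x) ∈ G.edges := by
  constructor
  · intro h
    obtain ⟨j, hj, h⟩ := List.mem_map.1 h
    obtain ⟨e, he, h1, h2, h3⟩ := hG.of_out j (List.mem_range.1 hj)
    obtain ⟨u', v', x', hmem, hu, hv, hx⟩ := G.exists_mem_edges he
    simp only [Prod.mk.injEq] at h
    obtain rfl : u' = u := Fin.ext (hG.pos_inj _ u'.2 _ u.2 (by rw [← hu, ← h1, h.1]))
    obtain rfl : v' = v := Fin.ext (hG.pos_inj _ v'.2 _ v.2 (by rw [← hv, ← h2, h.2.1]))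
    obtain rfl : x' = x := by rw [← hx, ← h3, h.2.2]
    exact hmem
  · intro h
    obtain ⟨e, he, hu, hv, hx⟩ := G.exists_edge h
    obtain ⟨j, hj, h1, h2, h3⟩ := hG.out_of e he
    rw [← hu, ← hv, ← hx, ← h1, ← h2, ← h3]
    exact mem_edgeList hj

theorem SortedGraph.surj {n m : ℕ} {A p a b w f : ℕ → ℕ} (hG : SortedGraph n m A p a b w f) {x : ℕ}
    (hx : x < n) : ∃ v : Fin n, p v = x := by
  let g : Fin n → Fin n := fun v => ⟨p v, hG.pos_lt v v.2⟩
  have hg : Function.Injective g := fun u v h =>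
    Fin.ext (hG.pos_inj _ u.2 _ v.2 (congrArg Fin.val h))
  obtain ⟨v, hv⟩ := Finite.surjective_of_injective hg ⟨x, hx⟩
  exact ⟨v, congrArg Fin.val hv⟩

theorem SortedGraph.walk_iff {G : WDigraph} {p a b w : ℕ → ℕ}
    (hG : SortedGraph G.n G.m G.mem p a b w p) {u v : Fin G.n} {ℓ : ℕ} :
    LWalk (edgeList G.m a b w) (p u) (p v) ℓ ↔ G.Walk u v ℓ := by
  constructor
  · generalize hx : p u = x
    generalize hy : p v = y
    intro h
    induction h generalizing u with
    | nil z =>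
      obtain rfl : u = v := Fin.ext (hG.pos_inj _ u.2 _ v.2 (hx.trans hy.symm))
      exact .nil u
    | @cons x z y c ℓ h _ ih =>
      obtain ⟨j, hj, h'⟩ := List.mem_map.1 h
      obtain ⟨e, he, -, h2, -⟩ := hG.of_out j (List.mem_range.1 hj)
      simp only [Prod.mk.injEq] at h'
      obtain ⟨-, v', -, -, -, hv', -⟩ := G.exists_mem_edges he
      have hz : p v' = z := by rw [← h'.2.1, h2, hv']
      exact .cons (hG.mem_iff.1 (by rwa [hx, hz])) (ih hz hy)
  · intro h
    induction h with
    | nil v => exact .nil _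
    | cons h _ ih => exact .cons (hG.mem_iff.2 h) ih

theorem SortedGraph.minEcc_le_iff {G : WDigraph} {p a b w : ℕ → ℕ}
    (hG : SortedGraph G.n G.m G.mem p a b w p) {T d : ℕ} (hd : d < T) {c : Fin G.n} :
    G.minEcc c ≤ d ↔ ∀ x < G.n, mdist T (edgeList G.m a b w) (p c) x ≤ d := by
  rw [WDigraph.minEcc_le_iff]
  constructor
  · intro h x hx
    obtain ⟨v, rfl⟩ := hG.surj hx
    obtain ⟨ℓ, hℓ, hw | hw⟩ := h v
    · exact (min_le_left _ _).trans ((tdist_le_of_walk (hG.walk_iff.2 hw)).trans hℓ)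
    · exact (min_le_right _ _).trans ((tdist_le_of_walk (hG.walk_iff.2 hw)).trans hℓ)
  · intro h v
    have hv := h _ (hG.pos_lt v v.2)
    rw [mdist, min_le_iff] at hv
    rcases hv with hv | hv
    · rcases tdist_cases (T := T) (E := edgeList G.m a b w) (p c) (p v) with h' | h'
      · exact ⟨_, hv, .inl (hG.walk_iff.1 h')⟩
      · omega
    · rcases tdist_cases (T := T) (E := edgeList G.m a b w) (p v) (p c) with h' | h'
      · exact ⟨_, hv, .inr (hG.walk_iff.1 h')⟩
      · omega

/-- A value below `T` is the eccentricity of a vertex, hence at least the radius. If the radius is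
finite, covering of an optimal centre gives at most twice the radius, which is below `T`, so `∞` is
not output. -/
theorem isApprox_three {G : WDigraph} {p a b w : ℕ → ℕ}
    (hG : SortedGraph G.n G.m G.mem p a b w p) (hn : 1 ≤ G.n) {W k : ℕ} (hw : ∀ j < G.m, w j ≤ W)
    (hE : ∀ j < G.m, a j < b j)
    (hgen : Genuine G.n (2 * (G.n * W) + 1) (edgeList G.m a b w) k)
    (hcov : ∀ c < G.n, Covered G.n (2 * (G.n * W) + 1) (edgeList G.m a b w) k c) :
    IsApprox 3 G.minRadius (if k < 2 * (G.n * W) + 1 then (k : ℕ∞) else ⊤) := by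
  have hle : ∀ c d, G.minEcc c ≤ (d : ℕ) → k ≤ 2 * d ∧ k ≤ 2 * (G.n * W) := by
    intro c d hd
    have h1 : G.minEcc c ≤ (min d (G.n * W) : ℕ) := by
      rw [WDigraph.minEcc_le_iff] at hd ⊢
      have hW : ∀ x y : Fin G.n, ∀ ℓ, G.Walk x y ℓ → ℓ ≤ G.n * W := by
        intro x y ℓ hℓ
        have h2 := (hG.walk_iff.2 hℓ).length_le (W := W) (by simpa [edgeList] using hE)
          (by simpa [edgeList] using hw)
        have h3 := Nat.mul_le_mul_right W (hG.pos_lt y y.2).le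
        omega
      intro v
      obtain ⟨ℓ, hℓ, hv⟩ := hd v
      refine ⟨ℓ, le_min hℓ ?_, hv⟩
      rcases hv with hv | hv <;> exact hW _ _ _ hv
    have h2 := hcov _ (hG.pos_lt c c.2) _ ((hG.minEcc_le_iff (by omega)).1 h1)
    omega
  obtain ⟨c, hc⟩ := WDigraph.exists_minEcc_eq_minRadius hn
  constructor
  · split_ifs with hk
    · rcases hgen with h | ⟨x, hx, -, h⟩
      · omega
      · obtain ⟨u, rfl⟩ := hG.surj hx
        exact (iInf_le _ u).trans ((hG.minEcc_le_iff hk).2 h)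
    · exact le_top
  · rcases eq_or_ne G.minRadius ⊤ with htop | htop
    · rw [htop]
      simp
    · obtain ⟨d, hd⟩ := ENat.ne_top_iff_exists.1 htop
      have h1 := hle c d (hc.trans hd.symm).le
      rw [if_pos (by omega), ← hd]
      have h2 : k ≤ 3 * d := by omega
      simp only [ENat.toENNReal_coe, ENNReal.ofReal_ofNat]
      exact_mod_cast h2

/-! ## The running time of the algorithm -/

/-- The terms linear in `n` are absorbed by `n ≤ 2 * m + 1`. The bound `M` only enters through `M *
n + 1 ≥ n + 1`, which makes the logarithm at least `log k` and at least `log 2`. -/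
theorem radius_time {n m k M : ℕ} (hn : 1 ≤ n) (hm : n ≤ 2 * m + 1) (hM : 1 ≤ M) (hk : 1 ≤ k)
    (hkn : k ≤ n) (hkk : k * k ≤ 2 * n) :
    ((20 + (m * 30 + 10) + ((n + m) * 40 + n * 20 + 50) + (m * 10 + 10) +
      k * (rounds k + 1) * ((n + m + 1) * 600) : ℕ) : ℝ) ≤
      100000 * ((m : ℝ) + 1) * Real.sqrt n * Real.log ((M : ℝ) * n + 1) := by
  have hn' : (1 : ℝ) ≤ n := by exact_mod_cast hn
  have hM' : (1 : ℝ) ≤ M := by exact_mod_cast hM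
  set l := Real.log ((M : ℝ) * n + 1) with hl
  have hMn : (n : ℝ) ≤ M * n := le_mul_of_one_le_left (by positivity) hM'
  have hl2 : (1 : ℝ) / 2 ≤ l := by
    have h1 : Real.log 2 ≤ l := Real.log_le_log (by norm_num) (by linarith)
    have := Real.log_two_gt_d9
    linarith
  have hk2 : (k : ℝ) ≤ 2 * Real.sqrt n := by
    refine le_of_sq_le_sq ?_ (by positivity)
    rw [mul_pow, Real.sq_sqrt (by positivity)]
    have : ((k * k : ℕ) : ℝ) ≤ ((2 * n : ℕ) : ℝ) := by exact_mod_cast hkk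
    push_cast at this
    nlinarith
  have hr : (rounds k : ℝ) + 1 ≤ 8 * l := by
    have h1 := rounds_le hk
    have h2 : (1 : ℝ) / 4 ≤ Real.log (4 / 3) := by
      have := Real.one_sub_inv_le_log_of_pos (x := 4 / 3) (by norm_num)
      norm_num at this ⊢
      linarith
    have h3 : Real.log k ≤ l := Real.log_le_log (by positivity) (by
      have : (k : ℝ) ≤ n := by exact_mod_cast hkn
      linarith)
    have h4 : Real.log k / Real.log (4 / 3) ≤ 4 * l := by
      rw [div_le_iff₀ (by linarith)]
      nlinarith
    linarith
  have hs : 1 ≤ Real.sqrt n := Real.one_le_sqrt.2 hn'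
  have h1 : (((n + m + 1) * 600 : ℕ) : ℝ) ≤ 1800 * ((m : ℝ) + 1) := by
    have : (n + m + 1) * 600 ≤ 1800 * (m + 1) := by omega
    exact_mod_cast this
  have h2 : (20 + (m * 30 + 10) + ((n + m) * 40 + n * 20 + 50) + (m * 10 + 10) : ℕ) ≤ 300 * (m + 1) := by
    omega
  have h3 : ((20 + (m * 30 + 10) + ((n + m) * 40 + n * 20 + 50) + (m * 10 + 10) : ℕ) : ℝ) ≤
      300 * ((m : ℝ) + 1) := by exact_mod_cast h2
  have h4 : (1 : ℝ) / 2 ≤ Real.sqrt n * l := by nlinarith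
  have h5 : (k : ℝ) * (rounds k + 1) ≤ 16 * (Real.sqrt n * l) := by
    calc (k : ℝ) * (rounds k + 1) ≤ (2 * Real.sqrt n) * (8 * l) :=
          mul_le_mul hk2 hr (by positivity) (by positivity)
      _ = _ := by ring
  have h6 : (k : ℝ) * (rounds k + 1) * (((n + m + 1) * 600 : ℕ) : ℝ) ≤
      16 * (Real.sqrt n * l) * (1800 * ((m : ℝ) + 1)) :=
    mul_le_mul h5 h1 (by positivity) (by positivity)
  rw [Nat.cast_add, Nat.cast_mul (k * (rounds k + 1)), Nat.cast_mul k]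
  rw [Nat.cast_add (rounds k), Nat.cast_one]
  have h7 : (300 : ℝ) * (m + 1) ≤ 600 * ((m : ℝ) + 1) * (Real.sqrt n * l) := by
    have : (0 : ℝ) ≤ m := by positivity
    nlinarith
  have h8 : (0 : ℝ) ≤ ((m : ℝ) + 1) * (Real.sqrt n * l) := by positivity
  nlinarith

theorem radiusMain_runs {G : WDigraph} (hdag : G.IsDAG) (hn : 1 ≤ G.n) {B : ℕ} {s : State}
    (h10 : s.reg 10 = G.n) (h11 : s.reg 11 = G.m) (h0 : s.arr 0 = G.mem)
    (hz : ∀ a, a ≠ 0 → s.arr a = 0) (hnm : G.n ≤ 2 * G.m + 1)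
    (hB : 20 * (inputSize G.encode * inputSize G.encode) + 20 ≤ B) :
    ∃ k, 1 ≤ k ∧ k ≤ G.n ∧ k * k ≤ 2 * G.n ∧ Runs B radiusMain s
      ((G.m * 30 + 10) + ((G.n + G.m) * 40 + G.n * 20 + 50) + (G.m * 10 + 10) +
        k * (rounds k + 1) * ((G.n + G.m + 1) * 600))
      fun s' => IsApprox 3 G.minRadius s'.output := by
  have hS0 : G.n + 3 * G.m + 2 ≤ inputSize G.encode := G.mem_add_le 0
  set S := inputSize G.encode with hS
  have hSS : S ≤ S * S := Nat.le_mul_self S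
  have hnS : G.n * S ≤ S * S := Nat.mul_le_mul_right _ (by omega)
  have hnn : G.n * G.n ≤ S * S := Nat.mul_le_mul (by omega) (by omega)
  have hmn : G.m * G.n ≤ S * S := Nat.mul_le_mul (by omega) (by omega)
  have hin := G.input
  obtain ⟨t₁, s₁, he₁, ht₁, hwt, hW, hdeg, hch⟩ := readEdges_runs (B := B) (h0 ▸ hin) h11 (by omega)
    (hz 2 (by omega)) (hz 3 (by omega))
  have hs₁ := he₁.same
  rw [h0] at hwt hdeg hch
  obtain ⟨t₂, s₂, he₂, ht₂, hG₂⟩ := sortEdges_runs (B := B) hin hdag.wf_mem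
    ((hs₁.reg 10 (by decide)).trans h10) (by omega) ((hs₁.arr 0 (by decide)).trans h0) hdeg hch
  have hs₂ := he₂.same
  have h11₂ := ((hs₂.reg 11 (by decide)).trans (hs₁.reg 11 (by decide))).trans h11
  obtain ⟨t₃, s₃, he₃, ht₃, hG₃⟩ := placeTargets_runs (B := B) h11₂ (by omega) hG₂
  have hs₃ := he₃.same
  have h12₃ : s₃.reg 12 = s₁.reg 12 := (hs₃.reg 12 (by decide)).trans (hs₂.reg 12 (by decide))
  have h6 : s₃.arr 6 = s₂.arr 6 := hs₃.arr 6 (by decide)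
  have h8 : s₃.arr 8 = s₂.arr 8 := hs₃.arr 8 (by decide)
  rw [← h6, ← h8] at hG₃
  have hnW : G.n * s₁.reg 12 ≤ G.n * S := Nat.mul_le_mul_left _ hW
  have hlt : ∀ j < G.m, s₃.arr 6 j < s₃.arr 7 j := fun j hj => by
    obtain ⟨e, he, h1, h2, -⟩ := hG₃.of_out j hj
    rw [h1, h2]
    exact hG₃.topo e he
  have hw : ∀ j < G.m, s₃.arr 8 j ≤ s₁.reg 12 := fun j hj => by
    obtain ⟨e, he, -, -, h3⟩ := hG₃.of_out j hj
    rw [h3]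
    exact hwt e he
  obtain ⟨k, hk1, hkn, hkk, t₄, s₄, he₄, ht₄, b, hgen, hcov, hout, hout'⟩ :=
    radiusSearch_runs (B := B) (s := s₃) hn
      ((((hs₃.reg 10 (by decide)).trans (hs₂.reg 10 (by decide))).trans (hs₁.reg 10 (by decide))).trans h10)
      ((hs₃.reg 11 (by decide)).trans h11₂) h12₃ (by omega)
      (fun x _ => by
        rw [hs₃.arr 11 (by decide), hs₂.arr 11 (by decide), hs₁.arr 11 (by decide), hz 11 (by omega)]
        rfl)
      hlt (fun j hj => by
        obtain ⟨e, he, -, h2, -⟩ := hG₃.of_out j hj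
        rw [h2]
        exact hG₃.pos_lt _ (hin.dst_lt e he))
      (fun i j => hG₃.mono i j) hw
  refine ⟨k, hk1, hkn, hkk, t₁ + (t₂ + (t₃ + t₄)), s₄, .seq he₁ (.seq he₂ (.seq he₃ he₄)), by omega, ?_⟩
  have := isApprox_three hG₃ hn hw hlt hgen hcov
  convert this using 1
  rw [State.output]
  split_ifs with h1 h2 h2
  · have := (hout h2).1; omega
  · rfl
  · rw [(hout h2).2]
  · exact absurd (hout' (by omega)) h1

theorem radiusProg_runs {G : WDigraph} (hdag : G.IsDAG) (hn : 1 ≤ G.n) {B M : ℕ} (hM : 1 ≤ M)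
    (hB : 20 * (inputSize G.encode * inputSize G.encode) + 20 ≤ B) :
    ∃ t s', Exec B radiusProg (initState G.encode) t s' ∧
      (t : ℝ) ≤ 100000 * ((G.m : ℝ) + 1) * Real.sqrt G.n * Real.log ((M : ℝ) * G.n + 1) ∧
      IsApprox 3 G.minRadius s'.output := by
  have hS0 : G.n + 3 * G.m + 2 ≤ inputSize G.encode := G.mem_add_le 0
  have h0 : G.mem 0 = G.n := rfl
  have h1 : G.mem 1 = G.m := rfl
  have hSS := Nat.le_mul_self (inputSize G.encode)
  suffices h : wp B radiusProg (fun s' t =>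
      (t : ℝ) ≤ 100000 * ((G.m : ℝ) + 1) * Real.sqrt G.n * Real.log ((M : ℝ) * G.n + 1) ∧
      IsApprox 3 G.minRadius s'.output) (initState G.encode) 0 by
    obtain ⟨t, s', he, h⟩ := wp_sound h
    rw [zero_add] at h
    exact ⟨t, s', he, h⟩
  simp only [radiusProg, Prog.block, wp_seq, wp_const, wp_load, wp_op, wp_cond, BinOp.eval]
  simp only [State.setReg_reg, State.setReg_arr, WDigraph.initState_arr_zero, if_true]
  simp [h0, h1]
  refine ⟨by omega, by omega, by omega, fun h => ?_, fun h => ?_⟩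
  -- The branch with an isolated vertex takes constantly many steps, which the claimed time exceeds
  -- because the root is at least 1 and the logarithm at least `1 / 2`.
  · have hk : (8 : ℝ) ≤ 100000 * ((G.m : ℝ) + 1) * Real.sqrt G.n * Real.log ((M : ℝ) * G.n + 1) := by
      have hn' : (1 : ℝ) ≤ G.n := by exact_mod_cast hn
      have hM' : (1 : ℝ) ≤ M := by exact_mod_cast hM
      have h2 : (1 : ℝ) / 2 ≤ Real.log ((M : ℝ) * G.n + 1) := by
        have h3 : Real.log 2 ≤ Real.log ((M : ℝ) * G.n + 1) :=
          Real.log_le_log (by norm_num) (by nlinarith)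
        have := Real.log_two_gt_d9
        linarith
      have h3 : 1 ≤ Real.sqrt G.n := Real.one_le_sqrt.2 hn'
      have h4 : (1 : ℝ) ≤ ((G.m : ℝ) + 1) * Real.sqrt G.n :=
        one_le_mul_of_one_le_of_one_le (by simp) h3
      rw [mul_assoc (100000 : ℝ)]
      nlinarith
    refine ⟨by linarith, ?_⟩
    rw [G.minRadius_eq_top (by omega)]
    simp [State.output, IsApprox]
  · generalize hs : ((((((initState G.encode).setReg 20 0).setReg 10 G.n).setReg 20 1).setReg 11
      G.m).setReg 21 (G.m + G.m)).setReg 21 (G.m + G.m + 1) = s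
    obtain ⟨k, hk1, hkn, hkk, hr⟩ := radiusMain_runs hdag hn (B := B) (s := s) (by simp [← hs])
      (by simp [← hs]) (by simp [← hs, WDigraph.initState_arr_zero])
      (fun a ha => by funext i; simp [← hs, initState, ha]) (by omega) hB
    refine hr.wp fun s' t' _ hQ ht => ⟨le_trans ?_ (radius_time hn (by omega) hM hk1 hkn hkk), hQ⟩
    exact_mod_cast by omega

theorem exists_approximation : ∃ (P : Prog) (κ : ℕ) (C : ℝ), ∀ M : ℕ, 1 ≤ M →
    ApproximatesMinRadius P κ 3 (fun G => G.IsDAG ∧ ∀ e ∈ G.edges, e.2.2 ≤ M)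
      (fun G => C * ((G.m : ℝ) + 1) * Real.sqrt (G.n : ℝ) * Real.log ((M : ℝ) * (G.n : ℝ) + 1)) := by
  -- The numbers that occur are quadratic in the input size `S`; as `S ≥ 3`, the fourth power of `S
  -- + 2` also absorbs the constant factor. The program does not use `M`.
  refine ⟨radiusProg, 4, 100000, fun M hM G hn hG => ?_⟩
  refine radiusProg_runs hG.1 hn hM ?_
  have h3 : 3 ≤ inputSize G.encode := by
    have : G.n + 3 * G.m + 2 ≤ inputSize G.encode := G.mem_add_le 0
    omega
  generalize inputSize G.encode = S at h3
  obtain ⟨S, rfl⟩ : ∃ k, S = k + 3 := ⟨S - 3, by omega⟩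
  ring_nf
  nlinarith [pow_nonneg (Nat.zero_le S) 3]

/-! ## Unweighted graphs from lists of pairs -/

/-- The unweighted graph on `{0, …, N - 1}` with the given edges. -/
def WDigraph.ofPairs (N : ℕ) (l : List (ℕ × ℕ)) (hl : ∀ e ∈ l, e.1 < N ∧ e.2 < N) (hd : l.Nodup) :
    WDigraph where
  n := N
  edges := l.attach.map fun e => (⟨e.1.1, (hl _ e.2).1⟩, ⟨e.1.2, (hl _ e.2).2⟩, 1)
  simple := by
    rw [List.map_map]
    refine List.Nodup.map (fun e e' h => ?_) (List.nodup_attach.2 hd)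
    simp only [Function.comp_apply, Prod.mk.injEq, Fin.mk.injEq] at h
    exact Subtype.ext (Prod.ext h.1 h.2)

section

variable {N : ℕ} {l : List (ℕ × ℕ)} {hl : ∀ e ∈ l, e.1 < N ∧ e.2 < N} {hd : l.Nodup}

theorem WDigraph.ofPairs_m : (WDigraph.ofPairs N l hl hd).m = l.length := by
  simp [WDigraph.m, WDigraph.ofPairs]

theorem WDigraph.mem_ofPairs {u v : Fin N} {w : ℕ} :
    (u, v, w) ∈ (WDigraph.ofPairs N l hl hd).edges ↔ (u.val, v.val) ∈ l ∧ w = 1 := by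
  constructor
  · intro h
    obtain ⟨⟨e, he⟩, -, h⟩ := List.mem_map.1 h
    simp only [Prod.mk.injEq] at h
    obtain ⟨rfl, rfl, rfl⟩ := h
    exact ⟨he, rfl⟩
  · rintro ⟨h, rfl⟩
    exact List.mem_map.2 ⟨⟨_, h⟩, List.mem_attach _ _, rfl⟩

theorem WDigraph.ofPairs_weight : ∀ e ∈ (WDigraph.ofPairs N l hl hd).edges, e.2.2 = 1 :=
  fun _ he => (WDigraph.mem_ofPairs.1 he).2

theorem WDigraph.ofPairs_isDAG (h : ∀ e ∈ l, e.1 < e.2) : (WDigraph.ofPairs N l hl hd).IsDAG := by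
  have key : ∀ u v, Relation.TransGen (WDigraph.ofPairs N l hl hd).Adj u v → u.val < v.val := by
    intro u v huv
    induction huv with
    | single h' =>
      obtain ⟨w, hw⟩ := h'
      exact h _ (WDigraph.mem_ofPairs.1 hw).1
    | tail _ h' ih =>
      obtain ⟨w, hw⟩ := h'
      exact ih.trans (h _ (WDigraph.mem_ofPairs.1 hw).1)
  exact fun v hv => lt_irrefl _ (key v v hv)

theorem WDigraph.encode_ofPairs : (WDigraph.ofPairs N l hl hd).encode =
    N :: l.length :: l.flatMap fun e => [e.1, e.2, 1] := by
  rw [WDigraph.encode, WDigraph.ofPairs_m]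
  simp only [WDigraph.ofPairs, List.flatMap_map]
  rw [List.flatMap_subtype (g := fun e => [e.1, e.2, 1]) fun _ _ => rfl, List.unattach_attach]

/-- The edges with their lengths. -/
def unitEdges (l : List (ℕ × ℕ)) : List (ℕ × ℕ × ℕ) := l.map fun e => (e.1, e.2, 1)

theorem mem_unitEdges {x y w : ℕ} : (x, y, w) ∈ unitEdges l ↔ (x, y) ∈ l ∧ w = 1 := by
  simp [unitEdges, eq_comm]

theorem WDigraph.walk_ofPairs {u v : Fin (WDigraph.ofPairs N l hl hd).n} {ℓ : ℕ} :
    (WDigraph.ofPairs N l hl hd).Walk u v ℓ ↔ LWalk (unitEdges l) u v ℓ := by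
  constructor
  · intro h
    induction h with
    | nil v => exact .nil _
    | cons h _ ih => exact .cons (mem_unitEdges.2 (WDigraph.mem_ofPairs.1 h)) ih
  · generalize hx : u.val = x
    generalize hy : v.val = y
    intro h
    induction h generalizing u with
    | nil z =>
      obtain rfl : u = v := Fin.ext (hx.trans hy.symm)
      exact .nil u
    | @cons x z y c ℓ h _ ih =>
      have h' := mem_unitEdges.1 h
      refine .cons (v := (⟨z, (hl _ h'.1).2⟩ : Fin N)) (WDigraph.mem_ofPairs.2 ?_) (ih rfl hy)
      rwa [hx]

end

/-! ## The reduction -/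

/-- The data of the reduction: `n` sets in either list, a universe of size `d`, with
`u ∈ A k ↔ 0 < a (k * d + u)` and `u ∈ B k ↔ 0 < b (k * d + u)`. -/
structure Gadget where
  (n d q g L : ℕ)
  (a b : ℕ → ℕ)

/-- A family of edges. -/
structure EdgeFam where
  count : ℕ
  (x y src dst : ℕ → ℕ)

/-- The edges `src i → dst i`, for all `i < count` with `x i < y i`. -/
def EdgeFam.list (F : EdgeFam) : List (ℕ × ℕ) :=
  ((List.range F.count).filter fun i => F.x i < F.y i).map fun i => (F.src i, F.dst i)

theorem EdgeFam.mem_list {F : EdgeFam} {u v : ℕ} :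
    (u, v) ∈ F.list ↔ ∃ i < F.count, F.x i < F.y i ∧ F.src i = u ∧ F.dst i = v := by
  simp [EdgeFam.list, and_assoc]

namespace Gadget

variable (G : Gadget)

/-- The length of a row. -/
def len : ℕ := G.q * G.L

/-- The number of vertices of a row. -/
def wid : ℕ := G.len + 1

def rows : ℕ := G.n * G.wid

def X : ℕ := G.rows + G.wid

def Y : ℕ := G.X + G.d

def Z : ℕ := G.Y + G.rows

/-- A pad is one vertex with one edge. Enough of them bring the number of edges per vertex close to
1, at a rate set by `g`; besides, they rule out every centre beyond the first vertex of the extra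
row. -/
def pads : ℕ := G.g * (G.X * (G.L + 2 * G.d + 4))

/-- The number of vertices. -/
def N : ℕ := G.Z + G.pads

/-- The rows of the vertices for the first list, and one more row. -/
def fam₁ : EdgeFam := ⟨G.X, fun i => i % G.wid, fun _ => G.len, fun i => i, fun i => i + 1⟩

/-- The hops. Candidate `i` stands for the vertex `i / L` and the exponent `i % L`; the test
discards hops beyond the last row of the first list. -/
def fam₂ : EdgeFam := ⟨G.rows * G.L, fun i => i / G.L / G.wid + 2 ^ (i % G.L), fun _ => G.n,
  fun i => i / G.L, fun i => (i / G.L / G.wid + 2 ^ (i % G.L)) * G.wid⟩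

/-- Together with `fam₄` this gives the end of every row a detour to all elements of the universe,
through the whole extra row. -/
def fam₃ : EdgeFam := ⟨G.n, fun _ => 0, fun _ => 1, fun i => i * G.wid + G.len, fun _ => G.rows⟩

def fam₄ : EdgeFam := ⟨G.d, fun _ => 0, fun _ => 1, fun _ => G.rows + G.len, fun i => G.X + i⟩

def fam₅ : EdgeFam := ⟨G.n * G.d, fun _ => 0, G.a, fun i => i / G.d * G.wid + G.len,
  fun i => G.X + i % G.d⟩

def fam₆ : EdgeFam := ⟨G.n * G.d, fun _ => 0, G.b, fun i => G.X + i % G.d,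
  fun i => G.Y + i / G.d * G.wid⟩

def fam₇ : EdgeFam := ⟨G.rows, fun i => i % G.wid, fun _ => G.len, fun i => G.Y + i,
  fun i => G.Y + i + 1⟩

def fam₈ : EdgeFam := ⟨G.pads, fun _ => 0, fun _ => 1, fun _ => G.rows, fun i => G.Z + i⟩

def fams : List EdgeFam := [G.fam₁, G.fam₂, G.fam₃, G.fam₄, G.fam₅, G.fam₆, G.fam₇, G.fam₈]

def edges : List (ℕ × ℕ) := G.fams.flatMap EdgeFam.list

/-- The edges in coordinates. -/
inductive IsEdge : ℕ → ℕ → Prop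
  | row {k t : ℕ} (hk : k ≤ G.n) (ht : t < G.len) : IsEdge (k * G.wid + t) (k * G.wid + t + 1)
  | hop {k t j : ℕ} (hk : k < G.n) (ht : t ≤ G.len) (hj : j < G.L) (h : k + 2 ^ j < G.n) :
    IsEdge (k * G.wid + t) ((k + 2 ^ j) * G.wid)
  | last {k : ℕ} (hk : k < G.n) : IsEdge (k * G.wid + G.len) G.rows
  | all {u : ℕ} (hu : u < G.d) : IsEdge (G.rows + G.len) (G.X + u)
  | left {k u : ℕ} (hk : k < G.n) (hu : u < G.d) (h : 0 < G.a (k * G.d + u)) :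
    IsEdge (k * G.wid + G.len) (G.X + u)
  | right {k u : ℕ} (hk : k < G.n) (hu : u < G.d) (h : 0 < G.b (k * G.d + u)) :
    IsEdge (G.X + u) (G.Y + k * G.wid)
  | row' {k t : ℕ} (hk : k < G.n) (ht : t < G.len) :
    IsEdge (G.Y + (k * G.wid + t)) (G.Y + (k * G.wid + t) + 1)
  | pad {p : ℕ} (hp : p < G.pads) : IsEdge G.rows (G.Z + p)

variable {G}

theorem wid_pos : 0 < G.wid := Nat.succ_pos _

theorem rows_le {k : ℕ} (hk : k < G.n) : k * G.wid + G.wid ≤ G.rows := by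
  rw [← Nat.succ_mul]
  exact Nat.mul_le_mul_right _ hk

theorem exists_coord {v M : ℕ} (hv : v < M * G.wid) :
    ∃ k t, k < M ∧ t ≤ G.len ∧ v = k * G.wid + t :=
  ⟨v / G.wid, v % G.wid, Nat.div_lt_of_lt_mul (by rwa [mul_comm]),
    Nat.lt_succ_iff.1 (Nat.mod_lt _ wid_pos), (Nat.div_add_mod' _ _).symm⟩

theorem X_eq : G.X = (G.n + 1) * G.wid := (Nat.succ_mul _ _).symm

theorem mem_edges {x y : ℕ} : (x, y) ∈ G.edges ↔ G.IsEdge x y := by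
  have hlt : ∀ {t}, t ≤ G.len → t < G.wid := fun h => Nat.lt_succ_of_le h
  simp only [edges, fams, List.flatMap_cons, List.flatMap_nil, List.mem_append, EdgeFam.mem_list,
    List.not_mem_nil, or_false]
  constructor
  · rintro (⟨i, hi, hx, rfl, rfl⟩ | ⟨i, hi, hx, rfl, rfl⟩ | ⟨i, hi, hx, rfl, rfl⟩ |
      ⟨i, hi, hx, rfl, rfl⟩ | ⟨i, hi, hx, rfl, rfl⟩ | ⟨i, hi, hx, rfl, rfl⟩ |
      ⟨i, hi, hx, rfl, rfl⟩ | ⟨i, hi, hx, rfl, rfl⟩)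
    · simp only [fam₁] at *
      obtain ⟨k, t, hk, ht, rfl⟩ := exists_coord (X_eq ▸ hi)
      rw [mul_add_mod' (hlt ht)] at hx
      exact .row (by omega) hx
    · simp only [fam₂] at *
      have hL : 0 < G.L := Nat.pos_of_ne_zero fun h => by simp [h] at hi
      obtain ⟨k, t, hk, ht, hv⟩ := exists_coord (v := i / G.L)
        (Nat.div_lt_of_lt_mul (by rwa [mul_comm]))
      rw [hv] at hx ⊢
      rw [mul_add_div' (hlt ht)] at hx ⊢
      exact .hop hk ht (Nat.mod_lt _ hL) hx
    · exact .last hi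
    · exact .all hi
    · simp only [fam₅] at *
      have hd : 0 < G.d := Nat.pos_of_ne_zero fun h => by simp [h] at hi
      exact .left (Nat.div_lt_of_lt_mul (by rwa [mul_comm])) (Nat.mod_lt _ hd)
        (by rwa [Nat.div_add_mod'])
    · simp only [fam₆] at *
      have hd : 0 < G.d := Nat.pos_of_ne_zero fun h => by simp [h] at hi
      exact .right (Nat.div_lt_of_lt_mul (by rwa [mul_comm])) (Nat.mod_lt _ hd)
        (by rwa [Nat.div_add_mod'])
    · simp only [fam₇] at *
      obtain ⟨k, t, hk, ht, rfl⟩ := exists_coord hi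
      rw [mul_add_mod' (hlt ht)] at hx
      exact .row' hk hx
    · exact .pad hi
  · rintro (@⟨k, t, hk, ht⟩ | @⟨k, t, j, hk, ht, hj, h⟩ | @⟨k, hk⟩ | @⟨u, hu⟩ | @⟨k, u, hk, hu, h⟩ |
      @⟨k, u, hk, hu, h⟩ | @⟨k, t, hk, ht⟩ | @⟨p, hp⟩)
    · refine .inl ⟨k * G.wid + t, ?_, ?_, rfl, rfl⟩
      · simp only [fam₁, X_eq]
        exact mul_add_lt (by omega) (hlt ht.le)
      · simpa only [fam₁, mul_add_mod' (hlt ht.le)]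
    · refine .inr (.inl ⟨(k * G.wid + t) * G.L + j, ?_, ?_, ?_, ?_⟩) <;>
        simp only [fam₂, mul_add_div' hj, mul_add_mod' hj, mul_add_div' (hlt ht)]
      · exact mul_add_lt (mul_add_lt hk (hlt ht)) hj
      · exact h
    · exact .inr (.inr (.inl ⟨k, hk, Nat.one_pos, rfl, rfl⟩))
    · exact .inr (.inr (.inr (.inl ⟨u, hu, Nat.one_pos, rfl, rfl⟩)))
    · refine .inr (.inr (.inr (.inr (.inl ⟨k * G.d + u, mul_add_lt hk hu, h, ?_, ?_⟩)))) <;>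
        simp only [fam₅, mul_add_div' hu, mul_add_mod' hu]
    · refine .inr (.inr (.inr (.inr (.inr (.inl ⟨k * G.d + u, mul_add_lt hk hu, h, ?_, ?_⟩))))) <;>
        simp only [fam₆, mul_add_div' hu, mul_add_mod' hu]
    · refine .inr (.inr (.inr (.inr (.inr (.inr (.inl ⟨k * G.wid + t, mul_add_lt hk (hlt ht.le), ?_,
        rfl, rfl⟩))))))
      simpa only [fam₇, mul_add_mod' (hlt ht.le)]
    · exact .inr (.inr (.inr (.inr (.inr (.inr (.inr ⟨p, hp, Nat.one_pos, rfl, rfl⟩))))))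

theorem IsEdge.lt {x y : ℕ} (h : G.IsEdge x y) : x < y ∧ y < G.N := by
  have hw : G.wid = G.len + 1 := rfl
  have hX : G.X = G.rows + G.wid := rfl
  have hY : G.Y = G.X + G.d := rfl
  have hZ : G.Z = G.Y + G.rows := rfl
  have hN : G.N = G.Z + G.pads := rfl
  rcases h with @⟨k, t, hk, ht⟩ | @⟨k, t, j, hk, ht, hj, h⟩ | @⟨k, hk⟩ | @⟨u, hu⟩ | @⟨k, u, hk, hu, h⟩ |
      @⟨k, u, hk, hu, h⟩ | @⟨k, t, hk, ht⟩ | @⟨p, hp⟩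
  · have : k * G.wid ≤ G.rows := Nat.mul_le_mul_right _ hk
    omega
  · have h1 := rows_le h
    have h2 : k * G.wid + G.wid ≤ (k + 2 ^ j) * G.wid := by
      rw [← Nat.succ_mul]
      exact Nat.mul_le_mul_right _ (Nat.add_le_add_left (Nat.one_le_two_pow) _)
    omega
  · have := rows_le hk
    omega
  · omega
  · have := rows_le hk
    omega
  · have := rows_le hk
    omega
  · have := rows_le hk
    omega
  · omega

end Gadget

/-! ### Simplicity of the graph and the number of its edges -/

theorem EdgeFam.nodup_list {F : EdgeFam}
    (h : ∀ i < F.count, ∀ j < F.count, F.x i < F.y i → F.x j < F.y j → F.src i = F.src j →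
      F.dst i = F.dst j → i = j) : F.list.Nodup := by
  refine List.Nodup.map_on (fun i hi j hj hij => ?_) (List.nodup_range.filter _)
  simp only [List.mem_filter, List.mem_range, decide_eq_true_eq] at hi hj
  simp only [Prod.mk.injEq] at hij
  exact h i hi.1 j hj.1 hi.2 hj.2 hij.1 hij.2

theorem EdgeFam.length_list_le (F : EdgeFam) : F.list.length ≤ F.count := by
  rw [EdgeFam.list, List.length_map]
  simpa using List.length_filter_le (fun i => decide (F.x i < F.y i)) (List.range F.count)

/-- A union of lists, on the `i`-th of which the function `τ` has the value `k + i`, has no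
repetition. -/
theorem nodup_flatMap_of_tag {α : Type*} {τ : α → ℕ} {l : List (List α)} {k : ℕ}
    (hn : ∀ x ∈ l, x.Nodup) (hτ : ∀ i (h : i < l.length), ∀ e ∈ l[i], τ e = k + i) :
    l.flatten.Nodup := by
  refine List.nodup_flatten.2 ⟨hn, List.pairwise_iff_getElem.2 fun i j hi hj hij e h1 h2 => ?_⟩
  have := hτ i hi e h1
  have := hτ j hj e h2
  omega

namespace Gadget

variable {G : Gadget}

/-- The number of the family of an edge. -/
def tag (G : Gadget) (x y : ℕ) : ℕ :=
  if G.Z ≤ y then 7 else if G.Y ≤ y then (if x < G.Y then 5 else 6) else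
  if G.X ≤ y then (if x < G.rows then 4 else 3) else if y % G.wid ≠ 0 then 0 else
  if y < G.rows then 1 else 2

theorem nodup_edges : G.edges.Nodup := by
  have hw : G.wid = G.len + 1 := rfl
  have hX : G.X = G.rows + G.wid := rfl
  have hY : G.Y = G.X + G.d := rfl
  have hZ : G.Z = G.Y + G.rows := rfl
  have hlt : ∀ {t}, t ≤ G.len → t < G.wid := fun h => Nat.lt_succ_of_le h
  have hrow : ∀ {k}, k < G.n → k * G.wid + G.wid ≤ G.rows := rows_le
  have hdiv : ∀ {i}, i < G.n * G.d → i / G.d < G.n := fun hi =>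
    Nat.div_lt_of_lt_mul (by rwa [mul_comm])
  have hmod : ∀ {i}, i < G.n * G.d → i % G.d < G.d := fun {i} hi =>
    Nat.mod_lt _ (Nat.pos_of_ne_zero fun h => by simp [h] at hi)
  rw [edges, List.flatMap]
  refine nodup_flatMap_of_tag (τ := fun e => G.tag e.1 e.2) (k := 0) ?_ ?_
  · simp only [fams, List.map_cons, List.map_nil, List.forall_mem_cons, List.not_mem_nil,
      false_implies, implies_true, and_true]
    refine ⟨?_, ?_, ?_, ?_, ?_, ?_, ?_, ?_⟩ <;> refine EdgeFam.nodup_list ?_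
    · exact fun i _ j _ _ _ h _ => h
    · intro i hi j hj hx hy h h'
      simp only [fam₂] at *
      rw [h] at h'
      have h1 := Nat.eq_of_mul_eq_mul_right wid_pos h'
      have h2 : i % G.L = j % G.L := Nat.pow_right_injective le_rfl (Nat.add_left_cancel h1)
      rw [← Nat.div_add_mod i G.L, ← Nat.div_add_mod j G.L, h, h2]
    · intro i hi j hj hx hy h h'
      simp only [fam₃] at *
      exact Nat.eq_of_mul_eq_mul_right wid_pos (Nat.add_right_cancel h)
    · intro i hi j hj hx hy h h'
      simp only [fam₄] at *
      omega
    · intro i hi j hj hx hy h h'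
      simp only [fam₅] at *
      have h1 := Nat.eq_of_mul_eq_mul_right wid_pos (Nat.add_right_cancel h)
      rw [← Nat.div_add_mod i G.d, ← Nat.div_add_mod j G.d, h1, Nat.add_left_cancel h']
    · intro i hi j hj hx hy h h'
      simp only [fam₆] at *
      have h1 := Nat.eq_of_mul_eq_mul_right wid_pos (Nat.add_left_cancel h')
      rw [← Nat.div_add_mod i G.d, ← Nat.div_add_mod j G.d, h1, Nat.add_left_cancel h]
    · intro i hi j hj hx hy h h'
      simp only [fam₇] at *
      omega
    · intro i hi j hj hx hy h h'
      simp only [fam₈] at *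
      omega
  · intro f hf e he
    obtain ⟨u, v⟩ := e
    simp only [fams, List.map_cons, List.map_nil, List.length_cons, List.length_nil] at hf he
    interval_cases f <;> simp only [List.getElem_cons_succ, List.getElem_cons_zero] at he <;>
      obtain ⟨i, hi, hx, rfl, rfl⟩ := EdgeFam.mem_list.1 he
    · simp only [fam₁] at *
      obtain ⟨k, t, hk, ht, rfl⟩ := exists_coord (X_eq ▸ hi)
      rw [mul_add_mod' (hlt ht)] at hx
      have h1 : (k * G.wid + t + 1) % G.wid ≠ 0 := by
        rw [add_assoc, mul_add_mod' (by omega)]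
        omega
      have h2 : k * G.wid ≤ G.rows := Nat.mul_le_mul_right _ (by omega)
      rw [tag, if_neg (by omega), if_neg (by omega), if_neg (by omega), if_pos h1]
    · simp only [fam₂] at *
      have h1 := hrow hx
      have h2 := Nat.mul_mod_left (i / G.L / G.wid + 2 ^ (i % G.L)) G.wid
      rw [tag, if_neg (by omega), if_neg (by omega), if_neg (by omega), if_neg (not_not.2 h2), if_pos (by omega)]
    · simp only [fam₃] at *
      have h2 : G.rows % G.wid = 0 := Nat.mul_mod_left _ _
      rw [tag, if_neg (by omega), if_neg (by omega), if_neg (by omega), if_neg (not_not.2 h2), if_neg (lt_irrefl _)]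
    · simp only [fam₄] at *
      rw [tag, if_neg (by omega), if_neg (by omega), if_pos (by omega), if_neg (by omega)]
    · simp only [fam₅] at *
      have h1 := hrow (hdiv hi)
      have h2 := hmod hi
      rw [tag, if_neg (by omega), if_neg (by omega), if_pos (by omega), if_pos (by omega)]
    · simp only [fam₆] at *
      have h1 := hrow (hdiv hi)
      have h2 := hmod hi
      rw [tag, if_neg (by omega), if_pos (by omega), if_pos (by omega)]
    · simp only [fam₇] at *
      obtain ⟨k, t, hk, ht, rfl⟩ := exists_coord hi
      rw [mul_add_mod' (hlt ht)] at hx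
      have h1 := hrow hk
      rw [tag, if_neg (by omega), if_pos (by omega), if_neg (by omega)]
    · simp only [fam₈] at *
      rw [tag, if_pos (by omega)]

theorem length_edges_le : G.edges.length ≤
    G.X + G.rows * G.L + G.n + G.d + 2 * (G.n * G.d) + G.rows + G.pads := by
  have h₁ := G.fam₁.length_list_le
  have h₂ := G.fam₂.length_list_le
  have h₃ := G.fam₃.length_list_le
  have h₄ := G.fam₄.length_list_le
  have h₅ := G.fam₅.length_list_le
  have h₆ := G.fam₆.length_list_le
  have h₇ := G.fam₇.length_list_le
  have h₈ := G.fam₈.length_list_le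
  simp only [fam₁, fam₂, fam₃, fam₄, fam₅, fam₆, fam₇, fam₈] at *
  simp only [edges, fams, fam₁, fam₂, fam₃, fam₄, fam₅, fam₆, fam₇, fam₈, List.flatMap_cons,
    List.flatMap_nil, List.length_append, List.length_nil]
  omega

/-- The graph of the reduction. -/
def graph (G : Gadget) : WDigraph :=
  .ofPairs G.N G.edges (fun _ he => have := (mem_edges.1 he).lt; ⟨this.1.trans this.2, this.2⟩)
    nodup_edges

theorem isDAG_graph : G.graph.IsDAG := WDigraph.ofPairs_isDAG fun _ he => (mem_edges.1 he).lt.1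

theorem encode_graph :
    G.graph.encode = G.N :: G.edges.length :: G.edges.flatMap fun e => [e.1, e.2, 1] :=
  WDigraph.encode_ofPairs

theorem n_le_X : G.n ≤ G.X := (Nat.le_mul_of_pos_right _ wid_pos).trans (Nat.le_add_right _ _)

/-- The edges that are not paid for by a vertex of their own. -/
theorem extra_le : G.rows * G.L + G.n + 2 * (G.n * G.d) ≤ G.X * (G.L + 2 * G.d + 4) := by
  have h1 : G.rows * G.L ≤ G.X * G.L := Nat.mul_le_mul_right _ (Nat.le_add_right _ _)
  have h2 : G.n * G.d ≤ G.X * G.d := Nat.mul_le_mul_right _ n_le_X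
  have h3 := G.n_le_X
  have h4 : G.X * (G.L + 2 * G.d + 4) = G.X * G.L + 2 * (G.X * G.d) + 4 * G.X := by ring
  omega

/-- All edges but at most `X * (L + 2d + 4)` can be charged to distinct vertices. That excess is
`pads / g`, hence at most `(K - 1) N`. -/
theorem length_edges_le_mul {K : ℝ} (hg : 1 ≤ G.g * (K - 1)) (hK : 1 < K) :
    (G.edges.length : ℝ) ≤ K * G.N := by
  have h1 : G.edges.length ≤ G.N + G.X * (G.L + 2 * G.d + 4) := by
    have h1 := G.length_edges_le
    have h2 := G.extra_le
    have hY : G.Y = G.X + G.d := rfl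
    have hZ : G.Z = G.Y + G.rows := rfl
    have hN : G.N = G.Z + G.pads := rfl
    omega
  have h2 : (G.edges.length : ℝ) ≤ G.N + (G.X * (G.L + 2 * G.d + 4) : ℕ) := by exact_mod_cast h1
  have h3 : ((G.X * (G.L + 2 * G.d + 4) : ℕ) : ℝ) * G.g ≤ G.N := by
    have : G.X * (G.L + 2 * G.d + 4) * G.g ≤ G.N := by
      rw [mul_comm]
      exact Nat.le_add_left _ _
    exact_mod_cast this
  have h4 : (0 : ℝ) ≤ ((G.X * (G.L + 2 * G.d + 4) : ℕ) : ℝ) := Nat.cast_nonneg _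
  have h5 : ((G.X * (G.L + 2 * G.d + 4) : ℕ) : ℝ) ≤ (K - 1) * G.N := by
    calc ((G.X * (G.L + 2 * G.d + 4) : ℕ) : ℝ) ≤
        ((G.X * (G.L + 2 * G.d + 4) : ℕ) : ℝ) * (G.g * (K - 1)) := le_mul_of_one_le_right h4 hg
      _ = (K - 1) * (((G.X * (G.L + 2 * G.d + 4) : ℕ) : ℝ) * G.g) := by ring
      _ ≤ (K - 1) * G.N := mul_le_mul_of_nonneg_left h3 (by linarith)
  linarith

/-! ### A hitting set gives a small radius -/

/-- Some set of the first list intersects every set of the second list. -/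
def Hits (G : Gadget) : Prop :=
  ∃ k < G.n, ∀ j < G.n, ∃ u < G.d, 0 < G.a (k * G.d + u) ∧ 0 < G.b (j * G.d + u)

abbrev GWalk (G : Gadget) (x y ℓ : ℕ) : Prop := LWalk (unitEdges G.edges) x y ℓ

theorem IsEdge.walk {x y z ℓ : ℕ} (h : G.IsEdge x y) (hw : G.GWalk y z ℓ) : G.GWalk x z (ℓ + 1) := by
  rw [add_comm]
  exact .cons (mem_unitEdges.2 ⟨mem_edges.2 h, rfl⟩) hw

theorem walk_row {k : ℕ} (hk : k ≤ G.n) {t : ℕ} : ∀ {s : ℕ}, t + s ≤ G.len →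
    G.GWalk (k * G.wid + t) (k * G.wid + (t + s)) s := by
  intro s
  induction s generalizing t with
  | zero => exact fun _ => .nil _
  | succ s ih =>
    intro h
    have := ih (t := t + 1) (by omega)
    rw [show t + 1 + s = t + (s + 1) by ring] at this
    exact (IsEdge.row hk (by omega)).walk this

theorem walk_row' {k : ℕ} (hk : k < G.n) {t : ℕ} : ∀ {s : ℕ}, t + s ≤ G.len →
    G.GWalk (G.Y + (k * G.wid + t)) (G.Y + (k * G.wid + (t + s))) s := by
  intro s
  induction s generalizing t with
  | zero => exact fun _ => .nil _
  | succ s ih =>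
    intro h
    have := ih (t := t + 1) (by omega)
    rw [show t + 1 + s = t + (s + 1) by ring] at this
    exact (IsEdge.row' hk (by omega)).walk this

/-- The binary expansion of the difference `D` of the rows, largest power first. A hop may leave
from any vertex of a row and lands on the first vertex of another. -/
theorem exists_hops : ∀ {j : ℕ}, j ≤ G.L → ∀ {k t D : ℕ}, t ≤ G.len → 1 ≤ D → D < 2 ^ j →
    k + D < G.n → ∃ ℓ ≤ j, G.GWalk (k * G.wid + t) ((k + D) * G.wid) ℓ := by
  intro j
  induction j with
  | zero => intro _ k t D _ h1 h2; simp at h2; omega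
  | succ j ih =>
    intro hj k t D ht h1 h2 h3
    rcases lt_or_ge D (2 ^ j) with h | h
    · obtain ⟨ℓ, hℓ, hw⟩ := ih (by omega) ht h1 h h3
      exact ⟨ℓ, by omega, hw⟩
    · obtain ⟨D, rfl⟩ := Nat.exists_eq_add_of_le h
      have he : G.IsEdge (k * G.wid + t) ((k + 2 ^ j) * G.wid) :=
        .hop (by omega) ht (by omega) (by omega)
      rw [pow_succ] at h2
      rw [← add_assoc] at h3 ⊢
      rcases Nat.eq_zero_or_pos D with rfl | hD
      · exact ⟨0 + 1, by omega, he.walk (.nil _)⟩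
      · obtain ⟨ℓ, hℓ, hw⟩ := ih (by omega) (Nat.zero_le _) hD (by omega) h3
        exact ⟨ℓ + 1, by omega, he.walk hw⟩

theorem exists_walk_rows (hL : G.n ≤ 2 ^ G.L) {k k' t t' : ℕ} (hk : k < k') (hk' : k' < G.n)
    (ht : t ≤ G.len) (ht' : t' ≤ G.len) :
    ∃ ℓ ≤ G.len + G.L, G.GWalk (k * G.wid + t) (k' * G.wid + t') ℓ := by
  obtain ⟨D, rfl⟩ := Nat.exists_eq_add_of_le hk.le
  obtain ⟨ℓ, hℓ, hw⟩ := exists_hops le_rfl (k := k) (D := D) ht (by omega) (by omega) hk'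
  have h2 := walk_row hk'.le (t := 0) (s := t') (by omega)
  rw [zero_add] at h2
  exact ⟨ℓ + t', by omega, hw.append h2⟩

/-- The centre is the end of the row of the hitting set. Other rows of the first list are at
distance at most `L` hops plus one row; everything else is within `len + 2`, and `2 ≤ L`. -/
theorem minRadius_le_of_hits (hL : G.n ≤ 2 ^ G.L) (h2 : 2 ≤ G.L) (h : G.Hits) :
    G.graph.minRadius ≤ (G.len + G.L : ℕ) := by
  obtain ⟨i, hi, hit⟩ := h
  have hw : G.wid = G.len + 1 := rfl
  have hX : G.X = G.rows + G.wid := rfl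
  have hY : G.Y = G.X + G.d := rfl
  have hZ : G.Z = G.Y + G.rows := rfl
  have hN : G.N = G.Z + G.pads := rfl
  have hri := rows_le hi
  have hcN : i * G.wid + G.len < G.N := by omega
  refine (iInf_le _ (⟨i * G.wid + G.len, hcN⟩ : Fin G.N)).trans (WDigraph.minEcc_le_iff.2 ?_)
  intro v
  suffices H : ∀ v < G.N, ∃ ℓ ≤ G.len + G.L,
      G.GWalk (i * G.wid + G.len) v ℓ ∨ G.GWalk v (i * G.wid + G.len) ℓ by
    obtain ⟨ℓ, hℓ, h⟩ := H v v.2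
    exact ⟨ℓ, hℓ, h.imp WDigraph.walk_ofPairs.2 WDigraph.walk_ofPairs.2⟩
  intro v hv
  have hlast : G.IsEdge (i * G.wid + G.len) G.rows := .last hi
  have hrow : ∀ t ≤ G.len, G.GWalk G.rows (G.rows + t) t := fun t ht => by
    simpa [rows] using walk_row (G := G) le_rfl (t := 0) (s := t) (by omega)
  rcases lt_or_ge v G.rows with h1 | h1
  · obtain ⟨k, t, hk, ht, rfl⟩ := exists_coord h1
    rcases lt_trichotomy k i with hki | rfl | hki
    · obtain ⟨ℓ, hℓ, hwk⟩ := exists_walk_rows hL hki hi ht le_rfl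
      exact ⟨ℓ, hℓ, .inr hwk⟩
    · have := walk_row (G := G) hi.le (t := t) (s := G.len - t) (by omega)
      rw [Nat.add_sub_cancel' ht] at this
      exact ⟨_, by omega, .inr this⟩
    · obtain ⟨ℓ, hℓ, hwk⟩ := exists_walk_rows hL hki hk le_rfl ht
      exact ⟨ℓ, hℓ, .inl hwk⟩
  rcases lt_or_ge v G.X with h3 | h3
  · obtain ⟨t, rfl⟩ := Nat.exists_eq_add_of_le h1
    exact ⟨_, by omega, .inl (hlast.walk (hrow t (by omega)))⟩
  rcases lt_or_ge v G.Y with h4 | h4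
  · obtain ⟨u, rfl⟩ := Nat.exists_eq_add_of_le h3
    exact ⟨_, by omega, .inl (hlast.walk ((hrow _ le_rfl).append
      ((IsEdge.all (by omega)).walk (.nil _))))⟩
  rcases lt_or_ge v G.Z with h5 | h5
  · obtain ⟨y, rfl⟩ := Nat.exists_eq_add_of_le h4
    obtain ⟨j, t, hj, ht, rfl⟩ := exists_coord (G := G) (v := y) (M := G.n)
      (by have : G.rows = G.n * G.wid := rfl; omega)
    obtain ⟨u, hu, ha, hb⟩ := hit j hj
    have := walk_row' hj (t := 0) (s := t) (by omega)
    rw [zero_add] at this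
    exact ⟨_, by omega, .inl ((IsEdge.left hi hu ha).walk ((IsEdge.right hj hu hb).walk this))⟩
  · obtain ⟨p, rfl⟩ := Nat.exists_eq_add_of_le h5
    exact ⟨_, by omega, .inl (hlast.walk ((IsEdge.pad (by omega)).walk (.nil _)))⟩

/-! ### Without a hitting set the radius is large -/

/-- Walks are long if a potential grows by at most one along every edge. -/
theorem le_of_potential {f : ℕ → ℕ} (hf : ∀ x y, G.IsEdge x y → f y ≤ f x + 1) {x y ℓ : ℕ}
    (h : G.GWalk x y ℓ) : f y ≤ f x + ℓ := by
  refine h.le_of_closed fun e he => ?_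
  obtain ⟨a, b, c⟩ := e
  obtain ⟨h1, rfl⟩ := mem_unitEdges.1 he
  exact hf _ _ (mem_edges.1 h1)

theorem GWalk_le {x y ℓ : ℕ} (h : G.GWalk x y ℓ) : x ≤ y := by
  refine h.le fun e he => ?_
  obtain ⟨a, b, c⟩ := e
  exact (mem_edges.1 (mem_unitEdges.1 he).1).lt.1

/-- The distances from row `k`, if the `k`-th set and the `j`-th set are disjoint. -/
def pot (G : Gadget) (k j v : ℕ) : ℕ :=
  if v < k * G.wid then 4 * G.len + 10 else if v < k * G.wid + G.wid then 0 else
  if v < G.X then 1 + v % G.wid else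
  if v < G.Y then (if 0 < G.a (k * G.d + (v - G.X)) then 1 else G.len + 2) else
  if v < G.Y + j * G.wid then 0 else
  if v < G.Y + j * G.wid + G.wid then G.len + 3 + (v - (G.Y + j * G.wid)) else 0

theorem pot_before {k j v : ℕ} (h : v < k * G.wid) : G.pot k j v = 4 * G.len + 10 := if_pos h

theorem pot_same {k j t : ℕ} (h : t < G.wid) : G.pot k j (k * G.wid + t) = 0 := by
  rw [pot, if_neg (by omega), if_pos (by omega)]

theorem pot_after {k j v : ℕ} (h : k * G.wid + G.wid ≤ v) (h' : v < G.X) :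
    G.pot k j v = 1 + v % G.wid := by
  rw [pot, if_neg (by omega), if_neg (by omega), if_pos h']

theorem pot_universe {k j u : ℕ} (hk : k < G.n) (hu : u < G.d) :
    G.pot k j (G.X + u) = if 0 < G.a (k * G.d + u) then 1 else G.len + 2 := by
  have hX : G.X = G.rows + G.wid := rfl
  have hY : G.Y = G.X + G.d := rfl
  have hrk := rows_le hk
  rw [pot, if_neg (by omega), if_neg (by omega), if_neg (by omega), if_pos (by omega),
    Nat.add_sub_cancel_left]

theorem pot_row' {k j t : ℕ} (hk : k < G.n) (ht : t < G.wid) :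
    G.pot k j (G.Y + (j * G.wid + t)) = G.len + 3 + t := by
  have hX : G.X = G.rows + G.wid := rfl
  have hY : G.Y = G.X + G.d := rfl
  have hrk := rows_le hk
  rw [pot, if_neg (by omega), if_neg (by omega), if_neg (by omega), if_neg (by omega),
    if_neg (by omega), if_pos (by omega)]
  omega

theorem pot_other {k j v : ℕ} (hk : k < G.n) (hv : v < j * G.wid ∨ j * G.wid + G.wid ≤ v) :
    G.pot k j (G.Y + v) = 0 := by
  have hX : G.X = G.rows + G.wid := rfl
  have hY : G.Y = G.X + G.d := rfl
  have hrk := rows_le hk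
  rw [pot, if_neg (by omega), if_neg (by omega), if_neg (by omega), if_neg (by omega)]
  rcases hv with hv | hv
  · rw [if_pos (by omega)]
  · rw [if_neg (by omega), if_neg (by omega)]

theorem pot_le (k j v : ℕ) : G.pot k j v ≤ 4 * G.len + 10 := by
  have h := Nat.mod_lt v (G.wid_pos)
  have hw : G.wid = G.len + 1 := rfl
  rw [pot]
  split_ifs <;> omega

theorem mul_wid_add_le {i i' : ℕ} (h : i < i') : i * G.wid + G.wid ≤ i' * G.wid := by
  rw [← Nat.succ_mul]
  exact Nat.mul_le_mul_right _ h

/-- To enter the row of the `j`-th set, a walk needs an element outside the `k`-th set. Such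
elements are only reached from the end of a later row or of the extra row, which costs another `len`
edges. -/
theorem pot_closed {k j : ℕ} (hk : k < G.n) (hj : j < G.n)
    (hkj : ∀ u < G.d, 0 < G.a (k * G.d + u) → ¬ 0 < G.b (j * G.d + u)) {x y : ℕ}
    (h : G.IsEdge x y) : G.pot k j y ≤ G.pot k j x + 1 := by
  have hw : G.wid = G.len + 1 := rfl
  have hX : G.X = G.rows + G.wid := rfl
  have hrk := rows_le hk
  have hrj := rows_le hj
  -- Before row `k` the potential has a value no smaller than any other, so edges that leave these
  -- vertices impose no condition.
  have hbefore : ∀ {i t}, i < k → t ≤ G.len → ∀ v, G.pot k j v ≤ G.pot k j (i * G.wid + t) + 1 :=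
    fun {i t} hi ht v => by
      have := mul_wid_add_le (G := G) hi
      rw [pot_before (v := i * G.wid + t) (by omega)]
      have := G.pot_le k j v
      omega
  rcases h with @⟨i, t, hi, ht⟩ | @⟨i, t, s, hi, ht, hs, h⟩ | @⟨i, hi⟩ | @⟨u, hu⟩ | @⟨i, u, hi, hu, h⟩ |
      @⟨i, u, hi, hu, h⟩ | @⟨i, t, hi, ht⟩ | @⟨p, hp⟩
  · rcases lt_trichotomy i k with hik | rfl | hik
    · exact hbefore hik ht.le _
    · rw [add_assoc, pot_same (by omega)]
      omega
    · have h1 := mul_wid_add_le (G := G) hik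
      have h2 : i * G.wid ≤ G.rows := Nat.mul_le_mul_right _ hi
      rw [pot_after (by omega) (by omega), pot_after (by omega) (by omega), add_assoc (i * G.wid),
        mul_add_mod' (by omega), mul_add_mod' (by omega)]
      omega
  · rcases lt_or_ge i k with hik | hik
    · exact hbefore hik ht _
    · have h1 := rows_le h
      have h2 := mul_wid_add_le (G := G) (i := k) (i' := i + 2 ^ s)
        (by have := Nat.two_pow_pos s; omega)
      rw [pot_after (by omega) (by omega), Nat.mul_mod_left]
      omega
  · rcases lt_or_ge i k with hik | hik
    · exact hbefore hik le_rfl _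
    · rw [pot_after (by omega) (by omega), rows, Nat.mul_mod_left]
      omega
  · rw [pot_universe hk hu, pot_after (by omega) (by omega), rows, mul_add_mod' (by omega)]
    split_ifs <;> omega
  · rw [pot_universe hk hu]
    rcases lt_trichotomy i k with hik | rfl | hik
    · rw [← pot_universe (j := j) hk hu]
      exact hbefore hik le_rfl _
    · rw [if_pos h]
      omega
    · have h1 := mul_wid_add_le (G := G) hik
      have h2 := rows_le hi
      rw [pot_after (by omega) (by omega), mul_add_mod' (by omega)]
      split_ifs <;> omega
  · rcases lt_trichotomy i j with hij | rfl | hij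
    · rw [pot_other hk (.inl (by have := mul_wid_add_le (G := G) hij; omega))]
      omega
    · have h1 := pot_row' (j := i) hk (G.wid_pos)
      rw [add_zero] at h1
      -- The one edge type that needs disjointness: an element of the `j`-th set is not in the
      -- `k`-th set and so has potential `len + 2`.
      rw [h1, pot_universe hk hu, if_neg fun h' => hkj u hu h' h]
    · rw [pot_other hk (.inr (mul_wid_add_le hij))]
      omega
  · rcases lt_trichotomy i j with hij | rfl | hij
    · rw [add_assoc, pot_other hk (.inl (by have := mul_wid_add_le (G := G) hij; omega))]
      omega
    · rw [pot_row' hk (by omega), add_assoc, add_assoc, pot_row' hk (by omega)]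
      omega
    · rw [add_assoc, pot_other hk (.inr (by have := mul_wid_add_le (G := G) hij; omega))]
      omega
  · rw [Z, add_assoc, pot_other hk (.inr (by omega))]
    omega

/-- The distances from the first vertex of the last row. -/
def potLast (G : Gadget) (v : ℕ) : ℕ :=
  if v < G.rows then 4 * G.len + 10 else if v < G.X then v - G.rows else
  if v < G.Y then G.len + 1 else if v < G.Z then G.len + 2 + (v - G.Y) % G.wid else 0

theorem potLast_closed {x y : ℕ} (h : G.IsEdge x y) : G.potLast y ≤ G.potLast x + 1 := by
  have hw : G.wid = G.len + 1 := rfl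
  have hX : G.X = G.rows + G.wid := rfl
  have hY : G.Y = G.X + G.d := rfl
  have hZ : G.Z = G.Y + G.rows := rfl
  rcases h with @⟨i, t, hi, ht⟩ | @⟨i, t, s, hi, ht, hs, h⟩ | @⟨i, hi⟩ | @⟨u, hu⟩ | @⟨i, u, hi, hu, h⟩ |
      @⟨i, u, hi, hu, h⟩ | @⟨i, t, hi, ht⟩ | @⟨p, hp⟩
  · have h3 : i * G.wid ≤ G.rows := Nat.mul_le_mul_right _ hi
    rw [potLast, potLast]
    rcases hi.lt_or_eq with hi | rfl
    · have := rows_le hi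
      split_ifs <;> omega
    · have : G.rows = G.n * G.wid := rfl
      split_ifs <;> omega
  · have h1 := rows_le h
    have h2 := rows_le hi
    rw [potLast, potLast]
    split_ifs <;> omega
  · have h2 := rows_le hi
    rw [potLast, potLast]
    split_ifs <;> omega
  · rw [potLast, potLast]
    split_ifs <;> omega
  · have h2 := rows_le hi
    rw [potLast, potLast]
    split_ifs <;> omega
  · have h2 := rows_le hi
    have h3 : i * G.wid % G.wid = 0 := Nat.mul_mod_left _ _
    rw [potLast, potLast, Nat.add_sub_cancel_left, h3]
    split_ifs <;> omega
  · have h2 := rows_le hi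
    have h3 : (i * G.wid + t) % G.wid = t := mul_add_mod' (by omega)
    have h4 : (i * G.wid + t + 1) % G.wid = t + 1 := by
      rw [add_assoc, mul_add_mod' (by omega)]
    rw [potLast, potLast, add_assoc G.Y, Nat.add_sub_cancel_left, Nat.add_sub_cancel_left, h3, h4]
    split_ifs <;> omega
  · rw [potLast, potLast]
    split_ifs <;> omega

/-- The pads are incomparable to everything except for the rows. -/
def potPad (G : Gadget) (v : ℕ) : ℕ :=
  if G.Z ≤ v then 4 * G.len + 10 else if v ≤ G.rows then 4 * G.len + 10 else 0

theorem potPad_closed {x y : ℕ} (h : G.IsEdge x y) : G.potPad y ≤ G.potPad x + 1 := by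
  have hw : G.wid = G.len + 1 := rfl
  have hX : G.X = G.rows + G.wid := rfl
  have hY : G.Y = G.X + G.d := rfl
  have hZ : G.Z = G.Y + G.rows := rfl
  rcases h with @⟨i, t, hi, ht⟩ | @⟨i, t, s, hi, ht, hs, h⟩ | @⟨i, hi⟩ | @⟨u, hu⟩ | @⟨i, u, hi, hu, h⟩ |
      @⟨i, u, hi, hu, h⟩ | @⟨i, t, hi, ht⟩ | @⟨p, hp⟩
  · have h3 : i * G.wid ≤ G.rows := Nat.mul_le_mul_right _ hi
    rw [potPad, potPad]
    split_ifs <;> omega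
  · have h2 := rows_le hi
    rw [potPad, potPad]
    split_ifs <;> omega
  · have h2 := rows_le hi
    rw [potPad, potPad]
    split_ifs <;> omega
  · rw [potPad, potPad]
    split_ifs <;> omega
  · have h2 := rows_le hi
    rw [potPad, potPad]
    split_ifs <;> omega
  · have h2 := rows_le hi
    rw [potPad, potPad]
    split_ifs <;> omega
  · have h2 := rows_le hi
    rw [potPad, potPad]
    split_ifs <;> omega
  · rw [potPad, potPad]
    split_ifs <;> omega

/-- Without a hitting set every vertex has a vertex after or before it that is far away. -/
theorem exists_far (hn : 1 ≤ G.n) (hp : 1 ≤ G.pads) (h : ¬ G.Hits) {c : ℕ} (hc : c < G.N) :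
    ∃ v < G.N, ∀ ℓ, G.GWalk c v ℓ ∨ G.GWalk v c ℓ → 2 * G.len ≤ ℓ := by
  have hw : G.wid = G.len + 1 := rfl
  have hX : G.X = G.rows + G.wid := rfl
  have hY : G.Y = G.X + G.d := rfl
  have hZ : G.Z = G.Y + G.rows := rfl
  have hN : G.N = G.Z + G.pads := rfl
  have hr0 := rows_le hn
  rcases lt_trichotomy c G.rows with h1 | h1 | h1
  -- A vertex of row `k` is far from the end of the row of a set that the `k`-th set misses.
  · obtain ⟨k, t, hk, ht, rfl⟩ := exists_coord h1
    have hrk := rows_le hk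
    obtain ⟨j, hj, hkj⟩ : ∃ j < G.n, ∀ u < G.d, 0 < G.a (k * G.d + u) → ¬ 0 < G.b (j * G.d + u) := by
      by_contra! hcon
      exact h ⟨k, hk, hcon⟩
    have hrj := rows_le hj
    refine ⟨G.Y + j * G.wid + G.len, by omega, fun ℓ hℓ => ?_⟩
    rcases hℓ with hℓ | hℓ
    · have h2 := le_of_potential (fun _ _ => pot_closed hk hj hkj) hℓ
      have h3 : G.pot k j (k * G.wid + t) = 0 := by
        rw [pot, if_neg (by omega), if_pos (by omega)]
      have h4 : G.pot k j (G.Y + j * G.wid + G.len) = 2 * G.len + 3 := by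
        rw [pot, if_neg (by omega), if_neg (by omega), if_neg (by omega), if_neg (by omega),
          if_neg (by omega), if_pos (by omega)]
        omega
      omega
    · have := GWalk_le hℓ
      omega
  -- From the first vertex of the extra row, a walk must traverse that whole row and then a whole
  -- row of the second list.
  · refine ⟨G.Y + G.len, by omega, fun ℓ hℓ => ?_⟩
    rcases hℓ with hℓ | hℓ
    · have h2 := le_of_potential (fun _ _ => potLast_closed) hℓ
      have h3 : G.potLast c = 0 := by
        rw [potLast, if_neg (by omega), if_pos (by omega), h1, Nat.sub_self]
      have h4 : G.potLast (G.Y + G.len) = 2 * G.len + 2 := by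
        rw [potLast, if_neg (by omega), if_neg (by omega), if_neg (by omega), if_pos (by omega),
          Nat.add_sub_cancel_left, Nat.mod_eq_of_lt (by omega)]
        omega
      omega
    · have := GWalk_le hℓ
      omega
  -- Any later vertex is incomparable to a pad, or is itself a pad and incomparable to the vertex
  -- `Y`. The jump of `potPad` exceeds `2 * len`, which is all that is needed.
  · have hZp : G.potPad G.Z = 4 * G.len + 10 := by rw [potPad, if_pos le_rfl]
    rcases lt_or_ge c G.Z with h2 | h2
    · refine ⟨G.Z, by omega, fun ℓ hℓ => ?_⟩
      rcases hℓ with hℓ | hℓ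
      · have h3 := le_of_potential (fun _ _ => potPad_closed) hℓ
        have h4 : G.potPad c = 0 := by rw [potPad, if_neg (by omega), if_neg (by omega)]
        omega
      · have := GWalk_le hℓ
        omega
    · refine ⟨G.Y, by omega, fun ℓ hℓ => ?_⟩
      rcases hℓ with hℓ | hℓ
      · have := GWalk_le hℓ
        omega
      · have h3 := le_of_potential (fun _ _ => potPad_closed) hℓ
        have h4 : G.potPad G.Y = 0 := by rw [potPad, if_neg (by omega), if_neg (by omega)]
        have h5 : G.potPad c = 4 * G.len + 10 := by rw [potPad, if_pos h2]
        omega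

theorem le_minRadius_of_not_hits (hn : 1 ≤ G.n) (hp : 1 ≤ G.pads) (h : ¬ G.Hits) :
    ((2 * G.len : ℕ) : ℕ∞) ≤ G.graph.minRadius := by
  refine le_iInf fun c => ?_
  obtain ⟨v, hv, hfar⟩ := exists_far hn hp h c.2
  have h2 : min (G.graph.dist c ⟨v, hv⟩) (G.graph.dist ⟨v, hv⟩ c) ≤ G.graph.minEcc c :=
    le_iSup (fun v => min (G.graph.dist c v) (G.graph.dist v c)) ⟨v, hv⟩
  refine le_trans (le_min ?_ ?_) h2
  · exact le_iInf₂ fun ℓ hℓ => by exact_mod_cast hfar ℓ (.inl (WDigraph.walk_ofPairs.1 hℓ))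
  · exact le_iInf₂ fun ℓ hℓ => by exact_mod_cast hfar ℓ (.inr (WDigraph.walk_ofPairs.1 hℓ))

/-- A `(2 - δ)`-approximation tells whether there is a hitting set. -/
theorem lt_iff_hits {δ : ℝ} (hq : 1 ≤ G.q) (hδ : 2 < δ * (G.q + 1)) (hn : 1 ≤ G.n) (hp : 1 ≤ G.pads)
    (hL : G.n ≤ 2 ^ G.L) (h2 : 2 ≤ G.L) {o : ℕ∞} (ho : IsApprox (2 - δ) G.graph.minRadius o) :
    o < (2 * G.len : ℕ) ↔ G.Hits := by
  constructor
  · intro h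
    by_contra hcon
    exact absurd (h.trans_le ((le_minRadius_of_not_hits hn hp hcon).trans ho.1)) (lt_irrefl _)
  · intro h
    have h1 : ((G.graph.minRadius : ℕ∞) : ENNReal) ≤ ((G.len + G.L : ℕ) : ENNReal) := by
      have := ENat.toENNReal_le.2 (minRadius_le_of_hits hL h2 h)
      simpa using this
    have h3 : (o : ENNReal) ≤ ENNReal.ofReal ((2 - δ) * (G.len + G.L : ℕ)) := by
      refine ho.2.trans ?_
      rw [ENNReal.ofReal_mul' (Nat.cast_nonneg _), ENNReal.ofReal_natCast]
      exact mul_le_mul_right h1 _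
    -- With `len = qL` this is `(2 - δ)(q + 1) L < 2qL`, that is, `2 < δ (q + 1)`.
    have h4 : ENNReal.ofReal ((2 - δ) * (G.len + G.L : ℕ)) < ((2 * G.len : ℕ) : ENNReal) := by
      rw [← ENNReal.ofReal_natCast]
      have hq' : (1 : ℝ) ≤ G.q := by exact_mod_cast hq
      have hL' : (2 : ℝ) ≤ G.L := by exact_mod_cast h2
      have hlen : (G.len : ℝ) = G.q * G.L := by simp [len]
      refine (ENNReal.ofReal_lt_ofReal_iff ?_).2 ?_
      · push_cast
        rw [hlen]
        positivity
      · push_cast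
        rw [hlen]
        nlinarith
    have h5 := h3.trans_lt h4
    rw [← ENat.toENNReal_coe] at h5
    exact ENat.toENNReal_lt.1 h5

end Gadget

/-! ## Running a program as a subroutine -/

/-- Rename the registers and the arrays of a program. -/
def Prog.shift (k : ℕ) : Prog → Prog
  | .skip => .skip
  | .const x c => .const (x + k) c
  | .op o x y z => .op o (x + k) (y + k) (z + k)
  | .load x a y => .load (x + k) (a + 1) (y + k)
  | .store a y z => .store (a + 1) (y + k) (z + k)
  | .seq p q => .seq (p.shift k) (q.shift k)
  | .cond y z p q => .cond (y + k) (z + k) (p.shift k) (q.shift k)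
  | .loop y z p => .loop (y + k) (z + k) (p.shift k)

/-- The state `S` contains a copy of `s`, in the registers from `k` on and the arrays from `1` on. -/
structure Embeds (k : ℕ) (s S : State) : Prop where
  reg : ∀ x, S.reg (x + k) = s.reg x
  arr : ∀ a, S.arr (a + 1) = s.arr a

theorem Embeds.setReg {k : ℕ} {s S : State} (h : Embeds k s S) (x v : ℕ) :
    Embeds k (s.setReg x v) (S.setReg (x + k) v) :=
  ⟨fun y => by simp [h.reg], fun a => by simp [h.arr]⟩

theorem Embeds.setArr {k : ℕ} {s S : State} (h : Embeds k s S) (a i v : ℕ) :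
    Embeds k (s.setArr a i v) (S.setArr (a + 1) i v) :=
  ⟨fun y => by simp [h.reg], fun b => by simp [h.arr]⟩

theorem Exec.shift {B k : ℕ} {P : Prog} {s s' : State} {t : ℕ} (h : Exec B P s t s') :
    ∀ S, Embeds k s S → ∃ S', Exec B (P.shift k) S t S' ∧ Embeds k s' S' ∧
      ∀ x < k, S'.reg x = S.reg x := by
  induction h with
  | skip s => exact fun S hS => ⟨S, .skip S, hS, fun _ _ => rfl⟩
  | const s x c h => exact fun S hS => ⟨_, .const S _ c h, hS.setReg _ _, fun y hy => by simp; omega⟩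
  | op s o x y z h =>
    intro S hS
    rw [← hS.reg, ← hS.reg z] at h ⊢
    exact ⟨_, .op S o _ _ _ h, hS.setReg _ _, fun y hy => by simp; omega⟩
  | load s x a y =>
    intro S hS
    rw [← hS.reg, ← hS.arr]
    exact ⟨_, .load S _ _ _, hS.setReg _ _, fun y hy => by simp; omega⟩
  | store s a y z =>
    intro S hS
    rw [← hS.reg, ← hS.reg z]
    exact ⟨_, .store S _ _ _, hS.setArr _ _ _, fun _ _ => rfl⟩
  | seq _ _ ih₁ ih₂ =>
    intro S hS
    obtain ⟨S₁, h₁, hS₁, k₁⟩ := ih₁ S hS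
    obtain ⟨S₂, h₂, hS₂, k₂⟩ := ih₂ S₁ hS₁
    exact ⟨S₂, .seq h₁ h₂, hS₂, fun x hx => (k₂ x hx).trans (k₁ x hx)⟩
  | cond_true h _ ih =>
    intro S hS
    obtain ⟨S₁, h₁, hS₁, k₁⟩ := ih S hS
    rw [← hS.reg, ← hS.reg] at h
    exact ⟨S₁, .cond_true h h₁, hS₁, k₁⟩
  | cond_false h _ ih =>
    intro S hS
    obtain ⟨S₁, h₁, hS₁, k₁⟩ := ih S hS
    rw [← hS.reg, ← hS.reg] at h
    exact ⟨S₁, .cond_false h h₁, hS₁, k₁⟩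
  | loop_done h =>
    intro S hS
    rw [← hS.reg, ← hS.reg] at h
    exact ⟨S, .loop_done h, hS, fun _ _ => rfl⟩
  | loop_step h _ _ ih₁ ih₂ =>
    intro S hS
    obtain ⟨S₁, h₁, hS₁, k₁⟩ := ih₁ S hS
    obtain ⟨S₂, h₂, hS₂, k₂⟩ := ih₂ S₁ hS₁
    rw [← hS.reg, ← hS.reg] at h
    exact ⟨S₂, .loop_step h h₁ h₂, hS₂, fun x hx => (k₂ x hx).trans (k₁ x hx)⟩

/-! ## Writing down the graph of the reduction -/

/-- Cells past the end of the list read as 0, so storing at its end is the same as appending. -/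
theorem update_getD_length (l : List ℕ) (v : ℕ) :
    Function.update (fun i => l.getD i 0) l.length v = fun i => (l ++ [v]).getD i 0 := by
  funext i
  rw [Function.update_apply]
  split_ifs with h
  · subst h
    simp
  · rcases lt_or_gt_of_ne h with h | h
    · rw [List.getD_append _ _ _ _ h]
    · rw [List.getD_eq_default _ _ (by omega), List.getD_eq_default _ _ (by simp; omega)]

namespace Gadget

/-- The registers that hold the parameters of the reduction, and the input. -/
structure Setup (G : Gadget) (s : State) : Prop where
  r10 : s.reg 10 = G.n
  r11 : s.reg 11 = G.d
  r12 : s.reg 12 = G.L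
  r13 : s.reg 13 = G.wid
  r14 : s.reg 14 = G.len
  r15 : s.reg 15 = G.rows
  r16 : s.reg 16 = G.X
  r17 : s.reg 17 = G.Y
  r18 : s.reg 18 = G.Z
  r19 : s.reg 19 = G.pads
  r20 : s.reg 20 = 1
  r21 : s.reg 21 = 0
  r22 : s.reg 22 = G.rows * G.L
  r23 : s.reg 23 = G.n * G.d
  r24 : s.reg 24 = G.rows + G.len
  r25 : s.reg 25 = 2
  r26 : s.reg 26 = G.n * G.d + 2
  r27 : s.reg 27 = 2 * G.len
  a : ∀ i, s.arr 0 (i + 2) = G.a i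
  b : ∀ i, s.arr 0 (i + (G.n * G.d + 2)) = G.b i

theorem Setup.congr {G : Gadget} {s s' : State} (h : G.Setup s) (hr : ∀ x < 40, s'.reg x = s.reg x)
    (ha : s'.arr 0 = s.arr 0) : G.Setup s' := by
  constructor <;> first
    | (rw [hr _ (by norm_num)]; first
      | exact h.r10 | exact h.r11 | exact h.r12 | exact h.r13 | exact h.r14 | exact h.r15
      | exact h.r16 | exact h.r17 | exact h.r18 | exact h.r19 | exact h.r20 | exact h.r21
      | exact h.r22 | exact h.r23 | exact h.r24 | exact h.r25 | exact h.r26 | exact h.r27)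
    | (rw [ha]; first | exact h.a | exact h.b)

/-- The array `1` holds the encoding of the edges `es`, except for their number. -/
structure Out (G : Gadget) (es : List (ℕ × ℕ)) (s : State) : Prop where
  arr : s.arr 1 = fun i => (G.N :: 0 :: es.flatMap fun e => [e.1, e.2, 1]).getD i 0
  ptr : s.reg 51 = 3 * es.length + 2
  cnt : s.reg 52 = es.length

def push : Prog := .block [.store 1 51 42, .op .add 51 51 20, .store 1 51 43, .op .add 51 51 20,
  .store 1 51 20, .op .add 51 51 20, .op .add 52 52 20]

theorem push_wp {G : Gadget} {B : ℕ} {es : List (ℕ × ℕ)} {s : State} (h : G.Out es s)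
    (h20 : s.reg 20 = 1) (hB : 3 * es.length + 10 ≤ B) {t : ℕ} {K : State → ℕ → Prop}
    (hK : ∀ s', Same push s s' → G.Out (es ++ [(s.reg 42, s.reg 43)]) s' → K s' (t + 7)) :
    wp B push K s t := by
  have hlen : (G.N :: 0 :: es.flatMap fun e => [e.1, e.2, 1]).length = 3 * es.length + 2 := by
    simp [List.length_flatMap, mul_comm]
  have hw : wp B push (fun s' t' => t' = 0 + 7 ∧ G.Out (es ++ [(s.reg 42, s.reg 43)]) s') s 0 := by
    have h51 := h.ptr
    have h52 := h.cnt
    simp only [push, Prog.block, wp, BinOp.eval]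
    simp [h51, h52, h20]
    refine ⟨by omega, by omega, by omega, by omega, ?_, by simp; omega, by simp⟩
    simp only [State.setArr_arr, State.setReg_arr, if_true]
    rw [h.arr]
    generalize hl : (G.N :: 0 :: es.flatMap fun e => [e.1, e.2, 1]) = l at hlen
    rw [← hlen, update_getD_length, show l.length + 1 = (l ++ [s.reg 42]).length by simp,
      update_getD_length, show (l ++ [s.reg 42]).length + 1 = (l ++ [s.reg 42] ++ [s.reg 43]).length by simp,
      update_getD_length, ← hl]
    simp
  obtain ⟨t', s', he, ht', hQ⟩ := wp_sound hw
  refine wp_of_exec he ?_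
  rw [show t' = 7 by omega]
  exact hK s' he.same hQ

/-- `(z, c)` computes the family `F`: register `z` holds the number of candidates, and `c`
computes the `i`-th candidate. -/
structure Computes (G : Gadget) (B : ℕ) (z : ℕ) (c : Prog) (F : EdgeFam) : Prop where
  z_lt : z < 40
  wregs : ∀ x ∈ c.wregs, 40 ≤ x ∧ x < 50
  warrs : c.warrs = []
  count : ∀ s, G.Setup s → s.reg z = F.count
  step : ∀ s i, G.Setup s → s.reg 50 = i → i < F.count → wp B c (fun s' t => t ≤ 10 ∧
    s'.reg 40 = F.x i ∧ s'.reg 41 = F.y i ∧ s'.reg 42 = F.src i ∧ s'.reg 43 = F.dst i) s 0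

def emitBody (c : Prog) : Prog := .block [c, .cond 40 41 push .skip, .op .add 50 50 20]

def emit (z : ℕ) (c : Prog) : Prog := .seq (.const 50 0) (.loop 50 z (emitBody c))

/-- The first `i` candidates. -/
def _root_.MinRad.EdgeFam.pre (F : EdgeFam) (i : ℕ) : List (ℕ × ℕ) :=
  ((List.range i).filter fun i => F.x i < F.y i).map fun i => (F.src i, F.dst i)

theorem _root_.MinRad.EdgeFam.pre_succ (F : EdgeFam) (i : ℕ) :
    F.pre (i + 1) = F.pre i ++ if F.x i < F.y i then [(F.src i, F.dst i)] else [] := by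
  rw [EdgeFam.pre, List.range_succ, List.filter_append, List.map_append]
  congr 1
  by_cases h : F.x i < F.y i <;> simp [h]

theorem _root_.MinRad.EdgeFam.length_pre_le (F : EdgeFam) (i : ℕ) : (F.pre i).length ≤ i := by
  rw [EdgeFam.pre, List.length_map]
  simpa using List.length_filter_le (fun i => decide (F.x i < F.y i)) (List.range i)

theorem emit_runs {G : Gadget} {B z : ℕ} {c : Prog} {F : EdgeFam} (hc : G.Computes B z c F)
    {es : List (ℕ × ℕ)} {s : State} (hs : G.Setup s) (ho : G.Out es s)
    (hB : 3 * (es.length + F.count) + 10 ≤ B) :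
    Runs B (emit z c) s (F.count * 30 + 10) fun s' => G.Setup s' ∧ G.Out (es ++ F.list) s' := by
  have hz := hc.z_lt
  have hwr : ∀ x < 40, x ∉ (emit z c).wregs := by
    intro x hx hmem
    have h1 : (emit z c).wregs = [50] ++ (c.wregs ++ ([51, 51, 51, 52] ++ [] ++ [50])) := rfl
    rw [h1] at hmem
    simp only [List.mem_append, List.mem_cons, List.not_mem_nil, or_false] at hmem
    rcases hmem with h | h | h | h
    · omega
    · exact absurd (hc.wregs x h).1 (by omega)
    · omega
    · omega
  have hwa : 0 ∉ (emit z c).warrs := by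
    have h1 : (emit z c).warrs = [] ++ (c.warrs ++ ([1, 1, 1] ++ [] ++ [])) := rfl
    rw [h1, hc.warrs]
    simp
  apply Runs.of_wp
  have hsetup : ∀ {s'}, Same (emit z c) s s' → G.Setup s' := fun h =>
    hs.congr (fun x hx => h.reg x (hwr x hx)) (h.arr 0 hwa)
  rw [emit, wp_seq, wp_const]
  refine ⟨by omega, ?_⟩
  have hsame : ∀ {s'}, Same (emitBody c) (s.setReg 50 0) s' → Same (emit z c) s s' := by
    intro s' h
    have h1 : (emit z c).wregs = [50] ++ (emitBody c).wregs := rfl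
    refine ⟨fun x hx => ?_, fun a ha => h.arr a ha⟩
    rw [h1, List.mem_append, not_or, List.mem_singleton] at hx
    rw [h.reg x hx.2, State.setReg_reg, if_neg hx.1]
  refine Runs.wp (T := F.count * (29 + 1) + 1) (Runs.for (N := F.count)
    (I := fun i s' => s'.reg 50 = i ∧ G.Out (es ++ F.pre i) s') ?_ ?_ ?_) ?_
  · refine ⟨by simp, ⟨?_, ?_, ?_⟩⟩
    · simpa [EdgeFam.pre] using ho.arr
    · simpa [EdgeFam.pre] using ho.ptr
    · simpa [EdgeFam.pre] using ho.cnt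
  · intro i s' h hI
    rw [hI.1, hc.count s' (hsetup (hsame h))]
  · rintro i s' h hi ⟨h50, hout⟩
    have hst := hsetup (hsame h)
    obtain ⟨t₁, s₁, he₁, ht₁, h40, h41, h42, h43⟩ := wp_sound (hc.step s' i hst h50 hi)
    have hs₁ := he₁.same
    have hreg : ∀ x, x < 40 ∨ 50 ≤ x → s₁.reg x = s'.reg x := fun x hx =>
      hs₁.reg x fun hmem => by have := hc.wregs x hmem; omega
    have hout₁ : G.Out (es ++ F.pre i) s₁ := by
      refine ⟨?_, ?_, ?_⟩
      · rw [hs₁.arr 1 (by simp [hc.warrs])]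
        exact hout.arr
      · rw [hreg _ (by norm_num)]
        exact hout.ptr
      · rw [hreg _ (by norm_num)]
        exact hout.cnt
    have hst₁ : G.Setup s₁ := hst.congr (fun x hx => hreg x (.inl hx)) (hs₁.arr 0 (by simp [hc.warrs]))
    have hlen := F.length_pre_le i
    have h50₁ : s₁.reg 50 = i := (hreg 50 (by norm_num)).trans h50
    simp only [emitBody, Prog.block, wp_seq]
    refine wp_of_exec he₁ ?_
    rw [wp_seq, wp_cond, h40, h41]
    refine ⟨fun hlt => ?_, fun hlt => ?_⟩
    · refine push_wp hout₁ hst₁.r20 (by simp; omega) fun s₂ hs₂ ho₂ => ?_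
      have h20 : s₂.reg 20 = 1 := (hs₂.reg 20 (by decide)).trans hst₁.r20
      have h50₂ : s₂.reg 50 = i := (hs₂.reg 50 (by decide)).trans h50₁
      rw [wp_op, BinOp.eval, h20, h50₂]
      refine ⟨by omega, by omega, by simp, ?_⟩
      rw [h42, h43] at ho₂
      rw [F.pre_succ, if_pos hlt, ← List.append_assoc]
      exact ⟨ho₂.arr, by simpa using ho₂.ptr, by simpa using ho₂.cnt⟩
    · rw [wp_skip, wp_op, BinOp.eval, hst₁.r20, h50₁]
      refine ⟨by omega, by omega, by simp, ?_⟩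
      rw [F.pre_succ, if_neg hlt, List.append_nil]
      exact ⟨hout₁.arr, by simpa using hout₁.ptr, by simpa using hout₁.cnt⟩
  · rintro s' t' h ⟨-, hout⟩ ht
    exact ⟨by omega, hsetup (hsame ⟨h.reg, h.arr⟩), hout⟩

def emitAll : List (ℕ × Prog) → Prog
  | [] => .skip
  | (z, c) :: l => .seq (emit z c) (emitAll l)

theorem emitAll_runs {G : Gadget} {B : ℕ} {cs : List (ℕ × Prog)} {Fs : List EdgeFam}
    (hc : List.Forall₂ (fun zc F => G.Computes B zc.1 zc.2 F) cs Fs) :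
    ∀ {es : List (ℕ × ℕ)} {s : State}, G.Setup s → G.Out es s →
    3 * (es.length + (Fs.map EdgeFam.count).sum) + 10 ≤ B →
    Runs B (emitAll cs) s ((Fs.map EdgeFam.count).sum * 30 + cs.length * 10 + 1) fun s' =>
      G.Setup s' ∧ G.Out (es ++ Fs.flatMap EdgeFam.list) s' := by
  induction hc with
  | nil =>
    intro es s hs ho hB
    exact ⟨1, s, .skip s, by simp, hs, by simpa⟩
  | @cons zc F cs Fs h _ ih =>
    intro es s hs ho hB
    rw [List.map_cons, List.sum_cons] at hB ⊢
    have hl := F.length_list_le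
    have h1 := (emit_runs h hs ho (by omega)).seq (P' := emitAll cs) (fun s' _ hQ => ih hQ.1 hQ.2
      (by rw [List.length_append]; omega))
    refine h1.imp (by rw [List.length_cons]; omega) fun s' _ hQ => ⟨hQ.1, ?_⟩
    rw [List.flatMap_cons, ← List.append_assoc]
    exact hQ.2

/-- The numbers that occur in the reduction fit into a word. -/
structure Fits (G : Gadget) (B : ℕ) : Prop where
  N : 2 * G.N + 10 ≤ B
  hop : (G.n + 2 ^ G.L) * G.wid ≤ B
  rows : G.rows * G.L ≤ B
  nd : 2 * (G.n * G.d) + 2 ≤ B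
  edges : 3 * (G.fams.map EdgeFam.count).sum + 10 ≤ B

def code₁ : Prog := .block [.op .mod 40 50 13, .mov 41 14, .mov 42 50, .op .add 43 50 20]

def code₂ : Prog := .block [.op .div 42 50 12, .op .mod 44 50 12, .op .shl 44 20 44,
  .op .div 45 42 13, .op .add 40 45 44, .mov 41 10, .op .mul 43 40 13]

def code₃ : Prog := .block [.mov 40 21, .mov 41 20, .op .mul 42 50 13, .op .add 42 42 14, .mov 43 15]

def code₄ : Prog := .block [.mov 40 21, .mov 41 20, .mov 42 24, .op .add 43 16 50]

def code₅ : Prog := .block [.mov 40 21, .op .add 44 50 25, .load 41 0 44, .op .div 42 50 11,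
  .op .mul 42 42 13, .op .add 42 42 14, .op .mod 43 50 11, .op .add 43 16 43]

def code₆ : Prog := .block [.mov 40 21, .op .add 44 50 26, .load 41 0 44, .op .mod 42 50 11,
  .op .add 42 16 42, .op .div 43 50 11, .op .mul 43 43 13, .op .add 43 17 43]

def code₇ : Prog := .block [.op .mod 40 50 13, .mov 41 14, .op .add 42 17 50, .op .add 43 42 20]

def code₈ : Prog := .block [.mov 40 21, .mov 41 20, .mov 42 15, .op .add 43 18 50]

def codes : List (ℕ × Prog) := [(16, code₁), (22, code₂), (10, code₃), (11, code₄), (23, code₅),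
  (23, code₆), (15, code₇), (19, code₈)]

theorem computes_codes {G : Gadget} {B : ℕ} (hB : G.Fits B) :
    List.Forall₂ (fun zc F => G.Computes B zc.1 zc.2 F) codes G.fams := by
  have hw : G.wid = G.len + 1 := rfl
  have hX : G.X = G.rows + G.wid := rfl
  have hY : G.Y = G.X + G.d := rfl
  have hZ : G.Z = G.Y + G.rows := rfl
  have hN : G.N = G.Z + G.pads := rfl
  have hBN := hB.N
  have hnd := hB.nd
  have hnX := G.n_le_X
  have hdiv : ∀ {i}, i < G.n * G.d → i / G.d < G.n := fun hi =>
    Nat.div_lt_of_lt_mul (by rwa [mul_comm])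
  have hmod : ∀ {i}, i < G.n * G.d → i % G.d < G.d := fun {i} hi =>
    Nat.mod_lt _ (Nat.pos_of_ne_zero fun h => by simp [h] at hi)
  refine .cons ⟨by norm_num, by decide, rfl, fun s h => h.r16, ?_⟩ <|
    .cons ⟨by norm_num, by decide, rfl, fun s h => h.r22, ?_⟩ <|
    .cons ⟨by norm_num, by decide, rfl, fun s h => h.r10, ?_⟩ <|
    .cons ⟨by norm_num, by decide, rfl, fun s h => h.r11, ?_⟩ <|
    .cons ⟨by norm_num, by decide, rfl, fun s h => h.r23, ?_⟩ <|
    .cons ⟨by norm_num, by decide, rfl, fun s h => h.r23, ?_⟩ <|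
    .cons ⟨by norm_num, by decide, rfl, fun s h => h.r15, ?_⟩ <|
    .cons ⟨by norm_num, by decide, rfl, fun s h => h.r19, ?_⟩ .nil
  all_goals intro s i h h50 hi
  · simp only [fam₁] at *
    have := Nat.mod_lt i G.wid_pos
    simp [code₁, Prog.block, wp, BinOp.eval, h50, h.r13, h.r14, h.r20]
    omega
  · simp only [fam₂] at *
    have hL : 0 < G.L := Nat.pos_of_ne_zero fun h => by simp [h] at hi
    have h1 : i / G.L < G.rows := Nat.div_lt_of_lt_mul (by rwa [mul_comm])
    have h2 : i / G.L / G.wid < G.n := Nat.div_lt_of_lt_mul (by rwa [mul_comm])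
    have h3 : 2 ^ (i % G.L) ≤ 2 ^ G.L := Nat.pow_le_pow_right (by norm_num) (Nat.mod_lt _ hL).le
    have h4 : (i / G.L / G.wid + 2 ^ (i % G.L)) * G.wid ≤ (G.n + 2 ^ G.L) * G.wid :=
      Nat.mul_le_mul_right _ (by omega)
    have h5 : i / G.L / G.wid + 2 ^ (i % G.L) ≤ (i / G.L / G.wid + 2 ^ (i % G.L)) * G.wid :=
      Nat.le_mul_of_pos_right _ G.wid_pos
    have h6 := hB.hop
    have h7 := hB.rows
    have h8 := Nat.mod_le i G.L
    have h9 : 2 ^ (i % G.L) ≤ i / G.L / G.wid + 2 ^ (i % G.L) := Nat.le_add_left _ _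
    have h10 := Nat.div_le_self i G.L
    have h11 := Nat.div_le_self (i / G.L) G.wid
    simp [code₂, Prog.block, wp, BinOp.eval, h50, h.r12, h.r20, h.r13, h.r10, Nat.one_shiftLeft]
    omega
  · simp only [fam₃] at *
    have h1 := rows_le hi
    simp [code₃, Prog.block, wp, BinOp.eval, h50, h.r13, h.r14, h.r15, h.r20, h.r21]
    omega
  · simp only [fam₄] at *
    simp [code₄, Prog.block, wp, BinOp.eval, h50, h.r16, h.r24, h.r20, h.r21]
    omega
  · simp only [fam₅] at *
    have h1 := rows_le (hdiv hi)
    have h2 := hmod hi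
    have h3 := Nat.div_le_self i G.d
    simp [code₅, Prog.block, wp, BinOp.eval, h50, h.r11, h.r13, h.r14, h.r16, h.r21, h.r25, h.a]
    omega
  · simp only [fam₆] at *
    have h1 := rows_le (hdiv hi)
    have h2 := hmod hi
    have h3 := Nat.div_le_self i G.d
    simp [code₆, Prog.block, wp, BinOp.eval, h50, h.r11, h.r13, h.r16, h.r17, h.r21, h.r26, h.b]
    omega
  · simp only [fam₇] at *
    have := Nat.mod_lt i G.wid_pos
    simp [code₇, Prog.block, wp, BinOp.eval, h50, h.r13, h.r14, h.r17, h.r20]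
    omega
  · simp only [fam₈] at *
    simp [code₈, Prog.block, wp, BinOp.eval, h50, h.r15, h.r18, h.r20, h.r21]
    omega

/-! ### The parameters -/

/-- `L` is about `log n`. -/
structure IsLog (n L : ℕ) : Prop where
  two_le : 2 ≤ L
  le_pow : n ≤ 2 ^ L
  pow_le : 2 ^ L ≤ 4 * n

def logProg : Prog := .block [.const 12 2, .const 30 4,
  .loop 30 10 (.block [.op .add 30 30 30, .op .add 12 12 20])]

theorem logProg_runs {B n : ℕ} {s : State} (hn : 1 ≤ n) (h10 : s.reg 10 = n) (h20 : s.reg 20 = 1)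
    (hB : 2 * n + 4 ≤ B) :
    Runs B logProg s (n * 10 + 10) fun s' => IsLog n (s'.reg 12) := by
  apply Runs.of_wp
  simp only [logProg, Prog.block, wp_seq, wp_const]
  refine ⟨by omega, by omega, ?_⟩
  refine Runs.wp (T := n * (9 + 1) + 1) (Runs.loop (N := n) (I := fun i s' => s'.reg 12 = i + 2 ∧
    s'.reg 30 = 2 ^ (i + 2) ∧ 2 ^ (i + 2) ≤ 4 * n) ?_ ?_) ?_
  · simp; omega
  · rintro i s' hs ⟨h12, h30, hi⟩ hlt
    have h10' := hs.reg 10 (by decide)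
    have h20' := hs.reg 20 (by decide)
    simp [h10] at h10'
    simp [h20] at h20'
    rw [h30, h10'] at hlt
    have h1 : i + 2 < 2 ^ (i + 2) := Nat.lt_two_pow_self
    have h2 : 2 ^ (i + 1 + 2) = 2 ^ (i + 2) + 2 ^ (i + 2) := by ring
    refine ⟨by omega, ?_⟩
    simp [wp, BinOp.eval, h12, h30, h20', h2]
    omega
  · rintro s' t' hs ⟨i, hi, ⟨h12, h30, hi'⟩, hge⟩ ht
    have h10' := hs.reg 10 (by decide)
    simp [h10] at h10'
    rw [h30, h10'] at hge
    exact ⟨by omega, by rw [h12]; omega, by rw [h12]; omega, by rw [h12]; exact hi'⟩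

/-- Compute the parameters of the reduction. -/
def setupProg (q g : ℕ) : Prog := .block [.const 20 1, .load 10 0 21, .load 11 0 20, .const 25 2,
  logProg, .const 31 q, .op .mul 14 31 12, .op .add 13 14 20, .op .mul 15 10 13, .op .add 16 15 13,
  .op .add 17 16 11, .op .add 18 17 15, .const 31 g, .const 32 4, .op .mul 33 25 11,
  .op .add 33 12 33, .op .add 33 33 32, .op .mul 33 16 33, .op .mul 19 31 33, .op .mul 22 15 12,
  .op .mul 23 10 11, .op .add 24 15 14, .op .add 26 23 25, .op .mul 27 25 14, .op .add 34 18 19,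
  .store 1 21 34, .mov 51 25]

/-- The gadget for the input `x`. -/
def ofInput (q g n d L : ℕ) (x : ℕ → ℕ) : Gadget :=
  ⟨n, d, q, g, L, fun i => x (i + 2), fun i => x (i + (n * d + 2))⟩

theorem setupProg_runs {q g n d B : ℕ} {x : List ℕ} (hg : 1 ≤ g) (hn : 1 ≤ n) (hx0 : x.getD 0 0 = n)
    (hx1 : x.getD 1 0 = d) (hqB : q ≤ B)
    (hB : ∀ L, IsLog n L → Fits (ofInput q g n d L (fun i => x.getD i 0)) B) :
    Runs B (setupProg q g) (initState x) (n * 10 + 40) fun s' => ∃ L, IsLog n L ∧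
      (ofInput q g n d L (fun i => x.getD i 0)).Setup s' ∧
      (ofInput q g n d L (fun i => x.getD i 0)).Out [] s' := by
  rw [List.getD_eq_getElem?_getD] at hx0 hx1
  -- Existence is obtained by running `logProg` once in an auxiliary state; it is needed early, to
  -- know that `n` fits into a word.
  obtain ⟨L₀, hL₀⟩ : ∃ L, IsLog n L := by
    obtain ⟨t, s, -, -, h⟩ := logProg_runs (B := 2 * n + 4) (n := n)
      (s := ((initState []).setReg 10 n).setReg 20 1) hn (by simp) (by simp) le_rfl
    exact ⟨_, h⟩
  have hN₀ := (hB L₀ hL₀).N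
  have hnN : n ≤ (ofInput q g n d L₀ (fun i => x.getD i 0)).N := by
    refine ((ofInput q g n d L₀ (fun i => x.getD i 0)).n_le_X).trans ?_
    rw [N, Z, Y]
    omega
  apply Runs.of_wp
  simp only [setupProg, Prog.block, wp_seq, wp_const, wp_load]
  refine ⟨by omega, by omega, ?_⟩
  refine (logProg_runs hn (by simp [initState, hx0]) (by simp) (by omega)).wp fun s t hs hL ht => ?_
  have h10 : s.reg 10 = n := by simpa [initState, hx0] using hs.reg 10 (by decide)
  have h11 : s.reg 11 = d := by simpa [initState, hx1] using hs.reg 11 (by decide)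
  have h20 : s.reg 20 = 1 := by simpa [initState] using hs.reg 20 (by decide)
  have h21 : s.reg 21 = 0 := by simpa [initState] using hs.reg 21 (by decide)
  have h52 : s.reg 52 = 0 := by simpa [initState] using hs.reg 52 (by decide)
  have h25 : s.reg 25 = 2 := by simpa [initState] using hs.reg 25 (by decide)
  have ha0 : s.arr 0 = fun i => x.getD i 0 := by
    rw [hs.arr 0 (by decide)]
    funext i
    simp [initState]
  have ha1 : s.arr 1 = fun _ => 0 := by
    rw [hs.arr 1 (by decide)]
    funext i
    simp [initState]
  set L := s.reg 12 with hLdef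
  have hF := hB L hL
  generalize hG : ofInput q g n d L (fun i => x.getD i 0) = G at hF
  have hGn : G.n = n := by rw [← hG]; rfl
  have hGd : G.d = d := by rw [← hG]; rfl
  have hGq : G.q = q := by rw [← hG]; rfl
  have hGg : G.g = g := by rw [← hG]; rfl
  have hGL : G.L = L := by rw [← hG]; rfl
  have hGa : G.a = fun i => x.getD (i + 2) 0 := by rw [← hG]; rfl
  have hGb : G.b = fun i => x.getD (i + (n * d + 2)) 0 := by rw [← hG]; rfl
  have hlen : q * L = G.len := by rw [len, hGq, hGL]
  have hw : G.len + 1 = G.wid := rfl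
  have hrows : n * G.wid = G.rows := by rw [rows, hGn]
  have hX : G.rows + G.wid = G.X := rfl
  have hY : G.X + d = G.Y := by rw [Y, hGd]
  have hZ : G.Y + G.rows = G.Z := rfl
  have hpads : g * (G.X * (L + 2 * d + 4)) = G.pads := by rw [pads, hGg, hGL, hGd]
  have hN : G.Z + G.pads = G.N := rfl
  have hBN := hF.N
  have hBr := hF.rows
  have hBnd := hF.nd
  rw [hGL] at hBr
  rw [hGn, hGd] at hBnd
  have h3 : G.X * (L + 2 * d + 4) ≤ G.pads := hpads ▸ Nat.le_mul_of_pos_left _ hg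
  have h4 : L + 2 * d + 4 ≤ G.X * (L + 2 * d + 4) := Nat.le_mul_of_pos_left _ (by omega)
  have h5 : g ≤ G.pads := hpads ▸ Nat.le_mul_of_pos_right _ (by omega)
  simp only [wp, Prog.mov, BinOp.eval]
  simp [h10, h11, h20, h21, h25, ← hLdef, hlen, hw, hrows, hX, hY, hZ, hpads, hN]
  refine ⟨by omega, by omega, by omega, by omega, by omega, by omega, by omega, by omega, by omega,
    by omega, by omega, by omega, by omega, by omega, by omega, by omega, by omega, by omega, by omega,
    by omega, by omega, by omega, L, hL, ?_⟩
  simp only [List.getD_eq_getElem?_getD] at hG hGa hGb ha0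
  rw [hG]
  refine ⟨?_, ?_⟩
  · constructor <;> simp [h10, h11, h20, h21, h25, ← hLdef, hGn, hGd, hGL, hGa, hGb, ha0]
  · refine ⟨?_, by simp, by simp [h52]⟩
    simp [ha1]
    funext i
    rcases i with _ | _ | i <;> simp

/-- Registers `60` and `61` are the output registers of the embedded algorithm and register `27`
holds `2 * len`; the output `∞` leads to the answer "no". -/
def answer : Prog := .seq (.const 0 0) (.cond 0 60 (.cond 61 27 (.const 0 1) .skip) .skip)

/-- The decision algorithm that is obtained from an approximation algorithm `P`. -/
def decideProg (P : Prog) (q g : ℕ) : Prog :=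
  .block [setupProg q g, emitAll codes, .store 1 20 52, P.shift 60, answer]

end Gadget

/-! ### The encoding of the two lists of sets -/

theorem getD_encodeSets {n d : ℕ} (A : Fin n → Finset (Fin d)) (k : Fin n) (u : Fin d) :
    (encodeSets A).getD (k * d + u) 0 = if u ∈ A k then 1 else 0 := by
  have h : encodeSets A =
      List.ofFn fun i : Fin (n * d) => if i.modNat ∈ A i.divNat then 1 else 0 := by
    rw [List.ofFn_mul, encodeSets]
    congr 2
    funext i
    congr 1
    funext j
    congr 2
    · congr 1
      exact Fin.ext (mul_add_div' j.2).symm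
    · exact Fin.ext (mul_add_mod' j.2).symm
  have hlt : k * d + u < n * d := mul_add_lt k.2 u.2
  rw [h, List.getD_eq_getElem _ _ (by simpa using hlt), List.getElem_ofFn]
  congr 2
  · congr 1
    exact Fin.ext (mul_add_div' u.2)
  · exact Fin.ext (mul_add_mod' u.2)

theorem length_encodeSets {n d : ℕ} (A : Fin n → Finset (Fin d)) : (encodeSets A).length = n * d := by
  simp [encodeSets, List.length_flatten, Function.comp_def]

theorem hits_iff_hasHittingSet {n d q g L : ℕ} (A B : Fin n → Finset (Fin d)) :
    (Gadget.ofInput q g n d L fun i => (encodeHSE A B).getD i 0).Hits ↔ HasHittingSet A B := by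
  have ha : ∀ (k : Fin n) (u : Fin d),
      0 < (encodeHSE A B).getD (k * d + u + 2) 0 ↔ u ∈ A k := by
    intro k u
    have h : (encodeHSE A B).getD (k * d + u + 2) 0 = (encodeSets A).getD (k * d + u) 0 := by
      rw [encodeHSE, List.getD_cons_succ, List.getD_cons_succ, List.getD_append]
      rw [length_encodeSets]
      exact mul_add_lt k.2 u.2
    rw [h, getD_encodeSets]
    split_ifs with h <;> simp [h]
  have hb : ∀ (k : Fin n) (u : Fin d),
      0 < (encodeHSE A B).getD (k * d + u + (n * d + 2)) 0 ↔ u ∈ B k := by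
    intro k u
    have h : (encodeHSE A B).getD (k * d + u + (n * d + 2)) 0 = (encodeSets B).getD (k * d + u) 0 := by
      rw [encodeHSE, ← add_assoc, List.getD_cons_succ, List.getD_cons_succ, List.getD_append_right,
        length_encodeSets, Nat.add_sub_cancel]
      rw [length_encodeSets]
      omega
    rw [h, getD_encodeSets]
    split_ifs with h <;> simp [h]
  constructor
  · rintro ⟨k, hk, h⟩
    refine ⟨⟨k, hk⟩, fun j => ?_⟩
    obtain ⟨u, hu, h1, h2⟩ := h j j.2
    exact ⟨⟨u, hu⟩, Finset.mem_inter.2 ⟨(ha ⟨k, hk⟩ ⟨u, hu⟩).1 h1, (hb j ⟨u, hu⟩).1 h2⟩⟩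
  · rintro ⟨k, h⟩
    refine ⟨k, k.2, fun j hj => ?_⟩
    obtain ⟨u, hu⟩ := h ⟨j, hj⟩
    rw [Finset.mem_inter] at hu
    exact ⟨u, u.2, (ha k u).2 hu.1, (hb ⟨j, hj⟩ u).2 hu.2⟩

/-! ### The decision algorithm -/

namespace Gadget

theorem answer_runs {B v : ℕ} {s : State} {o : ℕ∞} (hB : 1 ≤ B) (h27 : s.reg 27 = v)
    (ho : o = if s.reg 60 = 0 then ⊤ else (s.reg 61 : ℕ∞)) :
    Runs B answer s 5 fun s' => s'.Decides (o < v) := by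
  apply Runs.of_wp
  simp only [answer, wp, State.setReg_reg]
  simp only [State.Decides]
  have h0 : (60 : ℕ) ≠ 0 := by norm_num
  have h1 : (61 : ℕ) ≠ 0 := by norm_num
  have h2 : (27 : ℕ) ≠ 0 := by norm_num
  simp only [if_true, if_neg h0, if_neg h1, if_neg h2, h27]
  refine ⟨by omega, fun h => ?_, fun h => ?_⟩
  · rw [if_neg (by omega)] at ho
    rw [ho, Nat.cast_lt]
    exact ⟨fun h' => ⟨hB, by omega, by simp, fun h'' => absurd h' h''⟩,
      fun h' => ⟨by omega, fun h'' => absurd h'' h', by simp⟩⟩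
  · rw [if_pos (by omega)] at ho
    rw [ho]
    exact ⟨by omega, fun h' => absurd h' (not_lt.2 le_top), by simp⟩

theorem decideProg_runs {P : Prog} {q g n d B : ℕ} {δ : ℝ} {x : List ℕ} {T : ℕ → ℕ} (hg : 1 ≤ g)
    (hn : 1 ≤ n) (hq : 1 ≤ q) (hδ : 2 < δ * (q + 1)) (hx0 : x.getD 0 0 = n) (hx1 : x.getD 1 0 = d)
    (hqB : q ≤ B) (hB : ∀ L, IsLog n L → Fits (ofInput q g n d L fun i => x.getD i 0) B)
    (hP : ∀ L, IsLog n L →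
      Runs B P (initState (ofInput q g n d L fun i => x.getD i 0).graph.encode) (T L) fun s =>
        IsApprox (2 - δ) (ofInput q g n d L fun i => x.getD i 0).graph.minRadius s.output) :
    ∃ L, IsLog n L ∧ Runs B (decideProg P q g) (initState x) (n * 10 +
      ((ofInput q g n d L fun i => x.getD i 0).fams.map EdgeFam.count).sum * 30 + T L + 200) fun s =>
      s.Decides (ofInput q g n d L fun i => x.getD i 0).Hits := by
  obtain ⟨t₁, s₁, he₁, ht₁, L, hL, hst₁, hout₁⟩ := setupProg_runs hg hn hx0 hx1 hqB hB
  refine ⟨L, hL, ?_⟩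
  have hF := hB L hL
  have hPL := hP L hL
  have hGn : (ofInput q g n d L fun i => x.getD i 0).n = n := rfl
  have hGL : (ofInput q g n d L fun i => x.getD i 0).L = L := rfl
  have hGq : (ofInput q g n d L fun i => x.getD i 0).q = q := rfl
  have hGg : (ofInput q g n d L fun i => x.getD i 0).g = g := rfl
  generalize ofInput q g n d L (fun i => x.getD i 0) = G at *
  have hBN := hF.N
  obtain ⟨t₂, s₂, he₂, ht₂, hst₂, hout₂⟩ := emitAll_runs (computes_codes hF) hst₁ hout₁
    (by have := hF.edges; simp only [List.length_nil]; omega)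
  rw [List.nil_append] at hout₂
  have he₃ := Exec.store (B := B) s₂ 1 20 52
  obtain ⟨t₄, s₄, he₄, ht₄, happ⟩ := hPL
  -- The construction only wrote registers below 60 and array 1, so the renamed program finds zeros
  -- everywhere except for the encoded graph, whose edge count the preceding store has just filled
  -- in.
  have hemb : Embeds 60 (initState G.graph.encode) (s₂.setArr 1 (s₂.reg 20) (s₂.reg 52)) := by
    refine ⟨fun y => ?_, fun a => ?_⟩
    · have h1 : ∀ y ∈ (setupProg q g).wregs, y < 60 := by
        have : (setupProg q g).wregs = (setupProg 0 0).wregs := rfl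
        rw [this]
        decide
      have h2 : ∀ y ∈ (emitAll codes).wregs, y < 60 := by decide
      rw [State.setArr_reg, he₂.same.reg _ fun h => absurd (h2 _ h) (by omega),
        he₁.same.reg _ fun h => absurd (h1 _ h) (by omega)]
      rfl
    · rw [State.setArr_arr]
      split_ifs with h
      · obtain rfl : a = 0 := by omega
        rw [hst₂.r20, hout₂.cnt, hout₂.arr, encode_graph]
        funext i
        rw [Function.update_apply]
        rcases i with _ | _ | i
        · simp [initState]
        · simp [initState, edges]
        · simp [initState, edges]
      · have h1 : ∀ y ∈ (setupProg q g).warrs, y = 1 := by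
          have : (setupProg q g).warrs = (setupProg 0 0).warrs := rfl
          rw [this]
          decide
        have h2 : ∀ y ∈ (emitAll codes).warrs, y = 1 := by decide
        rw [he₂.same.arr _ fun h' => h (h2 _ h'), he₁.same.arr _ fun h' => h (h1 _ h')]
        funext i
        have : a ≠ 0 := by omega
        simp [initState, this]
  obtain ⟨s₅, he₅, hemb₅, hreg₅⟩ := he₄.shift _ hemb
  have h27 : s₅.reg 27 = 2 * G.len := by
    rw [hreg₅ 27 (by norm_num)]
    exact hst₂.r27
  obtain ⟨t₆, s₆, he₆, ht₆, hdec⟩ := answer_runs (B := B) (s := s₅) (by omega) h27 (o := s₄.output) (by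
    rw [State.output]
    have h60 := hemb₅.reg 0
    have h61 := hemb₅.reg 1
    rw [zero_add] at h60
    rw [← h60, ← h61])
  refine ⟨_, s₆, .seq he₁ (.seq he₂ (.seq he₃ (.seq he₅ he₆))), ?_, ?_⟩
  · have h1 : codes.length = 8 := rfl
    omega
  · have hp : 1 ≤ G.pads := by
      rw [pads]
      exact Nat.mul_pos (by omega) (Nat.mul_pos (by rw [X]; have := G.wid_pos; omega) (by omega))
    have := lt_iff_hits (G := G) (by omega) (by rw [hGq]; exact hδ) (by omega) hp
      (by rw [hGn, hGL]; exact hL.le_pow) (by rw [hGL]; exact hL.two_le) happ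
    exact ⟨fun h => hdec.1 (this.2 h), fun h => hdec.2 fun h' => h (this.1 h')⟩

end Gadget

/-! ### The resources of the reduction -/

/-- The polylogarithmic factor costs half of the saving: the logarithm is `O(n ^ (ε / 8))`, and it
occurs with exponent at most 4, because `C₁ * l ^ 2 ≥ 1` allows the exponent `2 - ε` to be raised to
2 on this factor. -/
theorem exists_rpow_bound {ε C₁ : ℝ} (hε : 0 < ε) (hε1 : ε ≤ 1) (hC : 1 ≤ C₁) :
    ∃ C₂ : ℝ, ∀ n : ℕ, 1 ≤ n → ∀ N : ℝ, 0 ≤ N → N ≤ C₁ * n * (Real.logb 2 n + 3) ^ 2 →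
      N ^ (2 - ε) ≤ C₂ * (n : ℝ) ^ (2 - ε / 2) := by
  set K := 1 / (ε / 8 * Real.log 2) + 3 with hK
  have hl2 : 0 < Real.log 2 := Real.log_pos (by norm_num)
  refine ⟨C₁ ^ 2 * K ^ 4, fun n hn N hN0 hN => ?_⟩
  have hn' : (1 : ℝ) ≤ n := by exact_mod_cast hn
  have hn0 : (0 : ℝ) < n := by linarith
  set l := Real.logb 2 n + 3 with hl
  have hlog : 0 ≤ Real.logb 2 n := Real.logb_nonneg (by norm_num) hn'
  have hl1 : 1 ≤ l := by linarith
  have hlK : l ≤ K * (n : ℝ) ^ (ε / 8) := by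
    have h1 := Real.log_le_rpow_div hn0.le (show 0 < ε / 8 by positivity)
    have h2 : (1 : ℝ) ≤ (n : ℝ) ^ (ε / 8) := Real.one_le_rpow hn' (by positivity)
    have h3 : Real.logb 2 n ≤ 1 / (ε / 8 * Real.log 2) * (n : ℝ) ^ (ε / 8) := by
      rw [Real.logb, div_le_iff₀ hl2]
      refine h1.trans (le_of_eq ?_)
      field_simp
    rw [hK, add_mul]
    linarith
  have hl4 : l ^ 4 ≤ K ^ 4 * (n : ℝ) ^ (ε / 2) := by
    refine (pow_le_pow_left₀ (by linarith) hlK 4).trans (le_of_eq ?_)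
    rw [mul_pow, ← Real.rpow_natCast ((n : ℝ) ^ (ε / 8)), ← Real.rpow_mul hn0.le]
    congr 2
    push_cast
    ring
  have hK0 : 0 < K := by positivity
  calc N ^ (2 - ε) ≤ (C₁ * n * l ^ 2) ^ (2 - ε) := Real.rpow_le_rpow hN0 hN (by linarith)
    _ = (C₁ * l ^ 2) ^ (2 - ε) * (n : ℝ) ^ (2 - ε) := by
        rw [mul_right_comm, Real.mul_rpow (by positivity) hn0.le]
    _ ≤ (C₁ * l ^ 2) ^ (2 : ℝ) * (n : ℝ) ^ (2 - ε) := by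
        refine mul_le_mul_of_nonneg_right (Real.rpow_le_rpow_of_exponent_le ?_ (by linarith))
          (by positivity)
        exact one_le_mul_of_one_le_of_one_le hC (one_le_pow₀ hl1)
    _ = C₁ ^ 2 * (n : ℝ) ^ (2 - ε) * l ^ 4 := by
        rw [Real.rpow_two]
        ring
    _ ≤ C₁ ^ 2 * (n : ℝ) ^ (2 - ε) * (K ^ 4 * (n : ℝ) ^ (ε / 2)) :=
        mul_le_mul_of_nonneg_left hl4 (by positivity)
    _ = C₁ ^ 2 * K ^ 4 * ((n : ℝ) ^ (2 - ε) * (n : ℝ) ^ (ε / 2)) := by ring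
    _ = C₁ ^ 2 * K ^ 4 * (n : ℝ) ^ (2 - ε / 2) := by
        rw [← Real.rpow_add hn0]
        congr 2
        ring

namespace Gadget

variable {G : Gadget}

theorem sum_count : (G.fams.map EdgeFam.count).sum =
    G.X + G.rows * G.L + G.n + G.d + 2 * (G.n * G.d) + G.rows + G.pads := by
  simp only [fams, fam₁, fam₂, fam₃, fam₄, fam₅, fam₆, fam₇, fam₈, List.map_cons, List.map_nil,
    List.sum_cons, List.sum_nil]
  ring

theorem extra_le_N (hg : 1 ≤ G.g) : G.rows * G.L + G.n + 2 * (G.n * G.d) ≤ G.N := by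
  have h1 : G.X * (G.L + 2 * G.d + 4) ≤ G.pads := Nat.le_mul_of_pos_left _ hg
  have h2 : G.pads ≤ G.N := Nat.le_add_left _ _
  exact G.extra_le.trans (h1.trans h2)

theorem sum_count_le (hg : 1 ≤ G.g) : (G.fams.map EdgeFam.count).sum ≤ 2 * G.N := by
  have h1 := extra_le_N hg
  have hY : G.Y = G.X + G.d := rfl
  have hZ : G.Z = G.Y + G.rows := rfl
  have hN : G.N = G.Z + G.pads := rfl
  rw [sum_count]
  omega

theorem X_le_N : G.X ≤ G.N := by
  rw [N, Z, Y]
  omega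

theorem wid_le_N : G.wid ≤ G.N := (Nat.le_add_left _ _).trans X_le_N

theorem fits {B : ℕ} (hg : 1 ≤ G.g) (hL : IsLog G.n G.L) (hB : 16 * G.N ≤ B) : G.Fits B := by
  have h1 := extra_le_N hg
  have h2 := sum_count_le hg
  have h3 := G.wid_pos
  have h4 := G.wid_le_N
  refine ⟨by omega, ?_, by omega, by omega, by omega⟩
  have h5 : (G.n + 2 ^ G.L) * G.wid ≤ (5 * G.n) * G.wid :=
    Nat.mul_le_mul_right _ (by have := hL.pow_le; omega)
  have h6 : G.rows ≤ G.N := (Nat.le_add_right _ _).trans X_le_N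
  have h7 : 5 * G.n * G.wid = 5 * G.rows := mul_assoc _ _ _
  omega

theorem m_graph : G.graph.m = G.edges.length := WDigraph.ofPairs_m

theorem inputSize_le (hg : 1 ≤ G.g) : inputSize G.graph.encode + 2 ≤ 16 * G.N := by
  have h1 : G.edges.length ≤ 2 * G.N :=
    (length_edges_le.trans (le_of_eq sum_count.symm)).trans (sum_count_le hg)
  have h2 := G.wid_pos
  have h3 := G.wid_le_N
  have h4 : G.graph.encode.foldr max 0 ≤ 2 * G.N := by
    rw [encode_graph]
    refine foldr_max_le fun x hx => ?_
    simp only [List.mem_cons, List.mem_flatMap, List.not_mem_nil, or_false] at hx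
    rcases hx with rfl | rfl | ⟨e, he, hx⟩
    · omega
    · exact h1
    · have := (mem_edges.1 he).lt
      omega
  rw [inputSize, WDigraph.length_encode, m_graph]
  omega

/-- All parts of the graph are cubic in `s` up to constants: `4 + 1 + 4 + 28 = 37`, and `592 = 16 *
37`. The constant factor `a` becomes part of the exponent through `a ≤ 2 ^ a ≤ s ^ a`. -/
theorem N_le_pow {s : ℕ} (hg : 1 ≤ G.g) (hL : IsLog G.n G.L) (hn : G.n + 4 ≤ s) (hd : G.d + 4 ≤ s) :
    16 * G.N ≤ s ^ (592 * (G.g * (G.q + 1)) + 3) := by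
  have hL' : G.L ≤ 4 * s := by
    have h1 : G.L < 2 ^ G.L := Nat.lt_two_pow_self
    have h2 := hL.pow_le
    omega
  have hwid : G.wid ≤ 4 * (G.q + 1) * s := by
    have : G.q * G.L ≤ G.q * (4 * s) := Nat.mul_le_mul_left _ hL'
    have h2 : 4 * (G.q + 1) * s = G.q * (4 * s) + 4 * s := by ring
    have h3 : G.wid = G.q * G.L + 1 := rfl
    omega
  have hX : G.X ≤ 4 * (G.q + 1) * s ^ 2 := by
    rw [X_eq]
    calc (G.n + 1) * G.wid ≤ s * (4 * (G.q + 1) * s) := Nat.mul_le_mul (by omega) hwid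
      _ = _ := by ring
  have hpads : G.pads ≤ 28 * (G.g * (G.q + 1)) * s ^ 3 := by
    calc G.pads ≤ G.g * (4 * (G.q + 1) * s ^ 2 * (7 * s)) :=
          Nat.mul_le_mul_left _ (Nat.mul_le_mul hX (by omega))
      _ = _ := by ring
  have hs3 : s ^ 2 ≤ s ^ 3 := Nat.pow_le_pow_right (by omega) (by norm_num)
  have hs1 : s ≤ s ^ 3 := Nat.le_self_pow (by norm_num) s
  have hgq : G.q + 1 ≤ G.g * (G.q + 1) := Nat.le_mul_of_pos_left _ hg
  have hX' : G.X ≤ 4 * (G.g * (G.q + 1)) * s ^ 3 :=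
    hX.trans (Nat.mul_le_mul (by omega) hs3)
  have hd' : G.d ≤ (G.g * (G.q + 1)) * s ^ 3 :=
    (by omega : G.d ≤ s ^ 3).trans (Nat.le_mul_of_pos_left _ (by omega))
  have hr : G.rows ≤ G.X := Nat.le_add_right _ _
  have hN : G.N = G.X + G.d + G.rows + G.pads := rfl
  have h1 : 16 * G.N ≤ 592 * (G.g * (G.q + 1)) * s ^ 3 := by
    rw [mul_assoc] at hpads hX' ⊢
    omega
  have h2 : 592 * (G.g * (G.q + 1)) ≤ s ^ (592 * (G.g * (G.q + 1))) :=
    Nat.lt_two_pow_self.le.trans (Nat.pow_le_pow_left (by omega) _)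
  rw [pow_add]
  exact h1.trans (Nat.mul_le_mul_right _ h2)

/-- The rows have `O(n log n)` vertices, and the pads multiply this by `L + 2d + 4 = O(log n)`. -/
theorem N_le_log {c : ℝ} (hc : 1 ≤ c) (hn : 1 ≤ G.n) (hL : IsLog G.n G.L)
    (hd : (G.d : ℝ) ≤ c * Real.logb 2 G.n) :
    (G.N : ℝ) ≤ (4 * (G.q + 1) + c + 2 * G.g * (G.q + 1) * (2 * c + 3)) * G.n *
      (Real.logb 2 G.n + 3) ^ 2 := by
  have hn' : (1 : ℝ) ≤ G.n := by exact_mod_cast hn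
  have hlog : 0 ≤ Real.logb 2 G.n := Real.logb_nonneg (by norm_num) hn'
  have hL' : (G.L : ℝ) ≤ Real.logb 2 G.n + 3 := by
    have h1 : ((2 ^ G.L : ℕ) : ℝ) ≤ ((4 * G.n : ℕ) : ℝ) := by exact_mod_cast hL.pow_le
    push_cast at h1
    have h2 : (G.L : ℝ) ≤ Real.logb 2 (4 * G.n) := by
      rw [Real.le_logb_iff_rpow_le (by norm_num) (by positivity), Real.rpow_natCast]
      exact h1
    rw [Real.logb_mul (by norm_num) (by positivity),
      show (4 : ℝ) = 2 ^ (2 : ℝ) by norm_num, Real.logb_rpow (by norm_num) (by norm_num)] at h2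
    linarith
  set l := Real.logb 2 G.n + 3 with hl
  have hl3 : 3 ≤ l := by linarith
  have hq : (0 : ℝ) ≤ G.q := Nat.cast_nonneg _
  have hg : (0 : ℝ) ≤ G.g := Nat.cast_nonneg _
  have hwid : (G.wid : ℝ) ≤ (G.q + 1) * l := by
    have h1 : (G.wid : ℝ) = G.q * G.L + 1 := by simp [wid, len]
    rw [h1]
    nlinarith
  have hX : (G.X : ℝ) ≤ 2 * (G.q + 1) * (G.n * l) := by
    rw [X_eq]
    push_cast
    calc ((G.n : ℝ) + 1) * G.wid ≤ (2 * G.n) * ((G.q + 1) * l) :=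
          mul_le_mul (by linarith) hwid (Nat.cast_nonneg _) (by positivity)
      _ = _ := by ring
  have hdl : (G.d : ℝ) ≤ c * l := hd.trans (mul_le_mul_of_nonneg_left (by linarith) (by linarith))
  have hpads : (G.pads : ℝ) ≤ 2 * G.g * (G.q + 1) * (2 * c + 3) * (G.n * l ^ 2) := by
    rw [pads]
    push_cast
    calc (G.g : ℝ) * (G.X * (G.L + 2 * G.d + 4)) ≤
        G.g * ((2 * (G.q + 1) * (G.n * l)) * ((2 * c + 3) * l)) := by
          refine mul_le_mul_of_nonneg_left (mul_le_mul hX ?_ (by positivity) (by positivity)) hg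
          linarith
      _ = _ := by ring
  have hN : (G.N : ℝ) ≤ 2 * G.X + G.d + G.pads := by
    have h1 : G.N = G.X + G.d + G.rows + G.pads := rfl
    have h2 : G.rows ≤ G.X := Nat.le_add_right _ _
    have h3 : G.N ≤ 2 * G.X + G.d + G.pads := by omega
    exact_mod_cast h3
  have h1 : (G.n : ℝ) * l ≤ G.n * l ^ 2 := by
    refine mul_le_mul_of_nonneg_left ?_ (by linarith)
    nlinarith
  have h2 : l ≤ G.n * l ^ 2 := by nlinarith
  have h3 : 2 * (G.q + 1 : ℝ) * (G.n * l) ≤ 2 * (G.q + 1) * (G.n * l ^ 2) :=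
    mul_le_mul_of_nonneg_left h1 (by positivity)
  have h4 : c * l ≤ c * (G.n * l ^ 2) := mul_le_mul_of_nonneg_left h2 (by linarith)
  calc (G.N : ℝ) ≤ 2 * (2 * (G.q + 1) * (G.n * l ^ 2)) + c * (G.n * l ^ 2) +
        2 * G.g * (G.q + 1) * (2 * c + 3) * (G.n * l ^ 2) := by linarith
    _ = _ := by ring

end Gadget

/-- A fast approximation algorithm for the Min-Radius refutes the Hitting Set Conjecture. -/
theorem not_hittingSetConjecture {δ ε K : ℝ} (hδ : 0 < δ) (hε : 0 < ε) (hK : 1 < K)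
    (h : ∃ (P : Prog) (κ : ℕ) (C : ℝ), ApproximatesMinRadius P κ (2 - δ)
      (fun G => G.IsDAG ∧ (∀ e ∈ G.edges, e.2.2 = 1) ∧ (G.m : ℝ) ≤ K * (G.n : ℝ))
      (fun G => C * (G.n : ℝ) ^ (2 - ε))) : ¬ HittingSetConjecture := by
  obtain ⟨P, κ, C, hP⟩ := h
  -- The row length factor `q` is chosen so that `2q / (q + 1)` exceeds `2 - δ`.
  obtain ⟨q, hq, hqδ⟩ : ∃ q : ℕ, 1 ≤ q ∧ 2 < δ * (q + 1) := by
    refine ⟨⌈2 / δ⌉₊, Nat.one_le_iff_ne_zero.2 (Nat.ceil_pos.2 (by positivity)).ne', ?_⟩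
    have h1 := Nat.le_ceil (2 / δ)
    rw [div_le_iff₀ hδ] at h1
    linarith
  -- The multiplicity `g` of the pads is chosen so that the excess edges amount to at most a
  -- fraction `K - 1` of the vertices.
  obtain ⟨g, hg, hgK⟩ : ∃ g : ℕ, 1 ≤ g ∧ 1 ≤ g * (K - 1) := by
    have hK' : 0 < K - 1 := by linarith
    refine ⟨⌈1 / (K - 1)⌉₊, Nat.one_le_iff_ne_zero.2 (Nat.ceil_pos.2 (by positivity)).ne', ?_⟩
    have h1 := Nat.le_ceil (1 / (K - 1))
    rwa [div_le_iff₀ hK'] at h1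
  -- With `ε₁ ≤ 1` the exponent `2 - ε₁` is at least 1, so the linear cost of building the graph is
  -- dominated.
  set ε₁ := min ε 1 with hε₁
  have hε₁0 : 0 < ε₁ := lt_min hε one_pos
  have hε₁1 : ε₁ ≤ 1 := min_le_right _ _
  rw [HittingSetConjecture, not_not]
  refine ⟨ε₁ / 2, by positivity, fun c hc => ?_⟩
  obtain ⟨C₂, hC₂⟩ := exists_rpow_bound (C₁ := 4 * (q + 1) + c + 2 * g * (q + 1) * (2 * c + 3))
    hε₁0 hε₁1 (by
      have : (0 : ℝ) ≤ 2 * g * (q + 1) * (2 * c + 3) := by positivity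
      have : (0 : ℝ) ≤ q := Nat.cast_nonneg _
      linarith)
  set κ₀ := 592 * (g * (q + 1)) + 3 with hκ₀
  -- The graph encoding has size at most `s ^ κ₀`, so words for its `κ`-th power, and for the
  -- construction itself, fit into `s ^ (κ₀ * (κ + 1))`. The absolute value guards against a
  -- negative `C`.
  refine ⟨Gadget.decideProg P q g, κ₀ * (κ + 1), (270 + |C|) * C₂, fun n d hn hd A B => ?_⟩
  set x := encodeHSE A B with hx
  have hx0 : x.getD 0 0 = n := rfl
  have hx1 : x.getD 1 0 = d := rfl
  set s := inputSize x + 2 with hs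
  have hlen : x.length = 2 * (n * d) + 2 := by
    rw [hx, encodeHSE, List.length_cons, List.length_cons, List.length_append, length_encodeSets,
      length_encodeSets]
    ring
  have hns : n + 4 ≤ s := by
    have := getD_le_foldr_max x 0
    rw [hs, inputSize]
    omega
  have hds : d + 4 ≤ s := by
    have := getD_le_foldr_max x 1
    rw [hs, inputSize]
    omega
  have hN : ∀ L, Gadget.IsLog n L → 16 * (Gadget.ofInput q g n d L fun i => x.getD i 0).N ≤ s ^ κ₀ :=
    fun L hL => Gadget.N_le_pow hg hL hns hds
  have hpow : s ^ (κ₀ * (κ + 1)) = (s ^ κ₀) ^ (κ + 1) := pow_mul _ _ _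
  have hpow1 : s ^ κ₀ ≤ s ^ (κ₀ * (κ + 1)) := by
    rw [hpow]
    exact Nat.le_self_pow (by omega) _
  have hN1 : ∀ L, 1 ≤ (Gadget.ofInput q g n d L fun i => x.getD i 0).N := fun L =>
    Gadget.wid_pos.trans_le Gadget.wid_le_N
  have hrun : ∀ L, Gadget.IsLog n L → Runs (s ^ (κ₀ * (κ + 1))) P
      (initState (Gadget.ofInput q g n d L fun i => x.getD i 0).graph.encode)
      ⌊|C| * ((Gadget.ofInput q g n d L fun i => x.getD i 0).N : ℝ) ^ (2 - ε₁)⌋₊ fun s =>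
        IsApprox (2 - δ) (Gadget.ofInput q g n d L fun i => x.getD i 0).graph.minRadius s.output := by
    intro L hL
    obtain ⟨t, s', he, ht, happ⟩ := hP (Gadget.ofInput q g n d L fun i => x.getD i 0).graph (hN1 L)
      ⟨Gadget.isDAG_graph, WDigraph.ofPairs_weight, by
        rw [Gadget.m_graph]
        exact Gadget.length_edges_le_mul hgK hK⟩
    have hN1' : (1 : ℝ) ≤ (Gadget.ofInput q g n d L fun i => x.getD i 0).N := by exact_mod_cast hN1 L
    refine ⟨t, s', he.mono ?_, Nat.le_floor (ht.trans ?_), happ⟩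
    · have h1 := (Gadget.inputSize_le (G := Gadget.ofInput q g n d L fun i => x.getD i 0) hg).trans (hN L hL)
      rw [hpow]
      exact (Nat.pow_le_pow_left h1 κ).trans (Nat.pow_le_pow_right (by omega) (by omega))
    · refine mul_le_mul (le_abs_self C) (Real.rpow_le_rpow_of_exponent_le hN1' ?_) (by positivity)
        (abs_nonneg C)
      have : ε₁ ≤ ε := min_le_left _ _
      linarith
  have hqB : q ≤ s ^ (κ₀ * (κ + 1)) := by
    have h1 : q ≤ 592 * (g * (q + 1)) := by nlinarith
    have h2 : κ₀ < 2 ^ κ₀ := Nat.lt_two_pow_self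
    have h3 : 2 ^ κ₀ ≤ s ^ κ₀ := Nat.pow_le_pow_left (by omega) _
    omega
  obtain ⟨L, hL, t, s', he, ht, hdec⟩ := Gadget.decideProg_runs (P := P) hg hn hq hqδ hx0 hx1 hqB
    (fun L hL => Gadget.fits hg hL ((hN L hL).trans hpow1)) hrun
  refine ⟨t, s', he, ?_, ?_⟩
  · have hsum := Gadget.sum_count_le (G := Gadget.ofInput q g n d L fun i => x.getD i 0) hg
    have hnN : n ≤ (Gadget.ofInput q g n d L fun i => x.getD i 0).N :=
      (Gadget.n_le_X (G := Gadget.ofInput q g n d L fun i => x.getD i 0)).trans Gadget.X_le_N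
    have hlogN := Gadget.N_le_log (G := Gadget.ofInput q g n d L fun i => x.getD i 0) hc hn hL hd
    have hN1' := hN1 L
    have hN2 := hC₂ n hn _ (Nat.cast_nonneg _) hlogN
    generalize Gadget.ofInput q g n d L (fun i => x.getD i 0) = G at hsum hnN hN1' hN2 ht
    have hN1'' : (1 : ℝ) ≤ G.N := by exact_mod_cast hN1'
    have h1 : (G.N : ℝ) ≤ (G.N : ℝ) ^ (2 - ε₁) := Real.self_le_rpow_of_one_le hN1'' (by linarith)
    have h2 : (⌊|C| * (G.N : ℝ) ^ (2 - ε₁)⌋₊ : ℝ) ≤ |C| * (G.N : ℝ) ^ (2 - ε₁) :=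
      Nat.floor_le (by positivity)
    -- `270 = 10 + 2 * 30 + 200`, from `n ≤ N`, at most `2N` edge candidates, and `1 ≤ N`.
    have h3 : t ≤ 270 * G.N + ⌊|C| * (G.N : ℝ) ^ (2 - ε₁)⌋₊ := by omega
    have h4 : (t : ℝ) ≤ 270 * G.N + ⌊|C| * (G.N : ℝ) ^ (2 - ε₁)⌋₊ := by exact_mod_cast h3
    calc (t : ℝ) ≤ (270 + |C|) * (G.N : ℝ) ^ (2 - ε₁) := by linarith
      _ ≤ (270 + |C|) * (C₂ * (n : ℝ) ^ (2 - ε₁ / 2)) :=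
          mul_le_mul_of_nonneg_left hN2 (by positivity)
      _ = _ := by ring
  · exact ⟨fun h => hdec.1 ((hits_iff_hasHittingSet A B).2 h),
      fun h => hdec.2 fun h' => h ((hits_iff_hasHittingSet A B).1 h')⟩

end MinRad

theorem mainTheorem8 :
    (∃ (P : MinRad.Prog) (κ : ℕ) (C : ℝ), ∀ M : ℕ, 1 ≤ M →
      MinRad.ApproximatesMinRadius P κ 3
        (fun G => G.IsDAG ∧ ∀ e ∈ G.edges, e.2.2 ≤ M)
        (fun G => C * ((G.m : ℝ) + 1) * Real.sqrt (G.n : ℝ) *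
          Real.log ((M : ℝ) * (G.n : ℝ) + 1))) ∧
    (∀ δ ε K : ℝ, 0 < δ → 0 < ε → 1 < K →
      (∃ (P : MinRad.Prog) (κ : ℕ) (C : ℝ),
        MinRad.ApproximatesMinRadius P κ (2 - δ)
          (fun G => G.IsDAG ∧ (∀ e ∈ G.edges, e.2.2 = 1) ∧ (G.m : ℝ) ≤ K * (G.n : ℝ))
          (fun G => C * (G.n : ℝ) ^ (2 - ε))) →
      ¬ MinRad.HittingSetConjecture) :=
  ⟨MinRad.exists_approximation, fun _ _ _ hδ hε hK h => MinRad.not_hittingSetConjecture hδ hε hK h⟩
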